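/- **Digraphs and the problem.** A digraph is a finite set of vertices with a set of arcs, an arc being an ordered pair of distinct vertices. An instance of the *subset sum problem with digraph constraint* (SSG) consists of $n\ge 1$ items $a_1,\dots,a_n$ with positive integer sizes $s_1,\dots,s_n$, a positive integer capacity $c$, and a digraph $G=(A,E)$ on the item set $A=\{a_1,\dots,a_n\}$. A set $A'\subseteq A$ is *feasible* if $\sum_{a_j\in A'}s_j\le c$ and every $y\in A$ that has at least one predecessor in $A'$ (some $x\in A'$ with $(x,y)\in E$) belongs to $A'$. The task is to find a feasible set $A'$ that maximizes $\sum_{a_j\in A'}s_j$. **Directed co-graphs.** The class of directed co-graphs is the smallest class of digraphs that contains every one-vertex digraph and contains, with any two vertex-disjoint members $G_1=(V_1,E_1)$ and $G_2=(V_2,E_2)$, their disjoint union $(V_1\cup V_2,\,E_1\cup E_2)$, their order composition $(V_1\cup V_2,\,E_1\cup E_2\cup (V_1\times V_2))$, and their series composition $(V_1\cup V_2,\,E_1\cup E_2\cup (V_1\times V_2)\cup (V_2\times V_1))$. **Theorem.** SSG on directed co-graphs with $n$ vertices and $m$ arcs can be solved in $\mathcal O(n\cdot c^2+m)$ time and $\mathcal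 O(n\cdot c)$ space. Precisely: there are one program for a random access machine and one constant $K$ such that, for every SSG instance whose digraph $G$ is a directed co-graph with $n$ vertices and $m$ arcs, given in read-only input by $n$, $c$, the sizes and an adjacency list of the successors of each vertex (in any order), the program halts after at most $K(nc^2+m)$ steps, uses at most $K\,n\,c$ work cells in addition to the input and a constant number of registers, and outputs an optimal solution $A'$ as a $0/1$-vector in its work memory. Each arithmetic operation (addition, truncated subtraction, multiplication, comparison) and each access to a register, to the input or to the work memory counts as one step, and all numbers that occur during the computation are smaller than $\left(n+c+\sum_j s_j\right)^K$, that is, machine words have $\mathcal O\!\left(\log\left(n+c+\sum_j s_j\right)\right)$ bits. -/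

import Mathlib

/-! ## Directed co-graphs -/

/-- Expressions over the vertex set `V` built from single vertices by disjoint union,
series composition and order composition. -/
inductive DiCoExpr (V : Type) : Type
  | vertex (v : V) : DiCoExpr V
  | union (X Y : DiCoExpr V) : DiCoExpr V
  | series (X Y : DiCoExpr V) : DiCoExpr V
  | order (X Y : DiCoExpr V) : DiCoExpr V

namespace DiCoExpr

variable {V : Type}

/-- The vertices of the digraph defined by an expression. -/
def verts : DiCoExpr V → Set V
  | vertex v => {v}
  | union X Y => X.verts ∪ Y.verts
  | series X Y => X.verts ∪ Y.verts
  | order X Y => X.verts ∪ Y.verts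

/-- Operations are applied to vertex-disjoint digraphs only. -/
def Valid : DiCoExpr V → Prop
  | vertex _ => True
  | union X Y => X.Valid ∧ Y.Valid ∧ Disjoint X.verts Y.verts
  | series X Y => X.Valid ∧ Y.Valid ∧ Disjoint X.verts Y.verts
  | order X Y => X.Valid ∧ Y.Valid ∧ Disjoint X.verts Y.verts

/-- The arcs of the digraph defined by an expression: a disjoint union adds no arc, an order
composition adds all arcs from the first digraph to the second, and a series composition adds
all arcs between the two digraphs, in both directions. -/
def Arc : DiCoExpr V → V → V → Prop
  | vertex _, _, _ => False
  | union X Y, u, v => X.Arc u v ∨ Y.Arc u v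
  | series X Y, u, v => X.Arc u v ∨ Y.Arc u v ∨
      (u ∈ X.verts ∧ v ∈ Y.verts) ∨ (u ∈ Y.verts ∧ v ∈ X.verts)
  | order X Y, u, v => X.Arc u v ∨ Y.Arc u v ∨ (u ∈ X.verts ∧ v ∈ Y.verts)

end DiCoExpr

/-- A digraph with vertex set `V` is a directed co-graph if some expression defines it. -/
def IsDirectedCograph {V : Type} (G : Digraph V) : Prop :=
  ∃ X : DiCoExpr V, X.Valid ∧ X.verts = Set.univ ∧ ∀ u v, G.Adj u v ↔ X.Arc u v

/-! ## The subset sum problem with digraph constraint -/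

/-- An instance with the `n` items `0, …, n - 1`: a digraph without loops on the items, positive
item sizes and a positive capacity. -/
structure SSGInstance (n : ℕ) where
  graph : Digraph (Fin n)
  loopless : ∀ v, ¬ graph.Adj v v
  size : Fin n → ℕ
  size_pos : ∀ v, 0 < size v
  cap : ℕ
  cap_pos : 0 < cap

namespace SSGInstance

variable {n : ℕ}

/-- The total size of a set of items. -/
def total (I : SSGInstance n) (A : Finset (Fin n)) : ℕ := ∑ v ∈ A, I.size v

/-- The capacity constraint together with the digraph constraint: an item that has a predecessor
in the solution is itself in the solution. -/
def Feasible (I : SSGInstance n) (A : Finset (Fin n)) : Prop :=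
  I.total A ≤ I.cap ∧ ∀ y, (∃ x ∈ A, I.graph.Adj x y) → y ∈ A

/-- A feasible set of maximum total size. -/
def IsOptimal (I : SSGInstance n) (A : Finset (Fin n)) : Prop :=
  I.Feasible A ∧ ∀ B, I.Feasible B → I.total B ≤ I.total A

/-- The number of arcs. -/
noncomputable def numArcs (I : SSGInstance n) : ℕ :=
  {p : Fin n × Fin n | I.graph.Adj p.1 p.2}.ncard

/-- `adj v` lists the successors of `v`, each once, in an arbitrary order. -/
def IsAdjacencyLists (I : SSGInstance n) (adj : Fin n → List (Fin n)) : Prop :=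
  ∀ v, (adj v).Nodup ∧ ∀ w, w ∈ adj v ↔ I.graph.Adj v w

/-- The input words for an instance given by adjacency lists. They are `n`, the capacity, the `n`
sizes, then `n + 1` offsets, and finally the concatenation of the lists of the vertices
`0, …, n - 1`; the list of vertex `v` occupies in this concatenation the positions from the
`v`-th offset (inclusive) to the `(v + 1)`-st offset (exclusive). -/
def encode (I : SSGInstance n) (adj : Fin n → List (Fin n)) : List ℕ :=
  [n, I.cap] ++ List.ofFn I.size
    ++ (List.range (n + 1)).map (fun i => (((List.ofFn adj).take i).map List.length).sum)
    ++ (List.ofFn adj).flatten.map Fin.val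

end SSGInstance

/-! ## Random access machines

A program works on finitely many registers (those that it names), on a read-only array of input
words, and on a work memory that is addressed indirectly. All three hold natural numbers that
fit into a machine word. Control flow is structured, by conditionals and loops. -/

/-- Expressions; every node is one operation of the machine. -/
inductive RamExpr : Type
  | lit (k : ℕ) : RamExpr
  | reg (r : ℕ) : RamExpr
  | input (a : RamExpr) : RamExpr
  | load (a : RamExpr) : RamExpr
  | add (a b : RamExpr) : RamExpr
  | sub (a b : RamExpr) : RamExpr
  | mul (a b : RamExpr) : RamExpr
  | lt (a b : RamExpr) : RamExpr
  | eq (a b : RamExpr) : RamExpr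

/-- Programs. `assign r e` writes a register, `store a e` writes the work cell with address `a`;
a test succeeds if its value is not `0`. -/
inductive RamProg : Type
  | skip : RamProg
  | assign (r : ℕ) (e : RamExpr) : RamProg
  | store (a e : RamExpr) : RamProg
  | seq (P Q : RamProg) : RamProg
  | cond (e : RamExpr) (P Q : RamProg) : RamProg
  | loop (e : RamExpr) (P : RamProg) : RamProg

/-- The contents of the registers and of the work memory. -/
structure RamState where
  reg : ℕ → ℕ
  mem : ℕ → ℕ

/-- All registers and all work cells hold `0` at the start. -/
def RamState.start : RamState := ⟨fun _ => 0, fun _ => 0⟩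

/-- The resources of a run: the input words, the number of work cells (with the addresses
`0, …, cells - 1`), and a strict upper bound for the numbers that fit into a word. -/
structure RamSetup where
  input : List ℕ
  cells : ℕ
  bound : ℕ

/-- A number that does not fit into a word is an error. -/
def RamSetup.word (M : RamSetup) (k : ℕ) : Option ℕ := if k < M.bound then some k else none

namespace RamExpr

/-- The number of operations that the evaluation takes. -/
def cost : RamExpr → ℕ
  | lit _ => 1
  | reg _ => 1
  | input a => a.cost + 1
  | load a => a.cost + 1
  | add a b => a.cost + b.cost + 1
  | sub a b => a.cost + b.cost + 1
  | mul a b => a.cost + b.cost + 1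
  | lt a b => a.cost + b.cost + 1
  | eq a b => a.cost + b.cost + 1

/-- The value of an expression, or `none` if the evaluation produces a number that does not fit
into a word, or reads outside the input or outside the work memory. Subtraction is truncated
at `0`. -/
def eval (M : RamSetup) (σ : RamState) : RamExpr → Option ℕ
  | lit k => M.word k
  | reg r => some (σ.reg r)
  | input a => (a.eval M σ).bind fun x => (M.input[x]?).bind M.word
  | load a => (a.eval M σ).bind fun x => if x < M.cells then some (σ.mem x) else none
  | add a b => (a.eval M σ).bind fun x => (b.eval M σ).bind fun y => M.word (x + y)
  | sub a b => (a.eval M σ).bind fun x => (b.eval M σ).bind fun y => M.word (x - y)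
  | mul a b => (a.eval M σ).bind fun x => (b.eval M σ).bind fun y => M.word (x * y)
  | lt a b => (a.eval M σ).bind fun x => (b.eval M σ).bind fun y =>
      M.word (if x < y then 1 else 0)
  | eq a b => (a.eval M σ).bind fun x => (b.eval M σ).bind fun y =>
      M.word (if x = y then 1 else 0)

end RamExpr

/-- `RamRun M P σ t τ`: started in state `σ`, the program `P` halts without an error after exactly
`t` steps in state `τ`. An error in an evaluation and a write outside the work memory have no
rule, so that a run never leaves the resources of `M`. -/
inductive RamRun (M : RamSetup) : RamProg → RamState → ℕ → RamState → Prop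
  | skip (σ : RamState) : RamRun M .skip σ 1 σ
  | assign {r : ℕ} {e : RamExpr} {σ : RamState} {x : ℕ} (he : e.eval M σ = some x) :
      RamRun M (.assign r e) σ (e.cost + 1) { σ with reg := Function.update σ.reg r x }
  | store {a e : RamExpr} {σ : RamState} {i x : ℕ} (ha : a.eval M σ = some i)
      (hi : i < M.cells) (he : e.eval M σ = some x) :
      RamRun M (.store a e) σ (a.cost + e.cost + 1) { σ with mem := Function.update σ.mem i x }
  | seq {P Q : RamProg} {σ ρ τ : RamState} {s t : ℕ} (hP : RamRun M P σ s ρ)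
      (hQ : RamRun M Q ρ t τ) : RamRun M (.seq P Q) σ (s + t) τ
  | cond_true {e : RamExpr} {P Q : RamProg} {σ τ : RamState} {x t : ℕ}
      (he : e.eval M σ = some x) (hx : x ≠ 0) (hP : RamRun M P σ t τ) :
      RamRun M (.cond e P Q) σ (e.cost + 1 + t) τ
  | cond_false {e : RamExpr} {P Q : RamProg} {σ τ : RamState} {t : ℕ}
      (he : e.eval M σ = some 0) (hQ : RamRun M Q σ t τ) :
      RamRun M (.cond e P Q) σ (e.cost + 1 + t) τ
  | loop_true {e : RamExpr} {P : RamProg} {σ ρ τ : RamState} {x s t : ℕ}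
      (he : e.eval M σ = some x) (hx : x ≠ 0) (hP : RamRun M P σ s ρ)
      (hL : RamRun M (.loop e P) ρ t τ) : RamRun M (.loop e P) σ (e.cost + 1 + s + t) τ
  | loop_false {e : RamExpr} {P : RamProg} {σ : RamState} (he : e.eval M σ = some 0) :
      RamRun M (.loop e P) σ (e.cost + 1) σ

/-!
# Subset sum with digraph constraint on directed co-graphs

*Reduction to a preorder.* Write `R u v` if `v` can be reached from `u`. A set is feasible if and
only if it is closed under `R` and its total size is at most `c` (`SSGInstance.isUpSet_map_iff`). A
vertex belongs to a feasible set if and only if its up-set has total size at most `c`; such a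
vertex is *alive*, and since sizes are positive, its up-set has at most `c` members. A
breadth-first search from each vertex, abandoned when the total size exceeds `c`, lists all these
up-sets (`Search.prog_runs`); it looks at most at `O(c ^ 2)` arcs per vertex, because the successors
of a vertex are distinct and all of them are charged to the capacity.

*What is used about co-graphs.* No expression for the digraph has to be computed. The proof only
uses that `R` does not contain the pattern `N`: if `a` and `b` reach `c`, and `b` reaches `d`, then
`a` reaches `d`, or `a` and `b` are comparable, or `c` and `d` are (`DiCoExpr.nFree`).

*Elimination of twins.* Two vertices are twins if no third vertex that is left distinguishes them
with respect to `R`. The program finds an elimination sequence (`Net.ElimOk`), in which each vertex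
`X k` is a twin of a vertex `P k` that stays, until at most one vertex is left:
* Each strongly connected component is merged into its smallest vertex, its *leader*
  (`Components.prog_runs`).
* The leaders are inserted by increasing number of reachable vertices (`Order.prog_runs`), so that
  the up-set of a new vertex `v` is already present. Throughout, `R` on the inserted vertices that
  are left is the ancestor relation of a forest (`Forest`). The part of the up-set of `v` above the
  first level `d₀` at which it has several vertices is a chain. The remaining part is a module,
  since `R` contains no `N` (`Block.of_nFree`); as a union of sibling trees it can be contracted to a
  single vertex by repeatedly eliminating twins (`Contr`, `Contract.prog_runs`). Afterwards the
  up-set of `v` is a chain, and `v` becomes a leaf of the forest (`Forest.insert`,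
  `Insertion.prog_runs`). In the end the whole forest is contracted.

*Dynamic programming.* Each vertex that is left represents the cluster of the vertices merged into
it. For a cluster the program keeps its total size and the table of the amounts `s ≤ c` that can be
chosen from it. Because twins have the same relation to all other clusters, the choices before and
after a merge correspond to each other (`Net.Sol.merge`, `Net.Sol.split`): an amount for the merged
cluster is a sum of amounts for the two parts, where an arc from one part to the other requires that
nothing is chosen from the first, or everything from the second. A merge takes `O(c ^ 2)` steps, and
there are fewer than `n` of them (`Tables.prog_runs`). The largest entry in the table of the last
cluster is optimal, and a solution is found by undoing the merges (`Traceback.prog_runs`).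

*The machine.* Programs are written in a small language of commands (`Cmd`) with named registers and
arrays, which are interleaved in the work memory. `Runs E C s f Q` says that the compiled command
halts within `length * (f + 1)` steps in a state satisfying `Q`, without leaving the resources.
-/

/-! ### A small array language on top of the machine -/

/-- The registers of the program. The most important ones are the vertices `v`, `x`, `y` in question,
the number `em` of eliminated vertices, the number `num` of leaders, the segment of the array `row`
of length `len` that begins at `base`, and the vertex `w` to which a block is contracted. -/
inductive Reg
  | v | x | y | j | fin | len | head | wt | k | num | em | base | d | q | w | z | p | s | f | g
  | i | m | t
  deriving DecidableEq

/-- The arrays of the program. `out` is the output region, the other arrays are interleaved in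
the work memory behind it.
* `row` holds the lists of reachable vertices and `cnt` their lengths; `stamp` marks visited vertices.
* `lead v` is nonzero for the leaders `v`, and `ord` lists the leaders.
* `rep` marks the vertices of the forest; `dep` and `par` are their depths and parents, and `last y`
  is the successor of the child that is remembered at `y`, or `0`.
* `lx` and `lp` are the elimination sequence.
* `tab`, `cho` and `wgt` are the tables of the clusters, the splits, and the sizes of the clusters.
* `tgt` holds the amounts chosen from the clusters. -/
inductive Arr
  | out | stamp | row | cnt | lead | ord | rep | dep | par | last | lx | lp | tab | cho | wgt | tgt
  deriving DecidableEq

/-- The position of an array in the interleaved layout. -/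
def Arr.code : Arr → ℕ
  | out => 0 | stamp => 1 | row => 2 | cnt => 3 | lead => 4 | ord => 5 | rep => 6 | dep => 7
  | par => 8 | last => 9 | lx => 10 | lp => 11 | tab => 12 | cho => 13 | wgt => 14 | tgt => 15

/-- The number of a register on the machine. -/
def Reg.code : Reg → ℕ
  | v => 0 | x => 1 | y => 2 | j => 3 | fin => 4 | len => 5 | head => 6 | wt => 7 | k => 8
  | num => 9 | em => 10 | base => 11 | d => 12 | q => 13 | w => 14 | z => 15 | p => 16 | s => 17
  | f => 18 | g => 19 | i => 20 | m => 21 | t => 22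

theorem Reg.code_injective : Function.Injective Reg.code := by
  intro a b h
  cases a <;> cases b <;> first | rfl | (simp [Reg.code] at h)

theorem Arr.code_injective : Function.Injective Arr.code := by
  intro a b h
  cases a <;> cases b <;> first | rfl | (simp [Arr.code] at h)

theorem Arr.code_lt (k : Arr) : k.code < 16 := by cases k <;> simp [Arr.code]

/-- Expressions with named registers and arrays; `inp a` is the input word with the index `a`. -/
inductive Ex
  | lit (k : ℕ)
  | reg (r : Reg)
  | inp (a : Ex)
  | get (k : Arr) (a : Ex)
  | add (a b : Ex)
  | sub (a b : Ex)
  | mul (a b : Ex)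
  | lt (a b : Ex)
  | eq (a b : Ex)

/-- Commands with named registers and arrays. -/
inductive Cmd
  | skip
  | set (r : Reg) (e : Ex)
  | put (k : Arr) (a e : Ex)
  | seq (C D : Cmd)
  | ite (e : Ex) (C D : Cmd)
  | loop (e : Ex) (C : Cmd)

infixr:60 " ;; " => Cmd.seq

/-- The machine address of a cell of an array. -/
def Arr.addr (k : Arr) (a : RamExpr) : RamExpr :=
  match k with
  | .out => a
  | k => .add (.input (.lit 0)) (.add (.mul (.lit 16) a) (.lit k.code))

/-- Translation of expressions to the machine. -/
def Ex.compile : Ex → RamExpr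
  | lit k => .lit k
  | reg r => .reg r.code
  | inp a => .input a.compile
  | get k a => .load (k.addr a.compile)
  | add a b => .add a.compile b.compile
  | sub a b => .sub a.compile b.compile
  | mul a b => .mul a.compile b.compile
  | lt a b => .lt a.compile b.compile
  | eq a b => .eq a.compile b.compile

/-- Translation of commands to the machine. -/
def Cmd.compile : Cmd → RamProg
  | skip => .skip
  | set r e => .assign r.code e.compile
  | put k a e => .store (k.addr a.compile) e.compile
  | seq C D => .seq C.compile D.compile
  | ite e C D => .cond e.compile C.compile D.compile
  | .loop e C => .loop e.compile C.compile

/-- The size of a program; the running time is bounded by a multiple of it. -/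
def RamProg.length : RamProg → ℕ
  | skip => 1
  | assign _ e => e.cost + 1
  | store a e => a.cost + e.cost + 1
  | seq P Q => P.length + Q.length
  | cond e P Q => e.cost + 1 + P.length + Q.length
  | loop e P => e.cost + 1 + P.length

/-- The contents of the named registers and arrays. -/
structure St where
  reg : Reg → ℕ
  arr : Arr → ℕ → ℕ

/-- The state after writing a register. -/
def St.setR (s : St) (r : Reg) (x : ℕ) : St := { s with reg := Function.update s.reg r x }

/-- The state after writing an array cell. -/
def St.setA (s : St) (k : Arr) (i x : ℕ) : St :=
  { s with arr := Function.update s.arr k (Function.update (s.arr k) i x) }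

@[simp] theorem St.setR_reg (s : St) (r r' : Reg) (x : ℕ) :
    (s.setR r x).reg r' = if r' = r then x else s.reg r' := by
  simp [St.setR, Function.update_apply]

@[simp] theorem St.setR_arr (s : St) (r : Reg) (x : ℕ) : (s.setR r x).arr = s.arr := rfl

@[simp] theorem St.setA_reg (s : St) (k : Arr) (i x : ℕ) : (s.setA k i x).reg = s.reg := rfl

@[simp] theorem St.setA_arr (s : St) (k k' : Arr) (i x : ℕ) :
    (s.setA k i x).arr k' = if k' = k then Function.update (s.arr k) i x else s.arr k' := by
  simp [St.setA, Function.update_apply]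

/-- A machine together with the quantities that the proofs refer to: the number `n` of items, the
capacity `c`, and a bound `X` for all numbers that are kept in registers and cells. Intermediate
results of the evaluation of an expression are bounded by a power of `X`. Every array other than
`out` has `2 * (n * c)` cells, which suffices for `n` rows of length `c + 1`. -/
structure Env where
  M : RamSetup
  n : ℕ
  c : ℕ
  X : ℕ
  n_pos : 0 < n
  c_pos : 0 < c
  input_zero : M.input[0]? = some n
  input_one : M.input[1]? = some c
  le_X : ∀ a ∈ M.input, a ≤ X
  mul_le_X : 4 * ((n + 1) * (c + 1)) ≤ X
  X_lt : X ^ 60 < M.bound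
  cells : n + 16 * (2 * (n * c)) ≤ M.cells

namespace Env

variable (E : Env)

/-- The input words, with `0` outside of the input. -/
def inp (i : ℕ) : ℕ := E.M.input.getD i 0

/-- The number of cells of each array. -/
def lim : Arr → ℕ
  | .out => E.n
  | _ => 2 * (E.n * E.c)

/-- The machine address of a cell. -/
def loc (k : Arr) (i : ℕ) : ℕ := if k = .out then i else E.n + (16 * i + k.code)

theorem loc_lt {k : Arr} {i : ℕ} (h : i < E.lim k) : E.loc k i < E.M.cells := by
  have := E.cells
  have := k.code_lt
  unfold loc
  split_ifs with hk
  · subst hk; simp only [lim] at h; omega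
  · have : E.lim k = 2 * (E.n * E.c) := by cases k <;> first | rfl | exact absurd rfl hk
    omega

/-- Different cells have different addresses. -/
theorem loc_inj {k k' : Arr} {i i' : ℕ} (h : i < E.lim k) (h' : i' < E.lim k')
    (he : E.loc k i = E.loc k' i') : k = k' ∧ i = i' := by
  have h1 := k.code_lt
  have h2 := k'.code_lt
  unfold loc at he
  split_ifs at he with a b b
  · exact ⟨a.trans b.symm, he⟩
  · subst a; simp only [lim] at h; omega
  · subst b; simp only [lim] at h'; omega
  · exact ⟨Arr.code_injective (by omega), by omega⟩

theorem X_ge : 16 ≤ E.X := by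
  have := E.mul_le_X
  have h1 := E.n_pos
  have h2 := E.c_pos
  have : 2 * 2 ≤ (E.n + 1) * (E.c + 1) := Nat.mul_le_mul (by omega) (by omega)
  omega

theorem n_le_X : E.n + 1 ≤ E.X := by
  have := E.mul_le_X
  nlinarith [Nat.zero_le (E.n * E.c)]

theorem c_le_X : E.c + 1 ≤ E.X := by
  have := E.mul_le_X
  nlinarith [Nat.zero_le (E.n * E.c)]

theorem inp_le (i : ℕ) : E.inp i ≤ E.X := by
  unfold inp
  rw [List.getD_eq_getElem?_getD]
  cases h : E.M.input[i]? with
  | none => simp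
  | some a => exact E.le_X a (List.mem_of_getElem? h)

theorem word_eq {x m : ℕ} (hx : x ≤ E.X ^ m) (hm : m ≤ 60) : E.M.word x = some x := by
  have : E.X ^ m ≤ E.X ^ 60 := Nat.pow_le_pow_right (by have := E.X_ge; omega) hm
  have := E.X_lt
  unfold RamSetup.word
  rw [if_pos (by omega)]

end Env

namespace Ex

/-- The value of an expression. -/
def val (E : Env) (s : St) : Ex → ℕ
  | lit k => k
  | reg r => s.reg r
  | inp a => E.inp (a.val E s)
  | get k a => s.arr k (a.val E s)
  | add a b => a.val E s + b.val E s
  | sub a b => a.val E s - b.val E s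
  | mul a b => a.val E s * b.val E s
  | lt a b => if a.val E s < b.val E s then 1 else 0
  | eq a b => if a.val E s = b.val E s then 1 else 0

/-- All accesses of an expression to the input and to the arrays are within their bounds, and its
literals are at most `16`, so that they fit into words. -/
def Safe (E : Env) (s : St) : Ex → Prop
  | lit k => k ≤ 16
  | reg _ => True
  | inp a => a.Safe E s ∧ a.val E s < E.M.input.length
  | get k a => a.Safe E s ∧ a.val E s < E.lim k
  | add a b => a.Safe E s ∧ b.Safe E s
  | sub a b => a.Safe E s ∧ b.Safe E s
  | mul a b => a.Safe E s ∧ b.Safe E s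
  | lt a b => a.Safe E s ∧ b.Safe E s
  | eq a b => a.Safe E s ∧ b.Safe E s

end Ex

/-- A machine state represents an abstract state. -/
def Env.Rep (E : Env) (σ : RamState) (s : St) : Prop :=
  (∀ r : Reg, σ.reg r.code = s.reg r) ∧ ∀ k i, i < E.lim k → σ.mem (E.loc k i) = s.arr k i

/-- All stored numbers are at most `X`. -/
def Env.Ok (E : Env) (s : St) : Prop := (∀ r, s.reg r ≤ E.X) ∧ ∀ k i, s.arr k i ≤ E.X

theorem Arr.eval_addr {E : Env} {σ : RamState} {a : RamExpr} {k : Arr} {x m : ℕ}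
    (ha : a.eval E.M σ = some x) (hx : x ≤ E.X ^ m) (h1 : 1 ≤ m) (hm : m + 7 ≤ 60) :
    (k.addr a).eval E.M σ = some (E.loc k x) := by
  have hX := E.X_ge
  have hz : E.M.word 0 = some 0 := E.word_eq (m := 0) (by simp) (by simp)
  have h16 : E.M.word 16 = some 16 := E.word_eq (m := 1) (by simpa) (by simp)
  have hn : E.M.word E.n = some E.n :=
    E.word_eq (m := 1) (by have := E.n_le_X; simp; omega) (by simp)
  have hc : E.M.word k.code = some k.code :=
    E.word_eq (m := 1) (by have := k.code_lt; simp; omega) (by simp)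
  have hp : E.X ≤ E.X ^ m := by
    calc E.X = E.X ^ 1 := (pow_one _).symm
      _ ≤ E.X ^ m := Nat.pow_le_pow_right (by omega) h1
  have e1 : E.X ^ (m + 1) = E.X ^ m * E.X := pow_succ _ _
  have e2 : E.X ^ (m + 2) = E.X ^ m * E.X * E.X := by rw [pow_succ, pow_succ]
  have b1 : 16 * x ≤ E.X ^ (m + 1) := by rw [e1]; nlinarith
  have b2 : 16 * x + k.code ≤ E.X ^ (m + 2) := by
    rw [e2]; have := k.code_lt; rw [e1] at b1; nlinarith
  have b3 : E.n + (16 * x + k.code) ≤ E.X ^ (m + 3) := by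
    have := E.n_le_X
    have e3 : E.X ^ (m + 3) = E.X ^ (m + 2) * E.X := pow_succ _ _
    have : E.X ≤ E.X ^ (m + 2) := by rw [e2]; nlinarith
    rw [e3]; nlinarith
  have w1 := E.word_eq b1 (by omega)
  have w2 := E.word_eq b2 (by omega)
  have w3 := E.word_eq b3 (by omega)
  cases k <;> simp [Arr.addr, RamExpr.eval, Env.loc, ha, hz, h16, hn, hc, w1, w2, w3,
    E.input_zero]

theorem Arr.cost_le_addr (k : Arr) (a : RamExpr) : a.cost ≤ (k.addr a).cost := by
  cases k <;> simp [Arr.addr, RamExpr.cost] <;> omega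

theorem RamExpr.cost_pos (a : RamExpr) : 1 ≤ a.cost := by cases a <;> simp [RamExpr.cost]

/-- The compiled expression is evaluated without an error. -/
theorem Ex.eval_compile {E : Env} {σ : RamState} {s : St} (hr : E.Rep σ s) (ho : E.Ok s) (e : Ex)
    (hs : e.Safe E s) (hc : e.compile.cost ≤ 50) :
    e.compile.eval E.M σ = some (e.val E s) ∧ e.val E s ≤ E.X ^ e.compile.cost := by
  have hX := E.X_ge
  have hle : ∀ {x m : ℕ}, x ≤ E.X → 1 ≤ m → x ≤ E.X ^ m := fun {x m} hx hm =>
    hx.trans (by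
      calc E.X = E.X ^ 1 := (pow_one _).symm
        _ ≤ E.X ^ m := Nat.pow_le_pow_right (by omega) hm)
  induction e with
  | lit k =>
    simp only [Safe] at hs
    have : k ≤ E.X ^ 1 := by simp; omega
    exact ⟨by simp [compile, RamExpr.eval, val, E.word_eq this], by simpa [compile, RamExpr.cost, val] using this⟩
  | reg r =>
    refine ⟨by simp [compile, RamExpr.eval, val, hr.1], ?_⟩
    simpa [compile, RamExpr.cost, val] using ho.1 r
  | inp a ih =>
    simp only [compile, RamExpr.cost] at hc
    obtain ⟨h1, h2⟩ := ih hs.1 (by omega)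
    have hl := hs.2
    have he : E.M.input[a.val E s]? = some (E.inp (a.val E s)) := by
      simp [Env.inp, hl]
    have hx : E.inp (a.val E s) ≤ E.X ^ 1 := by simpa using E.inp_le _
    exact ⟨by simp [compile, RamExpr.eval, val, h1, he, E.word_eq hx],
      hle (E.inp_le _) (by simp [compile, RamExpr.cost])⟩
  | get k a ih =>
    simp only [compile, RamExpr.cost] at hc
    have hk := Arr.cost_le_addr k a.compile
    obtain ⟨h1, h2⟩ := ih hs.1 (by omega)
    have := Arr.eval_addr (k := k) h1 h2 (RamExpr.cost_pos _) (by omega)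
    refine ⟨?_, hle (ho.2 _ _) (by simp [compile, RamExpr.cost])⟩
    simp only [compile, RamExpr.eval, val, this, Option.bind_some]
    rw [if_pos (E.loc_lt hs.2), hr.2 _ _ hs.2]
  | add a b iha ihb =>
    simp only [compile, RamExpr.cost] at hc
    obtain ⟨h1, h2⟩ := iha hs.1 (by omega)
    obtain ⟨h3, h4⟩ := ihb hs.2 (by omega)
    have p1 : 0 < E.X ^ a.compile.cost := by positivity
    have p2 : 0 < E.X ^ b.compile.cost := by positivity
    have hb : a.val E s + b.val E s ≤ E.X ^ (a.compile.cost + b.compile.cost + 1) := by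
      rw [pow_succ, pow_add]
      have : E.X ^ a.compile.cost + E.X ^ b.compile.cost
        ≤ E.X ^ a.compile.cost * E.X ^ b.compile.cost * 2 := by nlinarith
      nlinarith [Nat.mul_pos p1 p2]
    exact ⟨by simp [compile, RamExpr.eval, val, h1, h3, E.word_eq hb (by omega)], hb⟩
  | sub a b iha ihb =>
    simp only [compile, RamExpr.cost] at hc
    obtain ⟨h1, h2⟩ := iha hs.1 (by omega)
    obtain ⟨h3, h4⟩ := ihb hs.2 (by omega)
    have hb : a.val E s - b.val E s ≤ E.X ^ (a.compile.cost + b.compile.cost + 1) :=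
      (Nat.sub_le _ _).trans (h2.trans (Nat.pow_le_pow_right (by omega) (by omega)))
    exact ⟨by simp [compile, RamExpr.eval, val, h1, h3, E.word_eq hb (by omega)], hb⟩
  | mul a b iha ihb =>
    simp only [compile, RamExpr.cost] at hc
    obtain ⟨h1, h2⟩ := iha hs.1 (by omega)
    obtain ⟨h3, h4⟩ := ihb hs.2 (by omega)
    have hb : a.val E s * b.val E s ≤ E.X ^ (a.compile.cost + b.compile.cost + 1) := by
      rw [pow_succ, pow_add]
      exact (Nat.mul_le_mul h2 h4).trans (Nat.le_mul_of_pos_right _ (by omega))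
    exact ⟨by simp [compile, RamExpr.eval, val, h1, h3, E.word_eq hb (by omega)], hb⟩
  | lt a b iha ihb =>
    simp only [compile, RamExpr.cost] at hc
    obtain ⟨h1, h2⟩ := iha hs.1 (by omega)
    obtain ⟨h3, h4⟩ := ihb hs.2 (by omega)
    have hb : (lt a b).val E s ≤ E.X ^ (a.compile.cost + b.compile.cost + 1) :=
      hle (by simp only [val]; split_ifs <;> omega) (by omega)
    exact ⟨by simp only [compile, RamExpr.eval, h1, h3, Option.bind_some]
              exact E.word_eq hb (by omega), hb⟩
  | eq a b iha ihb =>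
    simp only [compile, RamExpr.cost] at hc
    obtain ⟨h1, h2⟩ := iha hs.1 (by omega)
    obtain ⟨h3, h4⟩ := ihb hs.2 (by omega)
    have hb : (eq a b).val E s ≤ E.X ^ (a.compile.cost + b.compile.cost + 1) :=
      hle (by simp only [val]; split_ifs <;> omega) (by omega)
    exact ⟨by simp only [compile, RamExpr.eval, h1, h3, Option.bind_some]
              exact E.word_eq hb (by omega), hb⟩

namespace Cmd

/-- The command writes the register. -/
def wr : Cmd → Reg → Bool
  | skip, _ => false
  | set r _, r' => r = r'
  | put _ _ _, _ => false
  | seq C D, r => C.wr r || D.wr r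
  | ite _ C D, r => C.wr r || D.wr r
  | .loop _ C, r => C.wr r

/-- The command writes the array. -/
def wa : Cmd → Arr → Bool
  | skip, _ => false
  | set _ _, _ => false
  | put k _ _, k' => k = k'
  | seq C D, k => C.wa k || D.wa k
  | ite _ C D, k => C.wa k || D.wa k
  | .loop _ C, k => C.wa k

/-- No expression of the command is too large for the bound on intermediate results. -/
def Small : Cmd → Bool
  | skip => true
  | set _ e => e.compile.cost ≤ 50
  | put _ a e => a.compile.cost ≤ 50 && e.compile.cost ≤ 50
  | seq C D => C.Small && D.Small
  | ite e C D => e.compile.cost ≤ 50 && C.Small && D.Small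
  | .loop e C => e.compile.cost ≤ 50 && C.Small

/-- The two states agree on everything that the command does not write. -/
structure Frame (C : Cmd) (s s' : St) : Prop where
  reg : ∀ r, C.wr r = false → s'.reg r = s.reg r
  arr : ∀ k, C.wa k = false → s'.arr k = s.arr k

theorem Frame.refl (C : Cmd) (s : St) : C.Frame s s := ⟨fun _ _ => rfl, fun _ _ => rfl⟩

theorem Frame.trans {C : Cmd} {s s' s'' : St} (h : C.Frame s s') (h' : C.Frame s' s'') :
    C.Frame s s'' :=
  ⟨fun r hr => (h'.reg r hr).trans (h.reg r hr), fun k hk => (h'.arr k hk).trans (h.arr k hk)⟩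

end Cmd

/-- Started in `s`, the command halts after at most `C.compile.length * (f + 1)` steps, in a state
with the property `Q`, and it changes only registers and arrays that it writes. -/
def Runs (E : Env) (C : Cmd) (s : St) (f : ℕ) (Q : St → Prop) : Prop :=
  C.Small → ∀ σ, E.Rep σ s → E.Ok s → ∃ t τ s', RamRun E.M C.compile σ t τ ∧
    t ≤ C.compile.length * (f + 1) ∧ E.Rep τ s' ∧ E.Ok s' ∧ C.Frame s s' ∧ Q s'

namespace Runs

variable {E : Env} {C D : Cmd} {s : St} {f f' : ℕ} {Q Q' : St → Prop}

theorem frame (h : Runs E C s f Q') (hQ : ∀ s', C.Frame s s' → Q' s' → Q s') :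
    Runs E C s f Q := by
  intro hm σ hr ho
  obtain ⟨t, τ, s', h1, h2, h3, h4, h5, h6⟩ := h hm σ hr ho
  exact ⟨t, τ, s', h1, h2, h3, h4, h5, hQ _ h5 h6⟩

/-- The stored numbers may be assumed to be bounded at the start. -/
theorem of_ok (h : E.Ok s → Runs E C s f Q) : Runs E C s f Q :=
  fun hm σ hr ho => h ho hm σ hr ho

theorem mono (h : Runs E C s f Q) (hf : f ≤ f') : Runs E C s f' Q := by
  intro hm σ hr ho
  obtain ⟨t, τ, s', h1, h2, h3⟩ := h hm σ hr ho
  exact ⟨t, τ, s', h1, h2.trans (Nat.mul_le_mul_left _ (by omega)), h3⟩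

theorem skip (h : Q s) : Runs E .skip s f Q := by
  intro _ σ hr ho
  exact ⟨1, σ, s, .skip σ, by simp [Cmd.compile, RamProg.length], hr, ho, .refl _ _, h⟩

theorem set {r : Reg} {e : Ex} (hs : e.Safe E s) (hv : e.val E s ≤ E.X)
    (h : Q (s.setR r (e.val E s))) : Runs E (.set r e) s f Q := by
  intro hm σ hr ho
  simp only [Cmd.Small, decide_eq_true_eq] at hm
  have he := (e.eval_compile hr ho hs hm).1
  refine ⟨_, _, s.setR r (e.val E s), .assign he, ?_, ⟨?_, ?_⟩, ⟨?_, ?_⟩, ⟨?_, ?_⟩, h⟩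
  · simp only [Cmd.compile, RamProg.length]; nlinarith
  · intro r'
    simp only [Function.update_apply, St.setR_reg, Reg.code_injective.eq_iff, hr.1]
  · intro k i hk; simpa using hr.2 k i hk
  · intro r'; simp only [St.setR_reg]; split_ifs; exacts [hv, ho.1 _]
  · intro k i; simpa using ho.2 k i
  · intro r' h'; simp only [Cmd.wr, decide_eq_false_iff_not] at h'
    simp [St.setR_reg, Ne.symm h']
  · intro k _; rfl

theorem put {k : Arr} {a e : Ex} (ha : a.Safe E s) (hl : a.val E s < E.lim k) (hs : e.Safe E s)
    (hv : e.val E s ≤ E.X) (h : Q (s.setA k (a.val E s) (e.val E s))) :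
    Runs E (.put k a e) s f Q := by
  intro hm σ hr ho
  simp only [Cmd.Small, Bool.and_eq_true, decide_eq_true_eq] at hm
  have he := (e.eval_compile hr ho hs hm.2).1
  have he' := a.eval_compile hr ho ha hm.1
  have hk := Arr.eval_addr (k := k) he'.1 he'.2 (RamExpr.cost_pos _) (by omega)
  refine ⟨_, _, s.setA k (a.val E s) (e.val E s), .store hk (E.loc_lt hl) he, ?_, ⟨?_, ?_⟩,
    ⟨?_, ?_⟩, ⟨?_, ?_⟩, h⟩
  · simp only [Cmd.compile, RamProg.length]; nlinarith
  · intro r'; simpa using hr.1 r'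
  · intro k' i hi
    simp only [Function.update_apply, St.setA_arr]
    by_cases h1 : k' = k
    · subst h1
      rw [if_pos rfl]
      by_cases h2 : i = a.val E s
      · subst h2; simp
      · rw [Function.update_of_ne h2, if_neg (fun h3 => h2 (E.loc_inj hi hl h3).2)]
        exact hr.2 _ _ hi
    · rw [if_neg h1, if_neg (fun h3 => h1 (E.loc_inj hi hl h3).1)]
      exact hr.2 _ _ hi
  · intro r'; simpa using ho.1 r'
  · intro k' i; simp only [St.setA_arr]; split_ifs
    · simp only [Function.update_apply]; split_ifs; exacts [hv, ho.2 _ _]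
    · exact ho.2 _ _
  · intro r' _; rfl
  · intro k' h'; simp only [Cmd.wa, decide_eq_false_iff_not] at h'
    simp [Ne.symm h']

theorem seq (h : Runs E C s f fun s' => Runs E D s' f Q) : Runs E (C ;; D) s f Q := by
  intro hm σ hr ho
  simp only [Cmd.Small, Bool.and_eq_true] at hm
  obtain ⟨t, τ, s', h1, h2, h3, h4, h5, h6⟩ := h hm.1 σ hr ho
  obtain ⟨t', τ', s'', g1, g2, g3, g4, g5, g6⟩ := h6 hm.2 τ h3 h4
  refine ⟨_, _, s'', .seq h1 g1, ?_, g3, g4, ⟨?_, ?_⟩, g6⟩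
  · simp only [Cmd.compile, RamProg.length]; rw [add_mul]; omega
  · intro r hh; simp only [Cmd.wr, Bool.or_eq_false_iff] at hh
    rw [g5.reg r hh.2, h5.reg r hh.1]
  · intro r hh; simp only [Cmd.wa, Bool.or_eq_false_iff] at hh
    rw [g5.arr r hh.2, h5.arr r hh.1]

theorem ite {e : Ex} (hs : e.Safe E s) (h1 : e.val E s ≠ 0 → Runs E C s f Q)
    (h2 : e.val E s = 0 → Runs E D s f Q) : Runs E (.ite e C D) s f Q := by
  intro hm σ hr ho
  simp only [Cmd.Small, Bool.and_eq_true, decide_eq_true_eq] at hm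
  have he := (e.eval_compile hr ho hs hm.1.1).1
  by_cases hv : e.val E s = 0
  · obtain ⟨t, τ, s', g1, g2, g3, g4, g5, g6⟩ := h2 hv hm.2 σ hr ho
    rw [hv] at he
    refine ⟨_, _, s', .cond_false he g1, ?_, g3, g4, ⟨?_, ?_⟩, g6⟩
    · simp only [Cmd.compile, RamProg.length]; nlinarith [Nat.zero_le (C.compile.length * (f + 1)),
        Nat.zero_le (e.compile.cost * f)]
    · intro r hh; simp only [Cmd.wr, Bool.or_eq_false_iff] at hh; exact g5.reg r hh.2
    · intro r hh; simp only [Cmd.wa, Bool.or_eq_false_iff] at hh; exact g5.arr r hh.2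
  · obtain ⟨t, τ, s', g1, g2, g3, g4, g5, g6⟩ := h1 hv hm.1.2 σ hr ho
    refine ⟨_, _, s', .cond_true he hv g1, ?_, g3, g4, ⟨?_, ?_⟩, g6⟩
    · simp only [Cmd.compile, RamProg.length]; nlinarith [Nat.zero_le (D.compile.length * (f + 1)),
        Nat.zero_le (e.compile.cost * f)]
    · intro r hh; simp only [Cmd.wr, Bool.or_eq_false_iff] at hh; exact g5.reg r hh.1
    · intro r hh; simp only [Cmd.wa, Bool.or_eq_false_iff] at hh; exact g5.arr r hh.1

/-- The rule for loops with at most `N` iterations. The invariant `I` refers to the number of the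
iteration; it need not mention what the body does not write. -/
theorem loop {e : Ex} {N : ℕ} (I : ℕ → St → Prop) (h0 : I 0 s)
    (hs : ∀ i s', C.Frame s s' → I i s' → e.Safe E s')
    (hb : ∀ i s', C.Frame s s' → I i s' → e.val E s' ≠ 0 → i < N ∧ Runs E C s' f (I (i + 1)))
    (hQ : ∀ i s', C.Frame s s' → I i s' → e.val E s' = 0 → Q s') :
    Runs E (.loop e C) s ((N + 1) * (f + 1)) Q := by
  have key : ∀ m i s', N - i ≤ m → C.Frame s s' → I i s' → C.Small → e.compile.cost ≤ 50 →
      ∀ σ, E.Rep σ s' → E.Ok s' → ∃ t τ s'', RamRun E.M (.loop e.compile C.compile) σ t τ ∧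
        t ≤ (e.compile.cost + 1) * (m + 1) + C.compile.length * (f + 1) * m ∧
        E.Rep τ s'' ∧ E.Ok s'' ∧ C.Frame s s'' ∧ Q s'' := by
    intro m
    induction m with
    | zero =>
      intro i s' hi hf hI hm hc σ hr ho
      have he := (e.eval_compile hr ho (hs i s' hf hI) hc).1
      have hv : e.val E s' = 0 := by
        by_contra hv
        have := (hb i s' hf hI hv).1
        omega
      rw [hv] at he
      exact ⟨_, _, s', .loop_false he, by simp, hr, ho, hf, hQ i s' hf hI hv⟩
    | succ m ih =>
      intro i s' hi hf hI hm hc σ hr ho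
      have he := (e.eval_compile hr ho (hs i s' hf hI) hc).1
      by_cases hv : e.val E s' = 0
      · rw [hv] at he
        refine ⟨_, _, s', .loop_false he, ?_, hr, ho, hf, hQ i s' hf hI hv⟩
        nlinarith [Nat.zero_le (e.compile.cost * m),
          Nat.zero_le (C.compile.length * (f + 1) * (m + 1))]
      · obtain ⟨hN, hrun⟩ := hb i s' hf hI hv
        obtain ⟨t, τ, s'', g1, g2, g3, g4, g5, g6⟩ := hrun hm σ hr ho
        obtain ⟨t', τ', s3, k1, k2, k3, k4, k5, k6⟩ :=
          ih (i + 1) s'' (by omega) (hf.trans g5) g6 hm hc τ g3 g4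
        exact ⟨_, _, s3, .loop_true he hv g1 k1, by nlinarith, k3, k4, k5, k6⟩
  intro hm σ hr ho
  simp only [Cmd.Small, Bool.and_eq_true, decide_eq_true_eq] at hm
  obtain ⟨t, τ, s', h1, h2, h3, h4, h5, h6⟩ :=
    key N 0 s (by omega) (.refl _ _) h0 hm.2 hm.1 σ hr ho
  refine ⟨t, τ, s', h1, h2.trans ?_, h3, h4, ⟨h5.reg, h5.arr⟩, h6⟩
  simp only [Cmd.compile, RamProg.length]
  nlinarith [Nat.zero_le (C.compile.length * (f + 1)), Nat.zero_le (e.compile.cost * N * f),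
    Nat.zero_le (e.compile.cost * f), Nat.zero_le (N * f), Nat.zero_le (e.compile.cost * N)]

end Runs

/-- The counting loop `for r := 0, …, e - 1 do C`. -/
def Cmd.for (r : Reg) (e : Ex) (C : Cmd) : Cmd :=
  .set r (.lit 0) ;; .loop (.lt (.reg r) e) (C ;; .set r (.add (.reg r) (.lit 1)))

/-- The rule for counting loops. The invariant is stated for the number of completed iterations;
it must not depend on the counter register. -/
theorem Runs.for {E : Env} {C : Cmd} {s : St} {f : ℕ} {Q : St → Prop} {r : Reg} {e : Ex} (N : ℕ)
    (I : ℕ → St → Prop) (hr : C.wr r = false) (hN : N < E.X)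
    (hI : ∀ i s' x, I i s' → I i (s'.setR r x)) (h0 : I 0 s)
    (he : ∀ i s', (Cmd.for r e C).Frame s s' → I i s' → e.Safe E s' ∧ e.val E s' = N)
    (hb : ∀ i s', (Cmd.for r e C).Frame s s' → I i s' → s'.reg r = i → i < N →
      Runs E C s' f (I (i + 1)))
    (hQ : ∀ s', I N s' → Q s') : Runs E (.for r e C) s ((N + 1) * (f + 1)) Q := by
  refine .seq (.set (by simp [Ex.Safe]) (by simp [Ex.val]) ?_)
  have hfr : ∀ s', (C ;; .set r (.add (.reg r) (.lit 1))).Frame (s.setR r (Ex.val E s (.lit 0))) s'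
      → (Cmd.for r e C).Frame s s' := by
    intro s' h
    refine ⟨fun r' hr' => ?_, fun k hk => ?_⟩
    · simp only [Cmd.for, Cmd.wr, Bool.or_eq_false_iff, decide_eq_false_iff_not] at hr'
      rw [h.reg r' (by simp [Cmd.wr, hr'])]
      simp [Ne.symm hr'.1]
    · simp only [Cmd.for, Cmd.wa, Bool.or_eq_false_iff] at hk
      rw [h.arr k (by simp [Cmd.wa, hk])]
      simp
  refine .loop (fun i s' => I i s' ∧ s'.reg r = i ∧ i ≤ N) ⟨hI _ _ _ h0, by simp [Ex.val], by omega⟩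
    ?_ ?_ ?_
  · intro i s' hf hi
    exact ⟨trivial, (he i s' (hfr _ hf) hi.1).1⟩
  · intro i s' hf hi hv
    have hv' : i < N := by
      simp only [Ex.val, (he i s' (hfr _ hf) hi.1).2, hi.2.1] at hv
      by_contra h; simp [h] at hv
    refine ⟨hv', .seq ((hb i s' (hfr _ hf) hi.1 hi.2.1 hv').frame ?_)⟩
    intro s'' hf' hi'
    have : s''.reg r = i := (hf'.reg r hr).trans hi.2.1
    refine .set (by simp [Ex.Safe]) (by simp [Ex.val, this]; omega) ?_
    exact ⟨hI _ _ _ hi', by simp [Ex.val, this], by omega⟩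
  · intro i s' hf hi hv
    have hv' : i = N := by
      simp only [Ex.val, (he i s' (hfr _ hf) hi.1).2, hi.2.1] at hv
      have := hi.2.2
      by_contra h; simp [show i < N by omega] at hv
    subst hv'
    exact hQ _ hi.1

/-- The weakest precondition of a command without loops. -/
def Cmd.wp (E : Env) : Cmd → (St → Prop) → St → Prop
  | skip, Q, s => Q s
  | set r e, Q, s => e.Safe E s ∧ e.val E s ≤ E.X ∧ Q (s.setR r (e.val E s))
  | put k a e, Q, s => (a.Safe E s ∧ a.val E s < E.lim k) ∧ (e.Safe E s ∧ e.val E s ≤ E.X) ∧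
      Q (s.setA k (a.val E s) (e.val E s))
  | seq C D, Q, s => C.wp E (D.wp E Q) s
  | ite e C D, Q, s => e.Safe E s ∧ (e.val E s ≠ 0 → C.wp E Q s) ∧ (e.val E s = 0 → D.wp E Q s)
  | .loop _ _, _, _ => False

/-- A command without loops takes a constant number of steps. -/
theorem Runs.of_wp {E : Env} {C : Cmd} {s : St} {f : ℕ} {Q : St → Prop} (h : C.wp E Q s) :
    Runs E C s f Q := by
  induction C generalizing s Q with
  | skip => exact .skip h
  | set r e => exact .set h.1 h.2.1 h.2.2
  | put k a e => exact .put h.1.1 h.1.2 h.2.1.1 h.2.1.2 h.2.2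
  | seq C D ihC ihD => exact .seq ((ihC h).frame fun s' _ hs' => ihD hs')
  | ite e C D ihC ihD => exact .ite h.1 (fun hv => ihC (h.2.1 hv)) (fun hv => ihD (h.2.2 hv))
  | loop e C => exact h.elim

/-! ### Digraphs as input -/

namespace Ex

instance : Add Ex := ⟨.add⟩
instance : Sub Ex := ⟨.sub⟩
instance : Mul Ex := ⟨.mul⟩
instance (k : ℕ) : OfNat Ex k := ⟨.lit k⟩
instance : Coe Reg Ex := ⟨.reg⟩

/-- The number of items. -/
def nE : Ex := .inp (.lit 0)

/-- The capacity. -/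
def cE : Ex := .inp (.lit 1)

variable (E : Env) (s : St) (a b : Ex)

@[simp] theorem val_reg (r : Reg) : (reg r).val E s = s.reg r := rfl
@[simp] theorem val_inp : (inp a).val E s = E.inp (a.val E s) := rfl
@[simp] theorem val_get (k : Arr) : (get k a).val E s = s.arr k (a.val E s) := rfl
@[simp] theorem val_add : (a + b).val E s = a.val E s + b.val E s := rfl
@[simp] theorem val_sub : (a - b).val E s = a.val E s - b.val E s := rfl
@[simp] theorem val_mul : (a * b).val E s = a.val E s * b.val E s := rfl
@[simp] theorem val_zero : (0 : Ex).val E s = 0 := rfl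
@[simp] theorem val_one : (1 : Ex).val E s = 1 := rfl
@[simp] theorem val_two : (2 : Ex).val E s = 2 := rfl
@[simp] theorem val_three : (3 : Ex).val E s = 3 := rfl
@[simp] theorem val_lt : (lt a b).val E s = if a.val E s < b.val E s then 1 else 0 := rfl
@[simp] theorem val_eq : (eq a b).val E s = if a.val E s = b.val E s then 1 else 0 := rfl

@[simp] theorem val_nE : nE.val E s = E.n := by
  simp [nE, val, Env.inp, List.getD_eq_getElem?_getD, E.input_zero]

@[simp] theorem val_cE : cE.val E s = E.c := by
  simp [cE, val, Env.inp, List.getD_eq_getElem?_getD, E.input_one]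

@[simp] theorem safe_reg (r : Reg) : (reg r).Safe E s := trivial
@[simp] theorem safe_inp : (inp a).Safe E s ↔ a.Safe E s ∧ a.val E s < E.M.input.length := Iff.rfl
@[simp] theorem safe_get (k : Arr) : (get k a).Safe E s ↔ a.Safe E s ∧ a.val E s < E.lim k :=
  Iff.rfl
@[simp] theorem safe_add : (a + b).Safe E s ↔ a.Safe E s ∧ b.Safe E s := Iff.rfl
@[simp] theorem safe_sub : (a - b).Safe E s ↔ a.Safe E s ∧ b.Safe E s := Iff.rfl
@[simp] theorem safe_mul : (a * b).Safe E s ↔ a.Safe E s ∧ b.Safe E s := Iff.rfl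
@[simp] theorem safe_zero : (0 : Ex).Safe E s := Nat.zero_le _
@[simp] theorem safe_one : (1 : Ex).Safe E s := by show 1 ≤ 16; simp
@[simp] theorem safe_two : (2 : Ex).Safe E s := by show 2 ≤ 16; simp
@[simp] theorem safe_three : (3 : Ex).Safe E s := by show 3 ≤ 16; simp
@[simp] theorem safe_lt : (lt a b).Safe E s ↔ a.Safe E s ∧ b.Safe E s := Iff.rfl
@[simp] theorem safe_eq : (eq a b).Safe E s ↔ a.Safe E s ∧ b.Safe E s := Iff.rfl

@[simp] theorem safe_nE : nE.Safe E s :=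
  ⟨Nat.zero_le _, (List.getElem?_eq_some_iff.1 E.input_zero).1⟩

@[simp] theorem safe_cE : cE.Safe E s :=
  ⟨by simp [Safe], (List.getElem?_eq_some_iff.1 E.input_one).1⟩

end Ex

attribute [simp] Cmd.wp

/-- A machine whose input describes a digraph with item sizes: `nb x` lists the successors of `x`,
and this list begins at position `off x` of the concatenated lists. -/
structure Net extends Env where
  sz : ℕ → ℕ
  sz_pos : ∀ v, v < n → 0 < sz v
  nb : ℕ → List ℕ
  nb_nodup : ∀ v, v < n → (nb v).Nodup
  nb_lt : ∀ v, v < n → ∀ y ∈ nb v, y < n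
  off : ℕ → ℕ
  inp_sz : ∀ v, v < n → v + 2 < M.input.length ∧ toEnv.inp (v + 2) = sz v
  inp_off : ∀ v, v < n → n + 2 + v < M.input.length ∧ toEnv.inp (n + 2 + v) = off v
  inp_off_succ : ∀ v, v < n →
    n + 3 + v < M.input.length ∧ toEnv.inp (n + 3 + v) = off v + (nb v).length
  inp_nb : ∀ v, v < n → ∀ i (h : i < (nb v).length),
    2 * n + 3 + (off v + i) < M.input.length ∧ toEnv.inp (2 * n + 3 + (off v + i)) = (nb v)[i]
  total_le : c + ∑ y ∈ Finset.range n, sz y ≤ X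
  off_lt : ∀ v, v < n → off v + (nb v).length < X

namespace Net

variable (K : Net)

/-- `y` can be reached from `x`. -/
def R (x y : ℕ) : Prop := Relation.ReflTransGen (fun x y => y ∈ K.nb x) x y

theorem R.lt {K : Net} {x y : ℕ} (h : K.R x y) (hx : x < K.n) : y < K.n := by
  induction h with
  | refl => exact hx
  | tail _ h ih => exact K.nb_lt _ ih _ h

open scoped Classical in
/-- The vertices that can be reached from `v`. -/
noncomputable def reach (v : ℕ) : Finset ℕ := (Finset.range K.n).filter (K.R v)

/-- A vertex is alive if some feasible set contains it. -/
def Alive (v : ℕ) : Prop := v < K.n ∧ ∑ y ∈ K.reach v, K.sz y ≤ K.c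

theorem mem_reach {v y : ℕ} (hv : v < K.n) : y ∈ K.reach v ↔ K.R v y := by
  simp only [reach, Finset.mem_filter, Finset.mem_range]
  exact ⟨fun h => h.2, fun h => ⟨h.lt hv, h⟩⟩

theorem sz_add_le {v : ℕ} (hv : v < K.n) : K.c + K.sz v ≤ K.X :=
  le_trans (Nat.add_le_add_left (Finset.single_le_sum (f := K.sz) (fun _ _ => Nat.zero_le _)
    (Finset.mem_range.2 hv)) _) K.total_le

theorem row_lt {v j : ℕ} (hv : v < K.n) (hj : j < K.c) : v * K.c + j < K.n * K.c := by
  calc v * K.c + j < (v + 1) * K.c := by rw [add_mul]; omega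
    _ ≤ K.n * K.c := Nat.mul_le_mul_right _ hv

theorem row_inj {m v j v' j' : ℕ} (hj : j < m) (hj' : j' < m) (h : v * m + j = v' * m + j') :
    v = v' ∧ j = j' := by
  have h1 : (v * m + j) / m = v := by
    rw [mul_comm, Nat.mul_add_div (by omega), Nat.div_eq_of_lt hj, add_zero]
  have h2 : (v' * m + j') / m = v' := by
    rw [mul_comm, Nat.mul_add_div (by omega), Nat.div_eq_of_lt hj', add_zero]
  have : v = v' := by rw [← h1, ← h2, h]
  subst this
  exact ⟨rfl, by omega⟩

theorem lt_two_mul {v : ℕ} (hv : v ≤ K.n) : v < 2 * (K.n * K.c) := by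
  have h1 := K.n_pos
  have := Nat.mul_le_mul_left K.n (show 1 ≤ K.c from K.c_pos)
  omega

end Net

/-! ### Computing the reachability lists -/

/-- The command is skipped unless the test succeeds. -/
def Cmd.when (e : Ex) (C : Cmd) : Cmd := .ite e C .skip

namespace Search

open Ex Cmd

/-- Handling of the successor at position `j`. -/
def visit : Cmd :=
  .set .y (inp (2 * nE + 3 + Reg.j)) ;;
  ite (eq (get .stamp Reg.y) (Reg.v + 1)) .skip
    (put .stamp Reg.y (Reg.v + 1) ;;
     .set .wt (Reg.wt + inp (Reg.y + 2)) ;;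
     when (lt Reg.wt (cE + 1))
       (put .row (Reg.v * cE + Reg.len) Reg.y ;; .set .len (Reg.len + 1))) ;;
  .set .j (Reg.j + 1)

/-- Handling of the vertex at position `head` of the queue. -/
def expand : Cmd :=
  .set .x (get .row (Reg.v * cE + Reg.head)) ;;
  .set .j (inp (nE + 2 + Reg.x)) ;;
  .set .fin (inp (nE + 3 + Reg.x)) ;;
  .loop (lt Reg.j Reg.fin * lt Reg.wt (cE + 1)) visit ;;
  .set .head (Reg.head + 1)

/-- The search from the vertex `v`, abandoned when the total size exceeds the capacity. -/
def start : Cmd :=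
  .set .wt (inp (Reg.v + 2)) ;;
  .set .len 0 ;;
  .set .head 0 ;;
  put .stamp Reg.v (Reg.v + 1) ;;
  when (lt Reg.wt (cE + 1)) (put .row (Reg.v * cE) Reg.v ;; .set .len 1)

/-- The complete search from the vertex `v`. -/
def explore : Cmd :=
  start ;;
  .loop (lt Reg.head Reg.len * lt Reg.wt (cE + 1)) expand ;;
  when (lt Reg.wt (cE + 1)) (put .cnt Reg.v Reg.len)

/-- The lists of reachable vertices. -/
def prog : Cmd := .for .v nE explore

open Net

variable {K : Net}

/-- The part of the invariant about the vertices that the search from `v` has found. -/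
structure Inv (K : Net) (v : ℕ) (s : St) : Prop where
  root : s.arr .stamp v = v + 1
  reach : ∀ y, s.arr .stamp y = v + 1 → y < K.n ∧ K.R v y
  wt : s.reg .wt = ∑ y ∈ (Finset.range K.n).filter (fun y => s.arr .stamp y = v + 1), K.sz y
  old : ∀ y, s.arr .stamp y ≤ v + 1
  row : s.reg .wt ≤ K.c → ∀ h < s.reg .len, s.arr .stamp (s.arr .row (v * K.c + h)) = v + 1
  inj : s.reg .wt ≤ K.c → ∀ h < s.reg .len, ∀ h' < s.reg .len,
    s.arr .row (v * K.c + h) = s.arr .row (v * K.c + h') → h = h'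
  surj : s.reg .wt ≤ K.c → ∀ y, s.arr .stamp y = v + 1 →
    ∃ h < s.reg .len, s.arr .row (v * K.c + h) = y

theorem Inv.card_le {v : ℕ} {s : St} (h : Inv K v s) (l : List ℕ)
    (hl : l.Nodup) (hs : ∀ y ∈ l, s.arr .stamp y = v + 1) : l.length ≤ s.reg .wt := by
  rw [← List.toFinset_card_of_nodup hl]
  rw [h.wt]
  refine le_trans ?_ (Finset.sum_le_sum_of_subset (s := l.toFinset) ?_)
  · rw [Finset.card_eq_sum_ones]
    refine Finset.sum_le_sum fun y hy => K.sz_pos y (h.reach y (hs y (by simpa using hy))).1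
  · intro y hy
    have := hs y (by simpa using hy)
    simp [this, (h.reach y this).1]

theorem Inv.len_le {v : ℕ} {s : St} (h : Inv K v s) (hc : s.reg .wt ≤ K.c) :
    s.reg .len ≤ s.reg .wt := by
  have := h.card_le ((List.range (s.reg .len)).map fun i => s.arr .row (v * K.c + i)) ?_ ?_
  · simpa using this
  · refine List.Nodup.map_on ?_ List.nodup_range
    intro a ha b hb
    exact h.inj hc a (by simpa using ha) b (by simpa using hb)
  · intro y hy
    simp only [List.mem_map, List.mem_range] at hy
    obtain ⟨i, hi, rfl⟩ := hy
    exact h.row hc i hi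

/-- What the search from `v` has recorded is kept, and the lists of other vertices are not touched. -/
structure Grows (K : Net) (v : ℕ) (s s' : St) : Prop where
  stamp : ∀ y, s.arr .stamp y = v + 1 → s'.arr .stamp y = v + 1
  len : s.reg .len ≤ s'.reg .len
  row : ∀ h < s.reg .len, s'.arr .row (v * K.c + h) = s.arr .row (v * K.c + h)
  other : ∀ u < v, ∀ h < K.c, s'.arr .row (u * K.c + h) = s.arr .row (u * K.c + h)

theorem Grows.refl (v : ℕ) (s : St) : Grows K v s s :=
  ⟨fun _ h => h, le_rfl, fun _ _ => rfl, fun _ _ _ _ => rfl⟩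

theorem Grows.trans {v : ℕ} {s s' s'' : St} (h : Grows K v s s') (h' : Grows K v s' s'') :
    Grows K v s s'' :=
  ⟨fun y hy => h'.stamp y (h.stamp y hy), h.len.trans h'.len,
    fun i hi => (h'.row i (hi.trans_le h.len)).trans (h.row i hi),
    fun u hu i hi => (h'.other u hu i hi).trans (h.other u hu i hi)⟩

/-- The invariant only depends on these components of the state. -/
theorem Inv.congr {v : ℕ} {s s' : St} (h : Inv K v s) (h1 : s'.arr .stamp = s.arr .stamp)
    (h2 : s'.arr .row = s.arr .row) (h3 : s'.reg .wt = s.reg .wt)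
    (h4 : s'.reg .len = s.reg .len) : Inv K v s' := by
  constructor <;> simp only [h1, h2, h3, h4]
  exacts [h.root, h.reach, h.wt, h.old, h.row, h.inj, h.surj]

theorem Grows.congr {v : ℕ} {s s' s'' : St} (h : Grows K v s s') (h1 : s''.arr .stamp = s'.arr .stamp)
    (h2 : s''.arr .row = s'.arr .row) (h4 : s''.reg .len = s'.reg .len) : Grows K v s s'' := by
  constructor <;> simp only [h1, h2, h4]
  exacts [h.stamp, h.len, h.row, h.other]

theorem filter_update {A : ℕ → ℕ} {n y a : ℕ} (hy : y < n) :
    (Finset.range n).filter (fun z => Function.update A y a z = a) =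
      insert y ((Finset.range n).filter fun z => A z = a) := by
  ext z
  simp only [Finset.mem_filter, Finset.mem_range, Finset.mem_insert, Function.update_apply]
  by_cases h : z = y <;> simp [h, hy]

/-- Looking at an arc either stamps its head, which is then counted in the weight, or finds it stamped. -/
theorem visit_runs {v x i : ℕ} {s : St} (hv : v < K.n) (hx : x < K.n) (hsv : s.reg .v = v)
    (hI : Inv K v s) (hR : K.R v x) (hj : s.reg .j = K.off x + i) (hi : i < (K.nb x).length)
    (hw : s.reg .wt ≤ K.c) {f : ℕ} :
    Runs K.toEnv visit s f fun s' => Inv K v s' ∧ s'.reg .j = K.off x + (i + 1) ∧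
      s'.arr .stamp ((K.nb x)[i]) = v + 1 ∧ Grows K v s s' := by
  refine .of_wp ?_
  obtain ⟨h1, h2⟩ := K.inp_nb x hx i hi
  have hyx := List.getElem_mem hi
  have hy := K.nb_lt x hx _ hyx
  obtain ⟨h3, h4⟩ := K.inp_sz _ hy
  have hRy : K.R v (K.nb x)[i] := hR.tail hyx
  have hlen := hI.len_le hw
  have hjX := K.off_lt x hx
  have hyX : (K.nb x)[i] < K.X := by have := K.n_le_X; omega
  have hyl := K.lt_two_mul hy.le
  have hwX : s.reg .wt + K.sz (K.nb x)[i] ≤ K.X := by have := K.sz_add_le hy; omega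
  have hS := K.sz_pos _ hy
  generalize hyy : (K.nb x)[i] = y at *
  simp only [visit, when, Cmd.wp]
  simp only [val_add, val_mul, val_two, val_nE, val_three, val_reg, hj, h2,
    val_inp]
  simp [hsv, hj, h1, h3, h4, Env.lim]
  refine ⟨hyX.le, hyl, fun hst => ⟨by omega, hI.congr rfl rfl rfl rfl, by omega, hst,
    (Grows.refl v s).congr rfl rfl rfl⟩, fun hst => ⟨hyl, by have := K.n_le_X; omega, hwX,
      fun hwc => ?_, fun hwc => ?_⟩⟩
  · have hll : s.reg .len + 1 ≤ K.c := by omega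
    have hrow := K.row_lt hv (show s.reg .len < K.c by omega)
    refine ⟨by omega, hyX.le, by have := K.c_le_X; omega, by omega, ?_, by omega, ?_⟩
    · constructor
      · simp [Function.update_apply, hI.root]
      · intro z hz
        simp [Function.update_apply] at hz
        by_cases h : z = y
        · subst h; exact ⟨hy, hRy⟩
        · exact hI.reach z (by simpa [h] using hz)
      · simp only [St.setR_reg, St.setR_arr, St.setA_arr, St.setA_reg]
        simp only [reduceCtorEq, if_false, if_true]
        rw [filter_update hy, Finset.sum_insert (by simp [hst]), hI.wt, add_comm]
      · intro z
        simp [Function.update_apply]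
        split_ifs
        · rfl
        · exact hI.old z
      · intro _ h hh
        simp only [St.setR_reg, St.setR_arr, St.setA_arr, St.setA_reg, reduceCtorEq, if_false,
          if_true, Function.update_apply, Nat.add_left_cancel_iff] at hh ⊢
        by_cases h' : h = s.reg .len
        · simp [h']
        · rw [if_neg h']
          by_cases h'' : s.arr .row (v * K.c + h) = y
          · simp [h'']
          · simpa [h''] using hI.row hw h (by omega)
      · intro _ h hh h' hh'
        simp [Function.update_apply] at hh hh' ⊢
        have key : ∀ h < s.reg .len, s.arr .row (v * K.c + h) ≠ y := by
          rintro h hh rfl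
          exact hst (hI.row hw h hh)
        by_cases a : h = s.reg .len <;> by_cases b : h' = s.reg .len
        · omega
        · simp [a, b]; intro e; exact absurd e.symm (key _ (by omega))
        · simp [a, b]; intro e; exact absurd e (key _ (by omega))
        · simp [a, b]; exact hI.inj hw h (by omega) h' (by omega)
      · intro _ z hz
        simp [Function.update_apply] at hz ⊢
        by_cases h : z = y
        · exact ⟨s.reg .len, by omega, by simp [h]⟩
        · obtain ⟨h', g1, g2⟩ := hI.surj hw z (by simpa [h] using hz)
          exact ⟨h', by omega, by rw [if_neg (by omega)]; exact g2⟩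
    · constructor
      · intro z hz; simp [Function.update_apply, hz]
      · simp
      · intro h hh
        simp [hh.ne]
      · intro u hu h hh
        simp only [St.setR_arr, St.setA_arr]
        simp only [reduceCtorEq, if_false, if_true]
        rw [Function.update_of_ne]
        intro e
        have := (row_inj hh (by omega) e).1
        omega
  · refine ⟨by omega, ?_, by omega, ?_⟩
    · constructor
      · simp [Function.update_apply, hI.root]
      · intro z hz
        simp [Function.update_apply] at hz
        by_cases h : z = y
        · subst h; exact ⟨hy, hRy⟩
        · exact hI.reach z (by simpa [h] using hz)
      · simp only [St.setR_reg, St.setR_arr, St.setA_arr, St.setA_reg]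
        simp only [reduceCtorEq, if_false, if_true]
        rw [filter_update hy, Finset.sum_insert (by simp [hst]), hI.wt, add_comm]
      · intro z
        simp [Function.update_apply]
        split_ifs
        · rfl
        · exact hI.old z
      · intro h; simp at h; omega
      · intro h; simp at h; omega
      · intro h; simp at h; omega
    · constructor
      · intro z hz; simp [Function.update_apply, hz]
      · simp
      · intro h hh; simp
      · intro u hu h hh; simp

/-- Expanding one vertex of the queue takes `O(c)` steps: its successors are distinct, all of them are
stamped, and the loop stops once the weight of the stamped vertices exceeds `c`. -/
theorem expand_runs {v : ℕ} {s : St} (hv : v < K.n) (hsv : s.reg .v = v) (hI : Inv K v s)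
    (hh : s.reg .head < s.reg .len) (hw : s.reg .wt ≤ K.c) :
    Runs K.toEnv expand s ((K.c + 2) * 1) fun s' => Inv K v s' ∧
      s'.reg .head = s.reg .head + 1 ∧ Grows K v s s' ∧ (s'.reg .wt ≤ K.c →
        ∀ y ∈ K.nb (s.arr .row (v * K.c + s.reg .head)), s'.arr .stamp y = v + 1) := by
  have hlen := hI.len_le hw
  have hrow := K.row_lt hv (show s.reg .head < K.c by omega)
  obtain ⟨hx, hR⟩ := hI.reach _ (hI.row hw _ hh)
  generalize hxx : s.arr .row (v * K.c + s.reg .head) = x at *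
  obtain ⟨h1, h2⟩ := K.inp_off x hx
  obtain ⟨h3, h4⟩ := K.inp_off_succ x hx
  have hjX := K.off_lt x hx
  have hnX := K.n_le_X
  refine .seq (.of_wp ?_)
  simp [hsv, hxx, Env.lim]
  refine ⟨by omega, by omega, ?_⟩
  refine .seq (.of_wp ?_)
  simp [h1, h2]
  refine ⟨by omega, ?_⟩
  refine .seq (.of_wp ?_)
  simp [h3, h4]
  refine ⟨by omega, ?_⟩
  refine .seq ?_
  refine (Runs.loop (N := K.c + 1) (f := 0) (fun i s' => Inv K v s' ∧ s'.reg .j = K.off x + i ∧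
    i ≤ (K.nb x).length ∧ (∀ i' (h : i' < (K.nb x).length), i' < i → s'.arr .stamp (K.nb x)[i'] = v + 1) ∧
    Grows K v s s') ?_ ?_ ?_ ?_).mono (by omega)
  · exact ⟨hI.congr rfl rfl rfl rfl, by simp, by simp, by simp, (Grows.refl v s).congr rfl rfl rfl⟩
  · intro i s' hf hi
    simp
  · rintro i s' hf ⟨g1, g2, g3, g4, g5⟩ hval
    have e1 : s'.reg .fin = K.off x + (K.nb x).length := by
      rw [hf.reg .fin rfl]; simp
    have e2 : s'.reg .v = v := by
      rw [hf.reg .v rfl]; simpa using hsv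
    simp [g2, e1] at hval
    have hwc : s'.reg .wt ≤ K.c := by omega
    constructor
    · have := g1.card_le ((K.nb x).take i) ((K.nb_nodup x hx).sublist (List.take_sublist _ _)) ?_
      · rw [List.length_take] at this; omega
      · intro y hy
        obtain ⟨i', hi', rfl⟩ := List.getElem_of_mem hy
        rw [List.length_take] at hi'
        rw [List.getElem_take]
        exact g4 i' _ (by omega)
    · refine (visit_runs hv hx e2 g1 hR g2 (by omega) hwc).frame ?_
      rintro s'' hf' ⟨k1, k2, k3, k4⟩
      refine ⟨k1, k2, by omega, ?_, g5.trans k4⟩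
      intro i' hi' hlt
      by_cases e : i' = i
      · subst e; exact k3
      · exact k4.stamp _ (g4 i' hi' (by omega))
  · rintro i s' hf ⟨g1, g2, g3, g4, g5⟩ hval
    have e1 : s'.reg .fin = K.off x + (K.nb x).length := by
      rw [hf.reg .fin rfl]; simp
    have e3 : s'.reg .head = s.reg .head := by
      rw [hf.reg .head rfl]; simp
    simp [g2, e1] at hval
    refine .of_wp ?_
    have := K.c_le_X
    simp [e3]
    refine ⟨by omega, g1.congr rfl rfl rfl rfl, g5.congr rfl rfl rfl, ?_⟩
    intro hwc y hy
    obtain ⟨i', hi', rfl⟩ := List.getElem_of_mem hy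
    exact g4 i' hi' (by omega)

/-- The correctness of the list of the vertex `v`. -/
structure RowOk (K : Net) (cnt row : ℕ → ℕ) (v : ℕ) : Prop where
  cnt_le : cnt v ≤ K.c
  alive : cnt v ≠ 0 ↔ K.Alive v
  mem : K.Alive v → ∀ y, K.R v y ↔ ∃ j < cnt v, row (v * K.c + j) = y
  inj : K.Alive v → ∀ j < cnt v, ∀ j' < cnt v, row (v * K.c + j) = row (v * K.c + j') → j = j'

/-- At most `c` vertices are expanded before the queue is empty or the weight exceeds `c`. In the first
case the queue lists the up-set of `v`; in the second `v` is not alive. -/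
theorem explore_runs {v : ℕ} {s : St} (hv : v < K.n) (hsv : s.reg .v = v)
    (hst : ∀ y, s.arr .stamp y ≤ v) (h0 : ∀ u, v ≤ u → s.arr .cnt u = 0) :
    Runs K.toEnv explore s ((K.c + 1) * ((K.c + 2) + 1)) fun s' =>
      RowOk K (s'.arr .cnt) (s'.arr .row) v ∧ (∀ y, s'.arr .stamp y ≤ v + 1) ∧
      (∀ u ≠ v, s'.arr .cnt u = s.arr .cnt u) ∧
      (∀ u < v, ∀ h < K.c, s'.arr .row (u * K.c + h) = s.arr .row (u * K.c + h)) := by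
  obtain ⟨h1, h2⟩ := K.inp_sz v hv
  have hvl := K.lt_two_mul hv.le
  have hnX := K.n_le_X
  have hcX := K.c_le_X
  have hzX := K.sz_add_le hv
  have hrow := K.row_lt hv K.c_pos
  have hcpos := K.c_pos
  have hne : ∀ y, s.arr .stamp y ≠ v + 1 := fun y => by have := hst y; omega
  have hinit : Runs K.toEnv start s 0 fun s' => Inv K v s' ∧ s'.reg .head = 0 ∧
      (∀ u < v, ∀ h < K.c, s'.arr .row (u * K.c + h) = s.arr .row (u * K.c + h)) := by
    have hS : (Finset.range K.n).filter (fun y => s.arr .stamp y = v + 1) = ∅ := by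
      ext y; simp [hne]
    have hsum : ∑ y ∈ (Finset.range K.n).filter
        (fun y => Function.update (s.arr .stamp) v (v + 1) y = v + 1), K.sz y = K.sz v := by
      rw [filter_update hv, hS]; simp
    refine .of_wp ?_
    simp [start, when, hsv, h1, h2, Env.lim]
    refine ⟨by omega, by omega, by omega, fun hc => ⟨by omega, by omega, by omega, ?_, ?_⟩,
      fun hc => ?_⟩
    · constructor
      · simp
      · intro z hz
        simp [Function.update_apply, hne] at hz
        subst hz; exact ⟨hv, .refl⟩
      · simp [hsum]
      · intro z; simp [Function.update_apply]; split_ifs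
        · rfl
        · have := hst z; omega
      · intro _ h hh; simp at hh; simp [hh]
      · intro _ h hh h' hh'; simp at hh hh'; simp [hh, hh']
      · intro _ z hz
        simp [Function.update_apply, hne] at hz
        exact ⟨0, by simp, by simp [hz]⟩
    · intro u hu h hh
      rw [Function.update_of_ne]
      intro e
      have := (Net.row_inj hh hcpos (show u * K.c + h = v * K.c + 0 by omega)).1
      omega
    · constructor
      · simp
      · intro z hz
        simp [Function.update_apply, hne] at hz
        subst hz; exact ⟨hv, .refl⟩
      · simp [hsum]
      · intro z; simp [Function.update_apply]; split_ifs
        · rfl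
        · have := hst z; omega
      · intro h; simp at h; omega
      · intro h; simp at h; omega
      · intro h; simp at h; omega
  refine .seq ((hinit.mono (Nat.zero_le _)).frame ?_)
  rintro s1 hf1 ⟨k1, k2, k3⟩
  have hcnt1 : s1.arr .cnt = s.arr .cnt := hf1.arr .cnt rfl
  have hv1 : s1.reg .v = v := (hf1.reg .v rfl).trans hsv
  refine .seq ?_
  refine (Runs.loop (N := K.c) (f := (K.c + 2) * 1) (fun i s' => Inv K v s' ∧ s'.reg .head = i ∧
    i ≤ s'.reg .len ∧ Grows K v s1 s' ∧ (s'.reg .wt ≤ K.c → ∀ h < i,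
      ∀ y ∈ K.nb (s'.arr .row (v * K.c + h)), s'.arr .stamp y = v + 1)) ?_ ?_ ?_ ?_).mono (by simp)
  · exact ⟨k1, k2, by simp, .refl _ _, by simp⟩
  · intro i s' hf hi; simp
  · rintro i s' hf ⟨g1, g2, g3, g4, g5⟩ hval
    simp [g2] at hval
    have hwc : s'.reg .wt ≤ K.c := by omega
    have := g1.len_le hwc
    refine ⟨by omega, (expand_runs hv ((hf.reg .v rfl).trans hv1) g1 (by omega) hwc).frame ?_⟩
    rintro s'' hf' ⟨m1, m2, m3, m4⟩
    refine ⟨m1, by omega, by have := m3.len; omega, g4.trans m3, fun hw h hh y hy => ?_⟩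
    rw [m3.row h (by omega)] at hy
    by_cases e : h = i
    · subst e; rw [g2] at m4; exact m4 hw y hy
    · exact m3.stamp _ (g5 hwc h (by omega) y hy)
  · rintro i s' hf ⟨g1, g2, g3, g4, g5⟩ hval
    simp [g2] at hval
    have hcnt2 : s'.arr .cnt = s.arr .cnt := (hf.arr .cnt rfl).trans hcnt1
    have hv2 : s'.reg .v = v := (hf.reg .v rfl).trans hv1
    have hold : ∀ u < v, ∀ h < K.c, s'.arr .row (u * K.c + h) = s.arr .row (u * K.c + h) :=
      fun u hu h hh => (g4.other u hu h hh).trans (k3 u hu h hh)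
    refine .of_wp ?_
    simp [when, hv2, Env.lim]
    refine ⟨fun hwc => ⟨by omega, ?_, ?_, ?_, ?_, ?_⟩, fun hwc => ⟨?_, ?_, ?_, hold⟩⟩
    · have := g1.len_le hwc; omega
    · have hl : s'.reg .len = i := by omega
      have hcl : ∀ y, K.R v y → s'.arr .stamp y = v + 1 := by
        intro y hy
        induction hy with
        | refl => exact g1.root
        | tail _ hyz ih =>
          obtain ⟨h, hh, rfl⟩ := g1.surj hwc _ ih
          exact g5 hwc h (by omega) _ hyz
      have hal : K.Alive v := by
        refine ⟨hv, le_trans (le_of_eq ?_) hwc⟩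
        rw [g1.wt]
        congr 1
        ext y
        simp only [K.mem_reach hv, Finset.mem_filter, Finset.mem_range]
        exact ⟨fun h => ⟨h.lt hv, hcl y h⟩, fun h => (g1.reach y h.2).2⟩
      obtain ⟨h', hh', _⟩ := g1.surj hwc v g1.root
      constructor
      · simp; exact (g1.len_le hwc).trans hwc
      · simp [hal]; omega
      · intro _ y
        simp
        constructor
        · intro hy; exact g1.surj hwc y (hcl y hy)
        · rintro ⟨j, hj, rfl⟩; exact (g1.reach _ (g1.row hwc j hj)).2
      · intro _ j hj j' hj'
        simp at hj hj' ⊢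
        exact g1.inj hwc j hj j' hj'
    · exact g1.old
    · intro u hu; simp [hu, hcnt2]
    · exact hold
    · have hal : ¬ K.Alive v := by
        rintro ⟨_, h⟩
        have : s'.reg .wt ≤ ∑ y ∈ K.reach v, K.sz y := by
          rw [g1.wt]
          refine Finset.sum_le_sum_of_subset ?_
          intro y hy
          simp only [K.mem_reach hv, Finset.mem_filter, Finset.mem_range] at hy ⊢
          exact (g1.reach y hy.2).2
        omega
      have hz : s'.arr .cnt v = 0 := by rw [hcnt2]; exact h0 v le_rfl
      exact ⟨by omega, by simp [hz, hal], fun h => absurd h hal, fun h => absurd h hal⟩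
    · exact g1.old
    · intro u _; rw [hcnt2]

theorem prog_runs {s : St} (hst : ∀ y, s.arr .stamp y = 0) (h0 : ∀ u, s.arr .cnt u = 0) :
    Runs K.toEnv prog s ((K.n + 1) * ((K.c + 1) * ((K.c + 2) + 1) + 1)) fun s' =>
      ∀ v < K.n, RowOk K (s'.arr .cnt) (s'.arr .row) v := by
  refine Runs.for K.n (fun i s' => (∀ y, s'.arr .stamp y ≤ i) ∧ (∀ u, i ≤ u → s'.arr .cnt u = 0) ∧
    ∀ u < i, RowOk K (s'.arr .cnt) (s'.arr .row) u) rfl (by have := K.n_le_X; omega) ?_ ?_ ?_ ?_ ?_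
  · intro i s' x h; exact h
  · exact ⟨fun y => (hst y).le, fun u _ => h0 u, by simp⟩
  · intro i s' _ _; simp
  · rintro i s' hf ⟨h1, h2, h3⟩ hi hn
    refine (explore_runs hn hi h1 h2).frame ?_
    rintro s'' _ ⟨g1, g2, g3, g4⟩
    refine ⟨g2, fun u hu => ?_, fun u hu => ?_⟩
    · rw [g3 u (by omega)]; exact h2 u (by omega)
    · by_cases e : u = i
      · subst e; exact g1
      · have hu' : u < i := by omega
        obtain ⟨p1, p2, p3, p4⟩ := h3 u hu'
        have hc := g3 u e
        constructor
        · rwa [hc]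
        · rwa [hc]
        · intro ha y
          rw [p3 ha y, hc]
          refine exists_congr fun j => and_congr_right fun hj => ?_
          rw [g4 u hu' j (by omega)]
        · intro ha j hj j' hj'
          rw [hc] at hj hj'
          rw [g4 u hu' j (by omega), g4 u hu' j' (by omega)]
          exact p4 ha j hj j' hj'
  · intro s' h; exact h.2.2

end Search

/-! ### Elimination sequences and strongly connected components -/

namespace Net

variable {K : Net}

theorem R.trans {a b c : ℕ} (h : K.R a b) (h' : K.R b c) : K.R a c :=
  Relation.ReflTransGen.trans h h'

theorem R.refl (a : ℕ) : K.R a a := Relation.ReflTransGen.refl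

theorem Alive.lt {v : ℕ} (h : K.Alive v) : v < K.n := h.1

theorem reach_subset {v y : ℕ} (hv : v < K.n) (h : K.R v y) : K.reach y ⊆ K.reach v := by
  intro z hz
  rw [K.mem_reach (h.lt hv)] at hz
  rw [K.mem_reach hv]
  exact h.trans hz

theorem Alive.mono {v y : ℕ} (h : K.Alive v) (hy : K.R v y) : K.Alive y :=
  ⟨hy.lt h.1, (Finset.sum_le_sum_of_subset (reach_subset h.1 hy)).trans h.2⟩

theorem Alive.card_le {v : ℕ} (h : K.Alive v) : (K.reach v).card ≤ K.c := by
  refine le_trans ?_ h.2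
  rw [Finset.card_eq_sum_ones]
  exact Finset.sum_le_sum fun y hy => K.sz_pos y (by simp [reach] at hy; exact hy.1)

/-- Vertices that reach each other are those with equally many reachable vertices. -/
theorem R.symm_iff {v y : ℕ} (hv : v < K.n) (h : K.R v y) :
    K.R y v ↔ (K.reach y).card = (K.reach v).card := by
  constructor
  · intro h'
    rw [(reach_subset hv h).antisymm (reach_subset (h.lt hv) h')]
  · intro e
    rw [← K.mem_reach (h.lt hv), Finset.eq_of_subset_of_card_le (reach_subset hv h) e.ge,
      K.mem_reach hv]
    exact R.refl v

/-- The vertex is the smallest one of its strongly connected component. -/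
def Leader (K : Net) (v : ℕ) : Prop := K.Alive v ∧ ∀ y < v, ¬ (K.R v y ∧ K.R y v)

theorem Leader.alive {v : ℕ} (h : K.Leader v) : K.Alive v := h.1

theorem Leader.lt {v : ℕ} (h : K.Leader v) : v < K.n := h.1.1

theorem Leader.antisymm {u v : ℕ} (hu : K.Leader u) (hv : K.Leader v) (h : K.R u v)
    (h' : K.R v u) : u = v := by
  rcases lt_trichotomy u v with e | e | e
  · exact absurd ⟨h', h⟩ (hv.2 u e)
  · exact e
  · exact absurd ⟨h, h'⟩ (hu.2 v e)

theorem Leader.card_lt {u v : ℕ} (hu : K.Leader u) (hv : K.Leader v) (h : K.R u v) (hne : u ≠ v) :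
    (K.reach v).card < (K.reach u).card := by
  refine lt_of_le_of_ne (Finset.card_le_card (reach_subset hu.lt h)) fun e => hne ?_
  exact hu.antisymm hv h ((R.symm_iff hu.lt h).2 e)

theorem card_eq_cnt {cnt row : ℕ → ℕ} {v : ℕ} (h : Search.RowOk K cnt row v) (ha : K.Alive v) :
    (K.reach v).card = cnt v := by
  have : K.reach v = (Finset.range (cnt v)).image fun j => row (v * K.c + j) := by
    ext y
    rw [K.mem_reach ha.1, h.mem ha]
    simp
  rw [this, Finset.card_image_of_injOn, Finset.card_range]
  intro a ha' b hb
  exact h.inj ha a (by simpa using ha') b (by simpa using hb)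

/-- The vertex has not been eliminated in the first `L` steps of the sequence `X`. -/
def Left (K : Net) (X : ℕ → ℕ) (L v : ℕ) : Prop := K.Alive v ∧ ∀ k < L, X k ≠ v

/-- In step `k` the vertex `X k` is eliminated. Among the vertices that are left no other vertex
distinguishes it from `P k`. -/
def ElimOk (K : Net) (X P : ℕ → ℕ) (L : ℕ) : Prop :=
  ∀ k < L, K.Left X k (X k) ∧ K.Left X k (P k) ∧ X k ≠ P k ∧
    ∀ u, K.Left X k u → u ≠ X k → u ≠ P k →
      (K.R u (X k) ↔ K.R u (P k)) ∧ (K.R (X k) u ↔ K.R (P k) u)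

theorem left_congr {X X' : ℕ → ℕ} {L v : ℕ} (h : ∀ k < L, X' k = X k) :
    K.Left X' L v ↔ K.Left X L v :=
  and_congr_right fun _ => forall₂_congr fun k hk => by rw [h k hk]

theorem left_update {X : ℕ → ℕ} {L v u : ℕ} :
    K.Left (Function.update X L v) (L + 1) u ↔ K.Left X L u ∧ u ≠ v := by
  constructor
  · rintro ⟨h, h'⟩
    refine ⟨⟨h, fun k hk => ?_⟩, ?_⟩
    · simpa [hk.ne] using h' k (by omega)
    · simpa using (h' L (by omega)).symm
  · rintro ⟨⟨h, h'⟩, hv⟩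
    refine ⟨h, fun k hk => ?_⟩
    by_cases e : k = L
    · subst e; simpa using hv.symm
    · rw [Function.update_of_ne e]; exact h' k (by omega)

theorem ElimOk.snoc {X P : ℕ → ℕ} {L v p : ℕ} (h : K.ElimOk X P L) (hv : K.Left X L v)
    (hp : K.Left X L p) (hne : v ≠ p)
    (ht : ∀ u, K.Left X L u → u ≠ v → u ≠ p → (K.R u v ↔ K.R u p) ∧ (K.R v u ↔ K.R p u)) :
    K.ElimOk (Function.update X L v) (Function.update P L p) (L + 1) := by
  intro k hk
  have hl : ∀ u, K.Left (Function.update X L v) k u ↔ K.Left X k u := fun u =>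
    left_congr fun j hj => Function.update_of_ne (by omega) _ _
  simp only [hl]
  by_cases e : k = L
  · subst e
    simpa using ⟨hv, hp, hne, ht⟩
  · rw [Function.update_of_ne e, Function.update_of_ne e]
    exact h k (by omega)

theorem ElimOk.injOn {X P : ℕ → ℕ} {L : ℕ} (h : K.ElimOk X P L) {i j : ℕ} (hi : i < L) (hj : j < L)
    (e : X i = X j) : i = j := by
  by_contra hne
  rcases lt_or_gt_of_ne hne with hlt | hlt
  · exact (h j hj).1.2 i hlt e
  · exact (h i hi).1.2 j hlt e.symm

theorem ElimOk.lt {X P : ℕ → ℕ} {L k : ℕ} (h : K.ElimOk X P L) (hk : k < L) :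
    X k < K.n ∧ P k < K.n := ⟨(h k hk).1.1.1, (h k hk).2.1.1.1⟩

theorem le_of_injOn {A : ℕ → ℕ} {N n : ℕ} (h : ∀ i < N, A i < n)
    (hinj : ∀ i < N, ∀ j < N, A i = A j → i = j) : N ≤ n := by
  have := Finset.card_le_card_of_injOn (s := Finset.range N) (t := Finset.range n) A
    (fun i hi => by simpa using h i (by simpa using hi))
    (fun i hi j hj => hinj i (by simpa using hi) j (by simpa using hj))
  simpa using this

theorem ElimOk.le {X P : ℕ → ℕ} {L : ℕ} (h : K.ElimOk X P L) : L ≤ K.n :=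
  le_of_injOn (fun _ hi => (h.lt hi).1) fun _ hi _ hj => h.injOn hi hj

/-- As long as a vertex is left, fewer than `n` vertices have been eliminated. -/
theorem ElimOk.lt_of_left {X P : ℕ → ℕ} {L v : ℕ} (h : K.ElimOk X P L) (hv : K.Left X L v) :
    L < K.n := by
  refine le_of_injOn (A := Function.update X L v) (N := L + 1) (fun i hi => ?_) ?_
  · by_cases e : i = L
    · subst e; simpa using hv.1.1
    · rw [Function.update_of_ne e]; exact (h.lt (by omega)).1
  · intro i hi j hj e
    by_cases a : i = L <;> by_cases b : j = L
    · omega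
    · subst a; simp [b] at e; exact absurd e.symm (hv.2 j (by omega))
    · subst b; simp [a] at e; exact absurd e (hv.2 i (by omega))
    · simp only [Function.update_of_ne a, Function.update_of_ne b] at e
      exact h.injOn (by omega) (by omega) e

end Net

namespace Components

open Ex Cmd Net

/-- The smallest vertex of the component of `v`. -/
def least : Cmd :=
  .set .m Reg.v ;;
  .for .j (get .cnt Reg.v)
    (.set .y (get .row (Reg.v * cE + Reg.j)) ;;
     when (eq (get .cnt Reg.y) (get .cnt Reg.v) * lt Reg.y Reg.m) (.set .m Reg.y))

/-- Eliminates the vertices that are not smallest in their components, and marks the others with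
the number of vertices that they reach. -/
def prog : Cmd :=
  .for .v nE
    (least ;;
     ite (eq Reg.m Reg.v) (put .lead Reg.v (get .cnt Reg.v))
       (put .lx Reg.em Reg.v ;; put .lp Reg.em Reg.m ;; .set .em (Reg.em + 1)))

variable {K : Net}

/-- All lists of reachable vertices are correct. -/
def Rows (K : Net) (s : St) : Prop :=
  ∀ v < K.n, Search.RowOk K (s.arr .cnt) (s.arr .row) v

theorem Rows.entry {s : St} (h : Rows K s) {v j : ℕ} (hv : v < K.n) (hj : j < s.arr .cnt v) :
    K.Alive v ∧ K.R v (s.arr .row (v * K.c + j)) := by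
  have ha := ((h v hv).alive).1 (by omega)
  exact ⟨ha, ((h v hv).mem ha _).2 ⟨j, hj, rfl⟩⟩

theorem Rows.congr {s s' : St} (h : Rows K s)
    (hc : s'.arr .cnt = s.arr .cnt) (hr : ∀ j < K.n * K.c, s'.arr .row j = s.arr .row j) :
    Rows K s' := by
  intro v hv
  obtain ⟨h1, h2, h3, h4⟩ := h v hv
  have hr' : ∀ j < s.arr .cnt v, s'.arr .row (v * K.c + j) = s.arr .row (v * K.c + j) :=
    fun j hj => hr _ (K.row_lt hv (by omega))
  refine ⟨by rwa [hc], by rwa [hc], fun ha y => ?_, fun ha j hj j' hj' => ?_⟩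
  · rw [h3 ha, hc]
    exact exists_congr fun j => and_congr_right fun hj => by rw [hr' j hj]
  · rw [hc] at hj hj'
    rw [hr' j hj, hr' j' hj']
    exact h4 ha j hj j' hj'

theorem least_runs {v : ℕ} {s : St} (hv : v < K.n) (hR : Rows K s) (hsv : s.reg .v = v) :
    Runs K.toEnv least s ((K.c + 1) * (0 + 1)) fun s' => s'.reg .m ≤ v ∧
      (K.Alive v → K.R v (s'.reg .m) ∧ K.R (s'.reg .m) v ∧
        ∀ y, K.R v y → K.R y v → s'.reg .m ≤ y) ∧ (¬ K.Alive v → s'.reg .m = v) := by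
  have hnX := K.n_le_X
  have hcX := K.c_le_X
  have hvl := K.lt_two_mul hv.le
  have hrv := hR v hv
  refine .seq (.of_wp ?_)
  simp [hsv]
  refine ⟨by omega, ?_⟩
  refine (Runs.for (s.arr .cnt v) (f := 0) (fun i s' => s'.reg .m ≤ v ∧
    (s'.reg .m = v ∨ ∃ j < i, s'.reg .m = s.arr .row (v * K.c + j) ∧
      s.arr .cnt (s'.reg .m) = s.arr .cnt v) ∧
    ∀ j < i, s.arr .cnt (s.arr .row (v * K.c + j)) = s.arr .cnt v →
      s'.reg .m ≤ s.arr .row (v * K.c + j)) rfl ?_ ?_ ?_ ?_ ?_ ?_).mono ?_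
  · have := hrv.cnt_le; omega
  · intro i s' x h; simpa using h
  · simp
  · intro i s' hf _
    have h1 : s'.reg .v = v := by rw [hf.reg .v rfl]; simpa using hsv
    have h2 : s'.arr .cnt = s.arr .cnt := by rw [hf.arr .cnt rfl]; simp
    simp [h1, h2, Env.lim, hvl]
  · rintro i s' hf ⟨g1, g2, g3⟩ hi hlt
    have h1 : s'.reg .v = v := by rw [hf.reg .v rfl]; simpa using hsv
    have h2 : s'.arr .cnt = s.arr .cnt := by rw [hf.arr .cnt rfl]; simp
    have h3 : s'.arr .row = s.arr .row := by rw [hf.arr .row rfl]; simp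
    have hc := hrv.cnt_le
    have hrow := K.row_lt hv (show i < K.c by omega)
    obtain ⟨ha, hy⟩ := hR.entry hv hlt
    have hyn := hy.lt hv
    have hyl := K.lt_two_mul hyn.le
    refine .of_wp ?_
    simp [when, h1, h2, h3, hi, Env.lim]
    refine ⟨by omega, by omega, ⟨hyl, hvl⟩, fun e2 e1 => ⟨by omega, by omega, ?_, ?_⟩,
      fun e1 => ⟨g1, ?_, ?_⟩⟩
    · right; exact ⟨i, by omega, rfl, e1⟩
    · intro j hj e
      by_cases e' : j = i
      · subst e'; exact le_rfl
      · have := g3 j (by omega) e; omega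
    · rcases g2 with g2 | ⟨j, hj, g2⟩
      · exact .inl g2
      · exact .inr ⟨j, by omega, g2⟩
    · intro j hj e
      by_cases e' : j = i
      · subst e'
        by_contra h
        exact absurd e (e1 (by omega))
      · exact g3 j (by omega) e
  · rintro s' ⟨g1, g2, g3⟩
    refine ⟨g1, fun ha => ?_, fun ha => ?_⟩
    · have hm : K.R v (s'.reg .m) ∧ K.R (s'.reg .m) v := by
        rcases g2 with g2 | ⟨j, hj, g2, g4⟩
        · rw [g2]; exact ⟨R.refl v, R.refl v⟩
        · have h1 := (hR.entry hv hj).2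
          rw [← g2] at h1
          refine ⟨h1, (R.symm_iff hv h1).2 ?_⟩
          rw [card_eq_cnt hrv ha, card_eq_cnt (hR _ (h1.lt hv)) (ha.mono h1), g4]
      refine ⟨hm.1, hm.2, fun y h1 h2 => ?_⟩
      obtain ⟨j, hj, rfl⟩ := (hrv.mem ha y).1 h1
      refine g3 j hj ?_
      rw [← card_eq_cnt hrv ha, ← card_eq_cnt (hR _ (h1.lt hv)) (ha.mono h1)]
      exact (R.symm_iff hv h1).1 h2
    · have : s.arr .cnt v = 0 := by
        by_contra h; exact ha (hrv.alive.1 h)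
      rcases g2 with g2 | ⟨j, hj, _⟩
      · exact g2
      · omega
  · have := hrv.cnt_le
    simp; omega

theorem prog_runs {s : St} (hR : Rows K s) (hem : s.reg .em = 0)
    (hl : ∀ v, s.arr .lead v = 0) :
    Runs K.toEnv prog s ((K.n + 1) * ((K.c + 1) * (0 + 1) + 1)) fun s' =>
      K.ElimOk (s'.arr .lx) (s'.arr .lp) (s'.reg .em) ∧
      (∀ v, K.Left (s'.arr .lx) (s'.reg .em) v ↔ K.Leader v) ∧
      (∀ v < K.n, (s'.arr .lead v ≠ 0 ↔ K.Leader v) ∧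
        (s'.arr .lead v ≠ 0 → s'.arr .lead v = s.arr .cnt v)) := by
  have hnX := K.n_le_X
  refine Runs.for K.n (fun i s' =>
      K.ElimOk (s'.arr .lx) (s'.arr .lp) (s'.reg .em) ∧
      (∀ v, K.Left (s'.arr .lx) (s'.reg .em) v ↔ K.Alive v ∧ (v < i → K.Leader v)) ∧
      (∀ v < i, (s'.arr .lead v ≠ 0 ↔ K.Leader v) ∧
        (s'.arr .lead v ≠ 0 → s'.arr .lead v = s.arr .cnt v)) ∧
      ∀ v, i ≤ v → s'.arr .lead v = 0) rfl ?_ ?_ ?_ ?_ ?_ ?_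
  · omega
  · intro i s' x h; simpa using h
  · refine ⟨?_, ?_, by simp, fun v _ => hl v⟩
    · intro k hk; omega
    · intro v; simp [Left, hem]
  · intro i s' hf _; simp
  · rintro i s' hf ⟨g1, g2, g3, g4⟩ hi hlt
    have h2 : s'.arr .cnt = s.arr .cnt := hf.arr .cnt rfl
    have h3 : s'.arr .row = s.arr .row := hf.arr .row rfl
    have hR' : Rows K s' := by intro v hv; rw [h2, h3]; exact hR v hv
    have hil := K.lt_two_mul hlt.le
    have hnn := K.lt_two_mul le_rfl
    have hcX := K.c_le_X
    refine .seq ((least_runs hlt hR' hi).frame ?_)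
    rintro s1 hf1 ⟨k1, k2, k3⟩
    have e1 : s1.reg .v = i := (hf1.reg .v rfl).trans hi
    have e2 : s1.arr .cnt = s.arr .cnt := (hf1.arr .cnt rfl).trans h2
    have e3 := hf1.arr .lx rfl
    have e4 := hf1.arr .lp rfl
    have e5 := hf1.arr .lead rfl
    have e6 := hf1.reg .em rfl
    have hem := g1.le
    have hcc := (hR i hlt).cnt_le
    refine .of_wp ?_
    simp [e1, e2, e3, e4, e5, e6, Env.lim, hil]
    refine ⟨fun e => ⟨by omega, g1, ?_, ?_, ?_⟩, fun e => ⟨by omega, by omega, by omega, ?_⟩⟩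
    · intro v
      rw [g2]
      refine and_congr_right fun ha => ⟨fun h hv => ?_, fun h hv => h (by omega)⟩
      by_cases hvi : v = i
      · subst hvi
        refine ⟨ha, fun y hy hyy => ?_⟩
        have := (k2 ha).2.2 y hyy.1 hyy.2
        omega
      · exact h (by omega)
    · intro v hv
      by_cases hvi : v = i
      · subst hvi
        simp
        rw [← ne_eq, (hR v hlt).alive]
        refine ⟨fun ha => ⟨ha, fun y hy hyy => ?_⟩, fun h => h.1⟩
        have := (k2 ha).2.2 y hyy.1 hyy.2
        omega
      · simp [hvi]
        exact g3 v (by omega)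
    · intro v hv
      rw [Function.update_of_ne (by omega)]
      exact g4 v (by omega)
    · have ha : K.Alive i := by by_contra h; exact e (k3 h)
      obtain ⟨m1, m2, m3⟩ := k2 ha
      have hml : K.Leader (s1.reg .m) := ⟨ha.mono m1, fun y hy hyy => by
        have := m3 y (m1.trans hyy.1) (hyy.2.trans m2); omega⟩
      have hil : ¬ K.Leader i := fun h => h.2 _ (by omega) ⟨m1, m2⟩
      have hv : K.Left (s'.arr .lx) (s'.reg .em) i := (g2 i).2 ⟨ha, by simp⟩
      have hp : K.Left (s'.arr .lx) (s'.reg .em) (s1.reg .m) := (g2 _).2 ⟨hml.1, fun _ => hml⟩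
      have := g1.lt_of_left hv
      refine ⟨by omega, by omega, g1.snoc hv hp (Ne.symm e) ?_, ?_, ?_, ?_⟩
      · intro u _ _ _
        exact ⟨⟨fun h => h.trans m1, fun h => h.trans m2⟩, ⟨fun h => m2.trans h, fun h => m1.trans h⟩⟩
      · intro v
        rw [left_update, g2, and_assoc]
        refine and_congr_right fun ha => ⟨fun h hv => h.1 (by omega), fun h => ⟨fun hv => h (by omega), ?_⟩⟩
        rintro rfl
        exact hil (h (by omega))
      · intro v hv
        by_cases hvi : v = i
        · subst hvi; simp [g4 v le_rfl, hil]
        · exact g3 v (by omega)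
      · intro v hv; exact g4 v (by omega)
  · rintro s' ⟨g1, g2, g3, _⟩
    refine ⟨g1, fun v => ?_, g3⟩
    rw [g2]
    exact ⟨fun h => h.2 h.1.1, fun h => ⟨h.1, fun _ => h⟩⟩

end Components

/-! ### Sorting -/

namespace Order

open Ex Cmd Net

/-- Lists the leaders by increasing number of reachable vertices. -/
def prog : Cmd :=
  .for .k cE (.for .v nE
    (when (eq (get .lead Reg.v) (Reg.k + 1)) (put .ord Reg.num Reg.v ;; .set .num (Reg.num + 1))))

/-- The first `N` entries of `A` are the leaders, sorted by the number of reachable vertices. -/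
structure Sorted (K : Net) (A : ℕ → ℕ) (N : ℕ) : Prop where
  leader : ∀ i < N, K.Leader (A i)
  inj : ∀ i < N, ∀ j < N, A i = A j → i = j
  surj : ∀ v, K.Leader v → ∃ i < N, A i = v
  mono : ∀ i j, i < j → j < N → (K.reach (A i)).card ≤ (K.reach (A j)).card

theorem Sorted.lt_of_R {K : Net} {A : ℕ → ℕ} {N i j : ℕ} (h : Sorted K A N) (hi : i < N) (hj : j < N)
    (hR : K.R (A i) (A j)) (hne : i ≠ j) : j < i := by
  have h1 := (h.leader i hi).card_lt (h.leader j hj) hR fun e => hne (h.inj i hi j hj e)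
  by_contra h2
  have := h.mono i j (by omega) hj
  omega

variable {K : Net}

/-- The invariant of the sort: listed are the leaders with at most `k` reachable vertices, and
those with `k + 1` reachable vertices that are smaller than `v`. -/
structure Inv (K : Net) (k v : ℕ) (A : ℕ → ℕ) (N : ℕ) : Prop where
  leader : ∀ i < N, K.Leader (A i) ∧ ((K.reach (A i)).card ≤ k ∨
    (K.reach (A i)).card = k + 1 ∧ A i < v)
  inj : ∀ i < N, ∀ j < N, A i = A j → i = j
  surj : ∀ u, K.Leader u → ((K.reach u).card ≤ k ∨ (K.reach u).card = k + 1 ∧ u < v) →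
    ∃ i < N, A i = u
  mono : ∀ i j, i < j → j < N → (K.reach (A i)).card ≤ (K.reach (A j)).card

theorem Inv.next {k v N : ℕ} {A : ℕ → ℕ} (h : Inv K k v A N)
    (hv : K.Leader v → (K.reach v).card ≠ k + 1) : Inv K k (v + 1) A N := by
  refine ⟨fun i hi => ?_, h.inj, fun u hu hk => h.surj u hu ?_, h.mono⟩
  · obtain ⟨h1, h2⟩ := h.leader i hi
    exact ⟨h1, by omega⟩
  · by_cases e : u = v
    · subst e; have := hv hu; omega
    · omega

theorem Inv.push {k v N : ℕ} {A : ℕ → ℕ} (h : Inv K k v A N) (hl : K.Leader v)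
    (hv : (K.reach v).card = k + 1) : Inv K k (v + 1) (Function.update A N v) (N + 1) := by
  have hne : ∀ i < N, A i ≠ v := by
    intro i hi e
    have := (h.leader i hi).2
    rw [e] at this
    omega
  refine ⟨fun i hi => ?_, fun i hi j hj e => ?_, fun u hu hk => ?_, fun i j hij hj => ?_⟩
  · by_cases e : i = N
    · subst e; simp [hl, hv]
    · rw [Function.update_of_ne e]
      obtain ⟨h1, h2⟩ := h.leader i (by omega)
      exact ⟨h1, by omega⟩
  · by_cases a : i = N <;> by_cases b : j = N
    · omega
    · subst a; simp [b] at e; exact absurd e.symm (hne j (by omega))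
    · subst b; simp [a] at e; exact absurd e (hne i (by omega))
    · simp only [Function.update_of_ne a, Function.update_of_ne b] at e
      exact h.inj i (by omega) j (by omega) e
  · by_cases e : u = v
    · subst e; exact ⟨N, by omega, by simp⟩
    · obtain ⟨i, hi, h1⟩ := h.surj u hu (by omega)
      exact ⟨i, by omega, by rw [Function.update_of_ne (by omega)]; exact h1⟩
  · rw [Function.update_of_ne (show i ≠ N by omega)]
    by_cases e : j = N
    · subst e
      have := (h.leader i hij).2
      simp; omega
    · rw [Function.update_of_ne e]; exact h.mono i j hij (by omega)

/-- Bucket sort: one pass over the vertices for every possible number of reachable vertices. -/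
theorem prog_runs {s : St} (hnum : s.reg .num = 0)
    (hl : ∀ v < K.n, (s.arr .lead v ≠ 0 ↔ K.Leader v) ∧
      (s.arr .lead v ≠ 0 → s.arr .lead v = (K.reach v).card)) :
    Runs K.toEnv prog s ((K.c + 1) * ((K.n + 1) * (0 + 1) + 1)) fun s' =>
      Sorted K (s'.arr .ord) (s'.reg .num) := by
  have hnX := K.n_le_X
  have hcX := K.c_le_X
  refine Runs.for K.c (fun i s' => Inv K i 0 (s'.arr .ord) (s'.reg .num)) rfl ?_ ?_ ?_ ?_ ?_ ?_
  · omega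
  · intro i s' x h; simpa using h
  · refine ⟨by simp [hnum], by simp [hnum], fun u hu h => ?_, by simp [hnum]⟩
    have : 0 < (K.reach u).card := Finset.card_pos.2 ⟨u, (K.mem_reach hu.lt).2 (R.refl u)⟩
    omega
  · intro i s' _ _; simp
  · intro k s1 hf1 h1 hk hkc
    refine Runs.for K.n (fun i s' => Inv K k i (s'.arr .ord) (s'.reg .num)) rfl ?_ ?_ h1 ?_ ?_ ?_
    · omega
    · intro i s' x h; simpa using h
    · intro i s' _ _; simp
    · intro i s' hf h hi hin
      have e1 : s'.reg .k = k := (hf.reg .k rfl).trans hk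
      have e2 : s'.arr .lead = s.arr .lead := (hf.arr .lead rfl).trans (hf1.arr .lead rfl)
      have hil := K.lt_two_mul hin.le
      have hnn := K.lt_two_mul le_rfl
      obtain ⟨l1, l2⟩ := hl i hin
      have hle := le_of_injOn (fun i hi => (h.leader i hi).1.lt) h.inj
      refine .of_wp ?_
      simp [when, hi, e1, e2, Env.lim, hil]
      refine ⟨fun e => ⟨by omega, by omega, by omega, ?_⟩, fun e => h.next fun hld e' => ?_⟩
      · have hld := l1.1 (by omega)
        exact h.push hld (by rw [← l2 (by omega)]; exact e)
      · exact e (by rw [l2 (l1.2 hld)]; exact e')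
    · intro s' h
      refine ⟨fun i hi => ?_, h.inj, fun u hu hk => h.surj u hu ?_, h.mono⟩
      · obtain ⟨h1, h2⟩ := h.leader i hi
        exact ⟨h1, by omega⟩
      · have := hu.lt; omega
  · intro s' h
    refine ⟨fun i hi => (h.leader i hi).1, h.inj, fun u hu => h.surj u hu ?_, h.mono⟩
    exact .inl hu.1.card_le

end Order

/-! ### Forests of vertices -/

/-- On the set `Q` of leaders, reachability is the ancestor relation of the forest in which `par q`
is the parent and `dep q` the depth of `q`. The roots have depth `1` and the parent `n`. -/
structure Forest (K : Net) (Q : ℕ → Prop) (dep par : ℕ → ℕ) : Prop where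
  leader : ∀ q, Q q → K.Leader q
  root : ∀ q, Q q → par q = K.n → dep q = 1 ∧ ∀ a, Q a → a ≠ q → ¬ K.R q a
  child : ∀ q, Q q → par q ≠ K.n → Q (par q) ∧ par q ≠ q ∧ dep q = dep (par q) + 1 ∧
    ∀ a, Q a → a ≠ q → (K.R q a ↔ K.R (par q) a)

namespace Forest

variable {K : Net} {Q : ℕ → Prop} {dep par : ℕ → ℕ} {q a b : ℕ}

open Net

theorem dep_pos (h : Forest K Q dep par) (hq : Q q) : 1 ≤ dep q := by
  by_cases e : par q = K.n
  · exact (h.root q hq e).1.ge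
  · rw [(h.child q hq e).2.2.1]; omega

theorem dep_lt (h : Forest K Q dep par) (hq : Q q) (ha : Q a) (hR : K.R q a) (hne : a ≠ q) :
    dep a < dep q := by
  induction hd : dep q using Nat.strong_induction_on generalizing q with
  | _ d ih =>
    have e : par q ≠ K.n := fun e => (h.root q hq e).2 a ha hne hR
    obtain ⟨h1, h2, h3, h4⟩ := h.child q hq e
    by_cases e' : a = par q
    · subst e'; omega
    · have := ih (dep (par q)) (by omega) h1 ((h4 a ha hne).1 hR) e' rfl
      omega

theorem R_par (h : Forest K Q dep par) (hq : Q q) (e : par q ≠ K.n) : K.R q (par q) := by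
  obtain ⟨h1, h2, h3, h4⟩ := h.child q hq e
  exact (h4 _ h1 h2).2 (R.refl _)

/-- Two ancestors of a vertex are comparable. -/
theorem comparable (h : Forest K Q dep par) (hq : Q q) (ha : Q a) (hb : Q b) (hqa : K.R q a)
    (hqb : K.R q b) (hd : dep a ≤ dep b) : K.R b a := by
  induction hdd : dep q using Nat.strong_induction_on generalizing q with
  | _ d ih =>
    by_cases e1 : b = q
    · subst e1; exact hqa
    by_cases e2 : a = q
    · subst e2; have := h.dep_lt hq hb hqb e1; omega
    have e : par q ≠ K.n := fun e => (h.root q hq e).2 a ha e2 hqa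
    obtain ⟨h1, h2, h3, h4⟩ := h.child q hq e
    exact ih (dep (par q)) (by omega) h1 ((h4 a ha e2).1 hqa) ((h4 b hb e1).1 hqb) rfl

theorem anc_unique (h : Forest K Q dep par) (hq : Q q) (ha : Q a) (hb : Q b) (hqa : K.R q a)
    (hqb : K.R q b) (hd : dep a = dep b) : a = b :=
  (h.leader a ha).antisymm (h.leader b hb) (h.comparable hq hb ha hqb hqa hd.ge)
    (h.comparable hq ha hb hqa hqb hd.le)

theorem anc_exists (h : Forest K Q dep par) (hq : Q q) {e : ℕ} (he : 1 ≤ e) (hd : e ≤ dep q) :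
    ∃ a, Q a ∧ K.R q a ∧ dep a = e := by
  induction hdd : dep q using Nat.strong_induction_on generalizing q with
  | _ d ih =>
    by_cases e1 : e = dep q
    · exact ⟨q, hq, R.refl q, e1.symm⟩
    have e2 : par q ≠ K.n := fun e => by have := (h.root q hq e).1; omega
    obtain ⟨h1, h2, h3, h4⟩ := h.child q hq e2
    obtain ⟨a, g1, g2, g3⟩ := ih (dep (par q)) (by omega) h1 (by omega) rfl
    exact ⟨a, g1, (h.R_par hq e2).trans g2, g3⟩

/-- Below an ancestor lies one of its children. -/
theorem exists_child (h : Forest K Q dep par) (hq : Q q) (ha : Q a) (hR : K.R q a) (hne : a ≠ q) :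
    ∃ b, Q b ∧ K.R q b ∧ par b = a := by
  have hlt := h.dep_lt hq ha hR hne
  obtain ⟨b, g1, g2, g3⟩ := h.anc_exists hq (e := dep a + 1) (by omega) (by omega)
  refine ⟨b, g1, g2, ?_⟩
  have hab : a ≠ b := by rintro rfl; omega
  have e : par b ≠ K.n := fun e => by
    have := (h.root b g1 e).1
    have := h.dep_pos ha
    omega
  obtain ⟨h1, h2, h3, h4⟩ := h.child b g1 e
  have hba := h.comparable hq ha g1 hR g2 (by omega)
  exact h.anc_unique g1 h1 ha (h.R_par g1 e) hba (by omega)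

theorem dep_le (h : Forest K Q dep par) (hq : Q q) : dep q ≤ K.c := by
  refine le_trans ?_ (h.leader q hq).1.card_le
  induction hd : dep q using Nat.strong_induction_on generalizing q with
  | _ d ih =>
    by_cases e : par q = K.n
    · have := (h.root q hq e).1
      have : 0 < (K.reach q).card :=
        Finset.card_pos.2 ⟨q, (K.mem_reach (h.leader q hq).lt).2 (R.refl q)⟩
      omega
    · obtain ⟨h1, h2, h3, h4⟩ := h.child q hq e
      have := ih (dep (par q)) (by omega) h1 rfl
      have := (h.leader q hq).card_lt (h.leader _ h1) (h.R_par hq e) h2.symm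
      omega

theorem erase (h : Forest K Q dep par) (hleaf : ∀ a, Q a → par a ≠ q) :
    Forest K (fun u => Q u ∧ u ≠ q) dep par := by
  refine ⟨fun a ha => h.leader a ha.1, fun a ha e => ?_, fun a ha e => ?_⟩
  · obtain ⟨h1, h2⟩ := h.root a ha.1 e
    exact ⟨h1, fun b hb => h2 b hb.1⟩
  · obtain ⟨h1, h2, h3, h4⟩ := h.child a ha.1 e
    exact ⟨⟨h1, hleaf a ha.1⟩, h2, h3, fun b hb => h4 b hb.1⟩

end Forest

/-- The vertices of `W` are not distinguished by the other vertices in `Cur`. -/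
def IsModule (K : Net) (Cur W : ℕ → Prop) : Prop :=
  ∀ u, Cur u → ¬ W u → ∀ w w', W w → W w' → (K.R u w ↔ K.R u w') ∧ (K.R w u ↔ K.R w' u)

/-- `v` and `p` are not distinguished by the other vertices in `Cur`. -/
def Twins (K : Net) (Cur : ℕ → Prop) (v p : ℕ) : Prop :=
  ∀ u, Cur u → u ≠ v → u ≠ p → (K.R u v ↔ K.R u p) ∧ (K.R v u ↔ K.R p u)

/-- What stays fixed while the set `W` is contracted to a single vertex: `W` is a module in `Cur₀`
and the union of trees of the forest on `Q₀` whose roots have the depth `d₀` and the same parent. -/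
structure Block (K : Net) (Cur₀ Q₀ W : ℕ → Prop) (dep par : ℕ → ℕ) (d₀ : ℕ) : Prop where
  sub : ∀ w, W w → Q₀ w
  lt : ∀ w, W w → w < K.n
  dep_ge : ∀ w, W w → d₀ ≤ dep w
  par_mem : ∀ w, W w → d₀ < dep w → W (par w)
  par_eq : ∀ w w', W w → W w' → dep w = d₀ → dep w' = d₀ → par w = par w'
  module : ∀ a b, W a → W b → a ≠ b → IsModule K Cur₀ W
  kids : ∀ a b, W a → W b → a ≠ b → ∀ q, Q₀ q → W (par q) → W q

/-- The state of a contraction. `Cur` are the vertices that are left and `Q` those among them that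
form the forest; the vertices in `Done` have been treated. A treated vertex that is left has no
children any more, and is remembered by `last` at its parent. -/
structure Contr (K : Net) (Cur₀ Q₀ W Done Cur Q : ℕ → Prop) (dep par last : ℕ → ℕ) : Prop where
  forest : Forest K Q dep par
  sub : ∀ q, Q q → Q₀ q
  q_iff : ∀ u, ¬ W u → (Q u ↔ Q₀ u)
  cur_iff : ∀ u, Cur u ↔ Cur₀ u ∧ (W u → Q u)
  done_sub : ∀ x, Done x → W x
  undone : ∀ x, W x → ¬ Done x → Q x
  down : ∀ x y, W x → Done y → dep y < dep x → Done x
  last_of : ∀ q, Q q → Done q → last (par q) = q + 1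
  of_last : ∀ y, last y ≠ 0 → ∃ q, last y = q + 1 ∧ Q q ∧ Done q ∧ par q = y
  done_last : ∀ x, Done x → last x = 0
  left : (∃ w, W w) → ∃ w, W w ∧ Q w

namespace Contr

variable {K : Net} {Cur₀ Q₀ W Done Cur Q : ℕ → Prop} {dep par last : ℕ → ℕ} {d₀ x z y : ℕ}

open Net

theorem cur_w (h : Contr K Cur₀ Q₀ W Done Cur Q dep par last) {u : ℕ} (hu : Cur u) (hw : W u) :
    Q u := ((h.cur_iff u).1 hu).2 hw

theorem par_ne (h : Contr K Cur₀ Q₀ W Done Cur Q dep par last) (hB : Block K Cur₀ Q₀ W dep par d₀)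
    (hq : Q x) (hx : W x) : par x ≠ x := by
  intro e
  have := hB.lt x hx
  exact (h.forest.child x hq (by omega)).2.1 e

/-- A treated vertex is a leaf. -/
theorem leaf_of_done (h : Contr K Cur₀ Q₀ W Done Cur Q dep par last)
    (hB : Block K Cur₀ Q₀ W dep par d₀) {a b : ℕ} (ha : W a) (hb : W b) (hab : a ≠ b)
    (hz : Done z) : ∀ q, Q q → par q ≠ z := by
  rintro q hq rfl
  have hw := h.done_sub _ hz
  have hqw := hB.kids a b ha hb hab q (h.sub q hq) hw
  have hn := hB.lt _ hw
  have hd := (h.forest.child q hq (by omega)).2.2.1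
  have h1 := h.last_of q hq (h.down q _ hqw hz (by omega))
  have h2 := h.done_last _ hz
  omega

/-- At the time when it is treated, a vertex has at most the remembered child. -/
theorem child_eq (h : Contr K Cur₀ Q₀ W Done Cur Q dep par last)
    (hB : Block K Cur₀ Q₀ W dep par d₀) {a b : ℕ} (ha : W a) (hb : W b) (hab : a ≠ b)
    (hx : W x) (hlev : ∀ y, W y → dep x < dep y → Done y) {q : ℕ} (hq : Q q) (hp : par q = x) :
    last x = q + 1 := by
  subst hp
  have hqw := hB.kids a b ha hb hab q (h.sub q hq) hx
  have hn := hB.lt _ hx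
  have hd := (h.forest.child q hq (by omega)).2.2.1
  exact h.last_of q hq (hlev q hqw (by omega))

/-- The remembered child can be merged into its parent. -/
theorem absorb (h : Contr K Cur₀ Q₀ W Done Cur Q dep par last)
    (hB : Block K Cur₀ Q₀ W dep par d₀) (hx : W x) (hnd : ¬ Done x)
    (hlev : ∀ y, W y → dep x < dep y → Done y) (hz : last x = z + 1) :
    (Q z ∧ W z ∧ z ≠ x ∧ dep x < dep z) ∧ Twins K Cur z x ∧
      Contr K Cur₀ Q₀ W Done (fun u => Cur u ∧ u ≠ z) (fun u => Q u ∧ u ≠ z) dep par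
        (Function.update last x 0) := by
  obtain ⟨q, e1, hqQ, hqD, hqp⟩ := h.of_last x (by omega)
  obtain rfl : q = z := by omega
  have hqW := h.done_sub _ hqD
  have hxQ := h.undone x hx hnd
  have hqx : q ≠ x := by rintro rfl; exact hnd hqD
  have hn := hB.lt _ hx
  obtain ⟨f1, f2, f3, f4⟩ := h.forest.child q hqQ (by omega)
  have hleaf := h.leaf_of_done hB hqW hx hqx hqD
  have hRqx : K.R q x := by have := h.forest.R_par hqQ (by omega); rwa [hqp] at this
  have hrec : ∀ q', Q q' → par q' = x → q' = q := by
    intro q' hq' hp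
    have := h.child_eq hB hqW hx hqx hx hlev hq' hp
    omega
  refine ⟨⟨hqQ, hqW, hqx, by rw [hqp] at f3; omega⟩, ?_, ?_⟩
  · intro u hu huq hux
    by_cases hw : W u
    · have huQ := h.cur_w hu hw
      refine ⟨⟨fun hr => hr.trans hRqx, fun hr => ?_⟩, ?_⟩
      · obtain ⟨b, b1, b2, b3⟩ := h.forest.exists_child huQ hxQ hr (Ne.symm hux)
        rwa [hrec b b1 b3] at b2
      · rw [f4 u huQ huq, hqp]
    · exact hB.module q x hqW hx hqx u ((h.cur_iff u).1 hu).1 hw q x hqW hx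
  · constructor
    · exact h.forest.erase hleaf
    · intro u hu; exact h.sub u hu.1
    · intro u hu
      rw [← h.q_iff u hu]
      exact ⟨fun h => h.1, fun h => ⟨h, fun e => hu (e ▸ hqW)⟩⟩
    · intro u
      rw [h.cur_iff]
      constructor
      · rintro ⟨⟨g1, g2⟩, g3⟩; exact ⟨g1, fun hw => ⟨g2 hw, g3⟩⟩
      · rintro ⟨g1, g2⟩
        exact ⟨⟨g1, fun hw => (g2 hw).1⟩, fun e => (g2 (e ▸ hqW)).2 e⟩
    · exact h.done_sub
    · intro y hy hyd; exact ⟨h.undone y hy hyd, by rintro rfl; exact hyd hqD⟩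
    · exact h.down
    · intro y hy hyd
      have : par y ≠ x := fun e => hy.2 (hrec y hy.1 e)
      rw [Function.update_of_ne this]
      exact h.last_of y hy.1 hyd
    · intro y hy
      have hyx : y ≠ x := by rintro rfl; simp at hy
      rw [Function.update_of_ne hyx] at hy ⊢
      obtain ⟨q', g1, g2, g3, g4⟩ := h.of_last y hy
      exact ⟨q', g1, ⟨g2, by rintro rfl; exact hyx (g4.symm.trans hqp)⟩, g3, g4⟩
    · intro y hy
      rw [Function.update_of_ne (by rintro rfl; exact hnd hy)]
      exact h.done_last y hy
    · intro _
      exact ⟨x, hx, hxQ, hqx.symm⟩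

/-- A childless vertex can be merged into the sibling that is remembered. -/
theorem join (h : Contr K Cur₀ Q₀ W Done Cur Q dep par last)
    (hB : Block K Cur₀ Q₀ W dep par d₀) (hx : W x) (hnd : ¬ Done x)
    (hlev : ∀ y, W y → dep x < dep y → Done y) (hlev' : ∀ y, Done y → dep x ≤ dep y)
    (h0 : last x = 0) (hy : last (par x) = y + 1) :
    (Q y ∧ W y ∧ y ≠ x ∧ Done y ∧ dep y = dep x) ∧ Twins K Cur x y ∧
      Contr K Cur₀ Q₀ W (fun u => Done u ∨ u = x) (fun u => Cur u ∧ u ≠ x)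
        (fun u => Q u ∧ u ≠ x) dep par last := by
  obtain ⟨q, e1, hqQ, hqD, hqp⟩ := h.of_last _ (by omega : last (par x) ≠ 0)
  obtain rfl : q = y := by omega
  have hqW := h.done_sub _ hqD
  have hxQ := h.undone x hx hnd
  have hqx : q ≠ x := by rintro rfl; exact hnd hqD
  have hleafq := h.leaf_of_done hB hqW hx hqx hqD
  have hleaf : ∀ q', Q q' → par q' ≠ x := by
    intro q' hq' hp
    have := h.child_eq hB hqW hx hqx hx hlev hq' hp
    omega
  have hdep : dep q = dep x := by
    by_cases e : par x = K.n
    · rw [(h.forest.root x hxQ e).1, (h.forest.root q hqQ (by omega)).1]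
    · rw [(h.forest.child x hxQ e).2.2.1, (h.forest.child q hqQ (by omega)).2.2.1, hqp]
  refine ⟨⟨hqQ, hqW, hqx, hqD, hdep⟩, ?_, ?_⟩
  · intro u hu hux huq
    by_cases hw : W u
    · have huQ := h.cur_w hu hw
      have a1 : ¬ K.R u x := fun hr => by
        obtain ⟨b, b1, b2, b3⟩ := h.forest.exists_child huQ hxQ hr (Ne.symm hux)
        exact hleaf b b1 b3
      have a2 : ¬ K.R u q := fun hr => by
        obtain ⟨b, b1, b2, b3⟩ := h.forest.exists_child huQ hqQ hr (Ne.symm huq)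
        exact hleafq b b1 b3
      refine ⟨by simp [a1, a2], ?_⟩
      by_cases e : par x = K.n
      · have b1 := (h.forest.root x hxQ e).2 u huQ hux
        have b2 := (h.forest.root q hqQ (by omega)).2 u huQ huq
        simp [b1, b2]
      · rw [(h.forest.child x hxQ e).2.2.2 u huQ hux,
          (h.forest.child q hqQ (by omega)).2.2.2 u huQ huq, hqp]
    · exact hB.module q x hqW hx hqx u ((h.cur_iff u).1 hu).1 hw x q hx hqW
  · constructor
    · exact h.forest.erase hleaf
    · intro u hu; exact h.sub u hu.1
    · intro u hu
      rw [← h.q_iff u hu]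
      exact ⟨fun h => h.1, fun h => ⟨h, fun e => hu (e ▸ hx)⟩⟩
    · intro u
      rw [h.cur_iff]
      constructor
      · rintro ⟨⟨g1, g2⟩, g3⟩; exact ⟨g1, fun hw => ⟨g2 hw, g3⟩⟩
      · rintro ⟨g1, g2⟩
        exact ⟨⟨g1, fun hw => (g2 hw).1⟩, fun e => (g2 (e ▸ hx)).2 e⟩
    · rintro u (hu | rfl)
      exacts [h.done_sub u hu, hx]
    · intro u hu hud
      simp only [not_or] at hud
      exact ⟨h.undone u hu hud.1, hud.2⟩
    · rintro u v hu (hv | rfl) hd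
      · exact .inl (h.down u v hu hv hd)
      · exact .inl (hlev u hu hd)
    · rintro u ⟨hu, hne⟩ (hud | rfl)
      · exact h.last_of u hu hud
      · exact absurd rfl hne
    · intro v hv
      obtain ⟨q', g1, g2, g3, g4⟩ := h.of_last v hv
      exact ⟨q', g1, ⟨g2, by rintro rfl; exact hnd g3⟩, .inl g3, g4⟩
    · rintro u (hu | rfl)
      exacts [h.done_last u hu, h0]
    · intro _; exact ⟨q, hqW, hqQ, hqx⟩

/-- A childless vertex is remembered at its parent. -/
theorem remember (h : Contr K Cur₀ Q₀ W Done Cur Q dep par last)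
    (hB : Block K Cur₀ Q₀ W dep par d₀) (hx : W x) (hnd : ¬ Done x)
    (hlev : ∀ y, W y → dep x < dep y → Done y) (hlev' : ∀ y, Done y → dep x ≤ dep y)
    (h0 : last x = 0) (hy : last (par x) = 0) :
    Contr K Cur₀ Q₀ W (fun u => Done u ∨ u = x) Cur Q dep par
      (Function.update last (par x) (x + 1)) := by
  have hxQ := h.undone x hx hnd
  have hn := hB.lt x hx
  constructor
  · exact h.forest
  · exact h.sub
  · exact h.q_iff
  · exact h.cur_iff
  · rintro u (hu | rfl)
    exacts [h.done_sub u hu, hx]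
  · intro u hu hud
    simp only [not_or] at hud
    exact h.undone u hu hud.1
  · rintro u v hu (hv | rfl) hd
    · exact .inl (h.down u v hu hv hd)
    · exact .inl (hlev u hu hd)
  · rintro u hu (hud | rfl)
    · have h1 := h.last_of u hu hud
      rw [Function.update_of_ne]
      · exact h1
      · intro e; rw [e] at h1; omega
    · simp
  · intro v hv
    by_cases e : v = par x
    · subst e; exact ⟨x, by simp, hxQ, .inr rfl, rfl⟩
    · rw [Function.update_of_ne e] at hv ⊢
      obtain ⟨q', g1, g2, g3, g4⟩ := h.of_last v hv
      exact ⟨q', g1, g2, .inl g3, g4⟩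
  · rintro u (hu | rfl)
    · rw [Function.update_of_ne]
      · exact h.done_last u hu
      · rintro rfl
        have := hlev' _ hu
        have := hB.lt _ (h.done_sub _ hu)
        have := (h.forest.child x hxQ (by omega)).2.2.1
        omega
    · rw [Function.update_of_ne (h.par_ne hB hxQ hx).symm]
      exact h0
  · exact h.left

/-- When all vertices have been treated, exactly one of them is left. -/
theorem unique (h : Contr K Cur₀ Q₀ W Done Cur Q dep par last)
    (hB : Block K Cur₀ Q₀ W dep par d₀) (hall : ∀ x, W x → Done x) {w : ℕ} (hw : W w) (hq : Q w) :
    dep w = d₀ ∧ (∀ u, W u → Q u → u = w) ∧ ∀ y, last y ≠ 0 → y = par w := by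
  have hd : ∀ u, W u → Q u → dep u = d₀ := by
    intro u hu huq
    by_contra hne
    have h1 := hB.dep_ge u hu
    have h2 := h.done_last _ (hall _ (hB.par_mem u hu (by omega)))
    have h3 := h.last_of u huq (hall u hu)
    omega
  have hu : ∀ u, W u → Q u → u = w := by
    intro u hu huq
    have h1 := h.last_of u huq (hall u hu)
    have h2 := h.last_of w hq (hall w hw)
    rw [hB.par_eq u w hu hw (hd u hu huq) (hd w hw hq)] at h1
    omega
  refine ⟨hd w hw hq, hu, fun y hy => ?_⟩
  obtain ⟨q, g1, g2, g3, g4⟩ := h.of_last y hy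
  rw [← g4, hu q (h.done_sub q g3) g2]

theorem congr {Done' Cur' Q' : ℕ → Prop} (h : Contr K Cur₀ Q₀ W Done Cur Q dep par last)
    (hD : ∀ u, Done' u ↔ Done u) (hC : ∀ u, Cur' u ↔ Cur u) (hQ : ∀ u, Q' u ↔ Q u) :
    Contr K Cur₀ Q₀ W Done' Cur' Q' dep par last := by
  obtain rfl : Done' = Done := funext fun u => propext (hD u)
  obtain rfl : Cur' = Cur := funext fun u => propext (hC u)
  obtain rfl : Q' = Q := funext fun u => propext (hQ u)
  exact h

end Contr

/-! ### Contracting a block of the forest -/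

namespace Contract

open Ex Cmd Net

/-- Eliminates the vertex `a`, which is indistinguishable from `b`. -/
def emit (a b : Reg) : Cmd :=
  put .lx Reg.em a ;; put .lp Reg.em b ;; .set .em (Reg.em + 1) ;; put .rep a 0

/-- Merges the remembered child into `x`. -/
def absorb : Cmd :=
  .set .z (get .last Reg.x) ;;
  when (lt 0 Reg.z) (.set .z (Reg.z - 1) ;; emit .z .x ;; put .last Reg.x 0)

/-- Merges `x` into the remembered sibling, or remembers `x`. -/
def join : Cmd :=
  .set .p (get .par Reg.x) ;;
  .set .y (get .last Reg.p) ;;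
  ite (lt 0 Reg.y) (.set .y (Reg.y - 1) ;; emit .x .y)
    (put .last Reg.p (Reg.x + 1) ;; .set .w Reg.x)

/-- Treats the `j`-th vertex of the list if it is left and has the depth `d`. -/
def body : Cmd :=
  .set .x (get .row (Reg.base + Reg.j)) ;;
  when (eq (get .rep Reg.x) 1 * eq (get .dep Reg.x) Reg.d) (absorb ;; join)

/-- Contracts the vertices of depth at least `q` in the list of length `len` at `base`. The levels are
treated from the deepest one upwards. Finally the mark at the parent of the last vertex is erased. -/
def prog : Cmd :=
  .set .d cE ;;
  .loop (lt Reg.q (Reg.d + 1) * lt 0 Reg.d) (.for .j Reg.len body ;; .set .d (Reg.d - 1)) ;;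
  put .last (get .par Reg.w) 0

variable {K : Net} {Cur₀ Q₀ W Done : ℕ → Prop} {d₀ : ℕ}

/-- The invariant of the contraction. -/
structure Inv (K : Net) (Cur₀ Q₀ W Done : ℕ → Prop) (s : St) : Prop where
  elim : K.ElimOk (s.arr .lx) (s.arr .lp) (s.reg .em)
  contr : Contr K Cur₀ Q₀ W Done (K.Left (s.arr .lx) (s.reg .em)) (fun u => s.arr .rep u = 1)
    (s.arr .dep) (s.arr .par) (s.arr .last)
  left : ∀ u, s.arr .rep u = 1 → K.Left (s.arr .lx) (s.reg .em) u
  par_le : ∀ u, s.arr .par u ≤ K.n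
  last_le : ∀ u, s.arr .last u ≤ K.n

theorem Inv.congr {Done' : ℕ → Prop} {s s' : St} (h : Inv K Cur₀ Q₀ W Done s)
    (hD : ∀ u, Done' u ↔ Done u) (ha : ∀ k, k ≠ .stamp → s'.arr k = s.arr k)
    (hr : s'.reg .em = s.reg .em) : Inv K Cur₀ Q₀ W Done' s' := by
  have h1 := ha .lx (by simp)
  have h2 := ha .lp (by simp)
  have h3 := ha .rep (by simp)
  have h4 := ha .dep (by simp)
  have h5 := ha .par (by simp)
  have h6 := ha .last (by simp)
  constructor <;> simp only [h1, h2, h3, h4, h5, h6, hr]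
  exacts [h.elim, h.contr.congr hD (fun _ => Iff.rfl) (fun _ => Iff.rfl), h.left, h.par_le, h.last_le]

/-- If a child of `x` has been recorded, its subtree has already been reduced to this one vertex, which
is a twin of `x` and is eliminated into it; then `x` is a leaf. -/
theorem absorb_runs {s : St} {x : ℕ} (hI : Inv K Cur₀ Q₀ W Done s)
    (hB : Block K Cur₀ Q₀ W (s.arr .dep) (s.arr .par) d₀) (hx : W x) (hnd : ¬ Done x)
    (hlev : ∀ y, W y → s.arr .dep x < s.arr .dep y → Done y) (hsx : s.reg .x = x) {f : ℕ} :
    Runs K.toEnv absorb s f fun s' => Inv K Cur₀ Q₀ W Done s' ∧ s'.arr .last x = 0 ∧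
      ∀ u, s.arr .rep u = 1 → s.arr .dep u ≤ s.arr .dep x → s'.arr .rep u = 1 := by
  have hn := hB.lt x hx
  have hxl := K.lt_two_mul hn.le
  have hnX := K.n_le_X
  have hll := hI.last_le x
  refine .of_wp ?_
  simp [absorb, when, emit, hsx, Env.lim]
  refine ⟨by omega, by omega, fun hz => ?_, fun hz => ⟨hI.congr (fun _ => Iff.rfl)
    (fun _ _ => rfl) rfl, hz, fun u h _ => h⟩⟩
  obtain ⟨z, hz'⟩ : ∃ z, s.arr .last x = z + 1 := ⟨s.arr .last x - 1, by omega⟩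
  obtain ⟨⟨h1, h2, h3, h4⟩, ht, hc⟩ := hI.contr.absorb hB hx hnd hlev hz'
  simp only [hz', Nat.add_sub_cancel]
  have hzn := hB.lt z h2
  have hzl := K.lt_two_mul hzn.le
  have hlz := hI.left z h1
  have hlx := hI.left x (hI.contr.undone x hx hnd)
  have hem := hI.elim.lt_of_left hlz
  have heml := K.lt_two_mul hem.le
  refine ⟨by omega, heml, by omega, heml, by omega, by omega, hzl, hxl, ?_, ?_⟩
  · constructor
    · simpa using hI.elim.snoc hlz hlx h3 ht
    · have := hc.congr (Cur' := K.Left (Function.update (s.arr .lx) (s.reg .em) z) (s.reg .em + 1))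
        (Q' := fun u => Function.update (s.arr .rep) z 0 u = 1) (fun _ => Iff.rfl)
        (fun u => left_update) (fun u => by
          by_cases e : u = z
          · subst e; simp
          · simp [e])
      simpa using this
    · intro u hu
      simp only [St.setR_reg, St.setR_arr, St.setA_arr, St.setA_reg, reduceCtorEq, if_false,
        if_true] at hu ⊢
      by_cases e : u = z
      · subst e; simp at hu
      · rw [Function.update_of_ne e] at hu
        exact left_update.2 ⟨hI.left u hu, e⟩
    · intro u; simpa using hI.par_le u
    · intro u; simp [Function.update_apply]; split_ifs
      · omega
      · exact hI.last_le u
  · intro u hu hd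
    rw [Function.update_of_ne (by rintro rfl; omega)]
    exact hu

/-- Two sibling leaves are twins, so that only one child of each treated parent remains. -/
theorem join_runs {s : St} {x : ℕ} (hI : Inv K Cur₀ Q₀ W Done s)
    (hB : Block K Cur₀ Q₀ W (s.arr .dep) (s.arr .par) d₀) (hx : W x) (hnd : ¬ Done x)
    (hlev : ∀ y, W y → s.arr .dep x < s.arr .dep y → Done y)
    (hlev' : ∀ y, Done y → s.arr .dep x ≤ s.arr .dep y) (h0 : s.arr .last x = 0)
    (hw : (∃ u, Done u ∧ s.arr .dep u = s.arr .dep x) → Done (s.reg .w) ∧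
      s.arr .rep (s.reg .w) = 1 ∧ s.arr .dep (s.reg .w) = s.arr .dep x)
    (hsx : s.reg .x = x) {f : ℕ} :
    Runs K.toEnv join s f fun s' => Inv K Cur₀ Q₀ W (fun u => Done u ∨ u = x) s' ∧
      (Done (s'.reg .w) ∨ s'.reg .w = x) ∧ s'.arr .rep (s'.reg .w) = 1 ∧
        s.arr .dep (s'.reg .w) = s.arr .dep x := by
  have hn := hB.lt x hx
  have hxl := K.lt_two_mul hn.le
  have hnX := K.n_le_X
  have hpl := hI.par_le x
  have hpl' := K.lt_two_mul hpl
  have hll := hI.last_le (s.arr .par x)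
  have hxQ := hI.contr.undone x hx hnd
  have hlx := hI.left x hxQ
  refine .of_wp ?_
  simp [join, emit, hsx, Env.lim]
  refine ⟨hxl, by omega, hpl', by omega, fun hy => ?_, fun hy => ⟨hpl', by omega, by omega, ?_, hxQ⟩⟩
  · obtain ⟨y, hy'⟩ : ∃ y, s.arr .last (s.arr .par x) = y + 1 :=
      ⟨s.arr .last (s.arr .par x) - 1, by omega⟩
    obtain ⟨⟨h1, h2, h3, h4, h5⟩, ht, hc⟩ := hI.contr.join hB hx hnd hlev hlev' h0 hy'
    obtain ⟨w1, w2, w3⟩ := hw ⟨y, h4, h5⟩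
    simp only [hy', Nat.add_sub_cancel]
    have hyn := hB.lt y h2
    have hly := hI.left y h1
    have hem := hI.elim.lt_of_left hlx
    have heml := K.lt_two_mul hem.le
    have hwx : s.reg .w ≠ x := fun e => hnd (e ▸ w1)
    refine ⟨by omega, heml, by omega, heml, by omega, by omega, hxl, ?_, .inl w1, ?_, w3⟩
    · constructor
      · simpa using hI.elim.snoc hlx hly h3.symm ht
      · have := hc.congr (Cur' := K.Left (Function.update (s.arr .lx) (s.reg .em) x) (s.reg .em + 1))
          (Q' := fun u => Function.update (s.arr .rep) x 0 u = 1) (fun _ => Iff.rfl)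
          (fun u => left_update) (fun u => by
            by_cases e : u = x
            · subst e; simp
            · simp [e])
        simpa using this
      · intro u hu
        simp only [St.setR_reg, St.setR_arr, St.setA_arr, St.setA_reg, reduceCtorEq, if_false,
          if_true] at hu ⊢
        by_cases e : u = x
        · subst e; simp at hu
        · rw [Function.update_of_ne e] at hu
          exact left_update.2 ⟨hI.left u hu, e⟩
      · intro u; simpa using hI.par_le u
      · intro u; simpa using hI.last_le u
    · rw [Function.update_of_ne hwx]; exact w2
  · constructor
    · simpa using hI.elim
    · simpa using hI.contr.remember hB hx hnd hlev hlev' h0 hy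
    · simpa using hI.left
    · simpa using hI.par_le
    · intro u; simp [Function.update_apply]; split_ifs
      · omega
      · exact hI.last_le u

/-- The list of the vertices among which the block is found. -/
structure IsList (K : Net) (Q₀ W : ℕ → Prop) (dep A : ℕ → ℕ) (b l d₀ : ℕ) : Prop where
  lt : ∀ j < l, A (b + j) < K.n
  inj : ∀ j < l, ∀ j' < l, A (b + j) = A (b + j') → j = j'
  mem : ∀ w, W w ↔ Q₀ w ∧ d₀ ≤ dep w ∧ ∃ j < l, A (b + j) = w
  bound : b + l ≤ 2 * (K.n * K.c)

/-- The vertices that have been treated before the `j`-th vertex of the list in round `d`. -/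
def DoneAt (W : ℕ → Prop) (dep A : ℕ → ℕ) (b d j u : ℕ) : Prop :=
  W u ∧ (d < dep u ∨ dep u = d ∧ ∃ i < j, A (b + i) = u)

theorem body_runs {s : St} {b l d j : ℕ}
    (hB : Block K Cur₀ Q₀ W (s.arr .dep) (s.arr .par) d₀)
    (hl : IsList K Q₀ W (s.arr .dep) (s.arr .row) b l d₀)
    (hI : Inv K Cur₀ Q₀ W (DoneAt W (s.arr .dep) (s.arr .row) b d j) s)
    (hw : (∃ u, DoneAt W (s.arr .dep) (s.arr .row) b d j u ∧ s.arr .dep u = d) →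
      DoneAt W (s.arr .dep) (s.arr .row) b d j (s.reg .w) ∧
      s.arr .rep (s.reg .w) = 1 ∧ s.arr .dep (s.reg .w) = d)
    (hb : s.reg .base = b) (hd : s.reg .d = d) (hj : s.reg .j = j) (hjl : j < l) (hdd : d₀ ≤ d)
    (hwn : s.reg .w < K.n) :
    Runs K.toEnv body s 0 fun s' => s'.reg .w < K.n ∧
      Inv K Cur₀ Q₀ W (DoneAt W (s.arr .dep) (s.arr .row) b d (j + 1)) s' ∧
      ((∃ u, DoneAt W (s.arr .dep) (s.arr .row) b d (j + 1) u ∧ s.arr .dep u = d) →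
        DoneAt W (s.arr .dep) (s.arr .row) b d (j + 1) (s'.reg .w) ∧
        s'.arr .rep (s'.reg .w) = 1 ∧ s.arr .dep (s'.reg .w) = d) := by
  have hx := hl.lt j hjl
  have hxl := K.lt_two_mul hx.le
  have hnX := K.n_le_X
  have hbl := hl.bound
  have hinj : ∀ i < l, s.arr .row (b + i) = s.arr .row (b + j) → i = j := fun i hi =>
    hl.inj i hi j hjl
  have hsucc : ∀ u, DoneAt W (s.arr .dep) (s.arr .row) b d (j + 1) u ↔
      DoneAt W (s.arr .dep) (s.arr .row) b d j u ∨
        W u ∧ s.arr .dep u = d ∧ u = s.arr .row (b + j) := by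
    intro u
    unfold DoneAt
    rw [← and_or_left, or_assoc, ← and_or_left]
    refine and_congr_right fun _ => or_congr_right (and_congr_right fun _ => ?_)
    constructor
    · rintro ⟨i, hi, rfl⟩
      by_cases e : i = j
      · subst e; exact .inr rfl
      · exact .inl ⟨i, by omega, rfl⟩
    · rintro (⟨i, hi, rfl⟩ | rfl)
      exacts [⟨i, by omega, rfl⟩, ⟨j, by omega, rfl⟩]
  have hbd : s.reg .base + s.reg .j = b + j := by omega
  refine .seq (.of_wp ?_)
  simp [hbd, Env.lim]
  generalize hxx : s.arr .row (b + j) = x at *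
  refine ⟨by omega, by omega, ?_⟩
  refine .ite (by simp [Env.lim, hxl]) (fun ht => ?_) (fun ht => .skip ?_)
  · simp at ht
    obtain ⟨ht1, ht2⟩ : s.arr .dep x = d ∧ s.arr .rep x = 1 := by
      refine ⟨?_, ?_⟩ <;> omega
    have hW : W x := (hl.mem x).2 ⟨hI.contr.sub x ht2, by omega, j, hjl, hxx⟩
    have hnd : ¬ DoneAt W (s.arr .dep) (s.arr .row) b d j x := by
      rintro ⟨_, h | ⟨_, i, hi, h⟩⟩
      · omega
      · have := hinj i (by omega) h; omega
    have hlev : ∀ y, W y → s.arr .dep x < s.arr .dep y →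
        DoneAt W (s.arr .dep) (s.arr .row) b d j y := fun y hy h => ⟨hy, .inl (by omega)⟩
    have hlev' : ∀ y, DoneAt W (s.arr .dep) (s.arr .row) b d j y → s.arr .dep x ≤ s.arr .dep y := by
      rintro y ⟨_, h | ⟨h, _⟩⟩ <;> omega
    refine .seq ((absorb_runs (s := s.setR .x x) (x := x) (hI.congr (fun _ => Iff.rfl) (fun _ _ => rfl) rfl)
      hB hW hnd hlev (by simp)).frame ?_)
    rintro s1 hf1 ⟨k1, k2, k3⟩
    have e1 : s1.arr .dep = s.arr .dep := (hf1.arr .dep rfl)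
    have e2 : s1.arr .par = s.arr .par := (hf1.arr .par rfl)
    have e3 : s1.reg .w = s.reg .w := by rw [hf1.reg .w rfl]; simp
    have e4 : s1.reg .x = x := by rw [hf1.reg .x rfl]; simp
    refine (join_runs k1 (by rw [e1, e2]; exact hB) hW hnd (by rw [e1]; exact hlev)
      (by rw [e1]; exact hlev') k2 ?_ e4).frame ?_
    · rw [e1, e3, ht1]
      intro h
      obtain ⟨g1, g2, g3⟩ := hw h
      exact ⟨g1, k3 _ (by simpa using g2) (by simp; omega), g3⟩
    · rintro s2 hf2 ⟨m1, m2, m3, m4⟩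
      rw [e1, ht1] at m4
      have hww : W (s2.reg .w) := m2.elim (fun h => h.1) (fun h => by rw [h]; exact hW)
      refine ⟨hB.lt _ hww, m1.congr (fun u => ?_) (fun _ _ => rfl) rfl, ?_⟩
      · rw [hsucc]
        refine or_congr_right ⟨fun h => h.2.2, ?_⟩
        rintro rfl; exact ⟨hW, ht1, rfl⟩
      · refine fun _ _ _ => ⟨?_, m3, m4⟩
        rw [hsucc]
        exact m2.imp id fun h => by rw [h]; exact ⟨hW, ht1, rfl⟩
  · have hsame : ∀ u, DoneAt W (s.arr .dep) (s.arr .row) b d (j + 1) u ↔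
        DoneAt W (s.arr .dep) (s.arr .row) b d j u := by
      intro u
      rw [hsucc]
      refine or_iff_left_of_imp ?_
      rintro ⟨h1, h2, rfl⟩
      by_contra hnd
      have := hI.contr.undone u h1 hnd
      simp [this, h2, hd] at ht
    refine ⟨by simpa using hwn, hI.congr hsame (fun _ _ => rfl) rfl, ?_⟩
    simp only [hsame]
    simpa using hw

/-- The result of a contraction of `W` from the state `s` to the state `s'`. -/
structure Result (K : Net) (W : ℕ → Prop) (d₀ : ℕ) (s s' : St) : Prop where
  elim : K.ElimOk (s'.arr .lx) (s'.arr .lp) (s'.reg .em)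
  forest : Forest K (fun u => s'.arr .rep u = 1) (s.arr .dep) (s.arr .par)
  last : ∀ y, s'.arr .last y = 0
  left : ∀ u, s'.arr .rep u = 1 → K.Left (s'.arr .lx) (s'.reg .em) u
  rep_iff : ∀ u, ¬ W u → (s'.arr .rep u = 1 ↔ s.arr .rep u = 1)
  left_iff : ∀ u, ¬ W u → (K.Left (s'.arr .lx) (s'.reg .em) u ↔ K.Left (s.arr .lx) (s.reg .em) u)
  left_rep : ∀ u, W u → K.Left (s'.arr .lx) (s'.reg .em) u → s'.arr .rep u = 1
  root : (∃ u, W u) → W (s'.reg .w) ∧ s.arr .dep (s'.reg .w) = d₀ ∧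
    ∀ u, W u → (s'.arr .rep u = 1 ↔ u = s'.reg .w)

theorem prog_runs {s : St} {b l : ℕ}
    (hB : Block K (K.Left (s.arr .lx) (s.reg .em)) (fun u => s.arr .rep u = 1) W
      (s.arr .dep) (s.arr .par) d₀)
    (hl : IsList K (fun u => s.arr .rep u = 1) W (s.arr .dep) (s.arr .row) b l d₀)
    (hd₀ : (∃ u, W u) → ∃ u, W u ∧ s.arr .dep u = d₀)
    (hE : K.ElimOk (s.arr .lx) (s.arr .lp) (s.reg .em))
    (hF : Forest K (fun u => s.arr .rep u = 1) (s.arr .dep) (s.arr .par))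
    (hleft : ∀ u, s.arr .rep u = 1 → K.Left (s.arr .lx) (s.reg .em) u)
    (hpar : ∀ u, s.arr .par u ≤ K.n) (hlast : ∀ u, s.arr .last u = 0)
    (hb : s.reg .base = b) (hlen : s.reg .len = l) (hq : s.reg .q = d₀)
    (hw : s.reg .w < K.n) (hlX : l < K.X) :
    Runs K.toEnv prog s ((K.c + 1) * ((l + 1) + 1)) fun s' =>
      Result K W d₀ s s' ∧ s'.reg .w < K.n := by
  have hnX := K.n_le_X
  have hcX := K.c_le_X
  have hcpos := K.c_pos
  have hI0 : Inv K (K.Left (s.arr .lx) (s.reg .em)) (fun u => s.arr .rep u = 1) W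
      (DoneAt W (s.arr .dep) (s.arr .row) b K.c 0) s := by
    have hno : ∀ u, ¬ DoneAt W (s.arr .dep) (s.arr .row) b K.c 0 u := by
      rintro u ⟨hu, h | ⟨_, i, hi, _⟩⟩
      · have := hF.dep_le (hB.sub u hu); omega
      · omega
    refine ⟨hE, ?_, hleft, hpar, fun u => by simp [hlast u]⟩
    refine ⟨hF, fun _ h => h, fun _ _ => Iff.rfl, fun u => ⟨fun h => ⟨h, fun hw => hB.sub u hw⟩,
      fun h => h.1⟩, fun x h => absurd h (hno x), fun x h _ => hB.sub x h, fun x y _ h => absurd h (hno y),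
      fun x _ h => absurd h (hno x), fun y h => absurd (hlast y) h, fun x h => absurd h (hno x), ?_⟩
    rintro ⟨w, hw⟩; exact ⟨w, hw, hB.sub w hw⟩
  refine .seq (.of_wp ?_)
  simp
  refine ⟨by omega, ?_⟩
  refine .seq ?_
  refine (Runs.loop (N := K.c) (f := (l + 1) * (0 + 1)) (fun i s' => s'.reg .d = K.c - i ∧ i ≤ K.c ∧
    Inv K (K.Left (s.arr .lx) (s.reg .em)) (fun u => s.arr .rep u = 1) W
      (DoneAt W (s.arr .dep) (s.arr .row) b (K.c - i) 0) s' ∧ s'.reg .w < K.n ∧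
    ((∃ u, W u) → K.c - i < d₀ → W (s'.reg .w) ∧ s'.arr .rep (s'.reg .w) = 1)) ?_ ?_ ?_ ?_).mono (by simp)
  · refine ⟨by simp, by simp, hI0.congr (fun _ => Iff.rfl) (fun _ _ => rfl) rfl, by simpa using hw, ?_⟩
    rintro ⟨u, hu⟩
    have := hF.dep_le (hB.sub u hu)
    have := hB.dep_ge u hu
    intro; omega
  · intro i s' _ _; simp
  · rintro i s1 hf1 ⟨g1, g2, g3, g4, g5⟩ hval
    have q1 : s1.reg .q = d₀ := by rw [hf1.reg .q rfl]; simpa using hq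
    have q2 : s1.reg .len = l := by rw [hf1.reg .len rfl]; simpa using hlen
    have q3 : s1.reg .base = b := by rw [hf1.reg .base rfl]; simpa using hb
    have a1 : s1.arr .dep = s.arr .dep := hf1.arr .dep rfl
    have a2 : s1.arr .par = s.arr .par := hf1.arr .par rfl
    have a3 : s1.arr .row = s.arr .row := hf1.arr .row rfl
    simp [g1, q1] at hval
    have hdd : d₀ ≤ K.c - i := by omega
    refine ⟨by omega, .seq ?_⟩
    refine Runs.frame (Runs.for (Q := fun s' =>
      Inv K (K.Left (s.arr .lx) (s.reg .em)) (fun u => s.arr .rep u = 1) W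
        (DoneAt W (s.arr .dep) (s.arr .row) b (K.c - i) l) s' ∧ s'.reg .w < K.n ∧
      ((∃ u, DoneAt W (s.arr .dep) (s.arr .row) b (K.c - i) l u ∧ s.arr .dep u = K.c - i) →
        DoneAt W (s.arr .dep) (s.arr .row) b (K.c - i) l (s'.reg .w) ∧
        s'.arr .rep (s'.reg .w) = 1 ∧ s.arr .dep (s'.reg .w) = K.c - i)) l (f := 0) (fun j s' =>
      Inv K (K.Left (s.arr .lx) (s.reg .em)) (fun u => s.arr .rep u = 1) W
        (DoneAt W (s.arr .dep) (s.arr .row) b (K.c - i) j) s' ∧ s'.reg .w < K.n ∧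
      ((∃ u, DoneAt W (s.arr .dep) (s.arr .row) b (K.c - i) j u ∧ s.arr .dep u = K.c - i) →
        DoneAt W (s.arr .dep) (s.arr .row) b (K.c - i) j (s'.reg .w) ∧
        s'.arr .rep (s'.reg .w) = 1 ∧ s.arr .dep (s'.reg .w) = K.c - i)) rfl hlX ?_ ?_ ?_ ?_ fun _ h => h) ?_
    · intro j s' x h
      exact ⟨h.1.congr (fun _ => Iff.rfl) (fun _ _ => rfl) (by simp), by simpa using h.2⟩
    · refine ⟨g3, g4, ?_⟩
      rintro ⟨u, ⟨_, h | ⟨_, i, hi, _⟩⟩, h'⟩ <;> omega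
    · intro j s' hf _
      have : s'.reg .len = l := (hf.reg .len rfl).trans q2
      simp [this]
    · rintro j s2 hf2 ⟨k1, k2, k3⟩ hj hjl
      have b1 : s2.arr .dep = s.arr .dep := (hf2.arr .dep rfl).trans a1
      have b2 : s2.arr .par = s.arr .par := (hf2.arr .par rfl).trans a2
      have b3 : s2.arr .row = s.arr .row := (hf2.arr .row rfl).trans a3
      have := body_runs (s := s2) (b := b) (l := l) (d := K.c - i) (j := j)
        (by rw [b1, b2]; exact hB) (by rw [b1, b3]; exact hl)
        (by rw [b1, b3]; exact k1) (by rw [b1, b3]; exact k3) ((hf2.reg .base rfl).trans q3)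
        ((hf2.reg .d rfl).trans g1) hj hjl hdd
      rw [b1, b3] at this
      exact (this k2).frame fun s3 _ m => ⟨m.2.1, m.1, m.2.2⟩
    · rintro s2 hf2 ⟨k1, k2, k3⟩
      have r1 : s2.reg .d = K.c - i := (hf2.reg .d rfl).trans g1
      refine .of_wp ?_
      simp [r1]
      -- after the round all vertices of depth at least `d` have been treated
      have hiff : ∀ u, DoneAt W (s.arr .dep) (s.arr .row) b (K.c - (i + 1)) 0 u ↔
          DoneAt W (s.arr .dep) (s.arr .row) b (K.c - i) l u := by
        intro u
        refine and_congr_right fun hu => ?_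
        constructor
        · rintro (h | ⟨_, j, hj, _⟩)
          · by_cases e : K.c - i < s.arr .dep u
            · exact .inl e
            · exact .inr ⟨by omega, ((hl.mem u).1 hu).2.2⟩
          · omega
        · rintro (h | ⟨h, _⟩) <;> exact .inl (by omega)
      refine ⟨by omega, by omega, by omega, k1.congr hiff (fun _ _ => rfl) rfl, k2, ?_⟩
      intro u hu hlt
      by_cases e : d₀ = K.c - i
      · obtain ⟨u', hu', hdu'⟩ := hd₀ ⟨u, hu⟩
        obtain ⟨p1, p2, p3⟩ := k3 ⟨u', ⟨hu', .inr ⟨by omega, ((hl.mem u').1 hu').2.2⟩⟩, by omega⟩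
        exact ⟨p1.1, p2⟩
      · omega
  · rintro i s1 hf1 ⟨g1, g2, g3, g4, g5⟩ hval
    have q1 : s1.reg .q = d₀ := by rw [hf1.reg .q rfl]; simpa using hq
    have a1 : s1.arr .dep = s.arr .dep := hf1.arr .dep rfl
    have a2 : s1.arr .par = s.arr .par := hf1.arr .par rfl
    simp [g1, q1] at hval
    have hC := g3.contr
    rw [a1, a2] at hC
    have hpar1 := g3.par_le (s1.reg .w)
    have hpl := K.lt_two_mul hpar1
    have hwl := K.lt_two_mul g4.le
    have hlt : (∃ u, W u) → K.c - i < d₀ := by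
      rintro ⟨u, hu⟩
      obtain ⟨u', hu', hdu'⟩ := hd₀ ⟨u, hu⟩
      have := hF.dep_pos (hB.sub u' hu')
      omega
    have hall : ∀ u, W u → DoneAt W (s.arr .dep) (s.arr .row) b (K.c - i) 0 u := by
      intro u hu
      have := hlt ⟨u, hu⟩
      have := hB.dep_ge u hu
      exact ⟨hu, .inl (by omega)⟩
    refine .of_wp ?_
    simp [Env.lim, hwl, hpl]
    refine ⟨?_, g4⟩
    constructor
    · simpa using g3.elim
    · simpa using hC.forest
    · intro y
      simp only [St.setA_arr, if_true, a2, Function.update_apply]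
      split_ifs with hy
      · rfl
      · by_contra hne
        obtain ⟨q, p1, p2, p3, p4⟩ := hC.of_last y hne
        obtain ⟨w1, w2⟩ := g5 ⟨q, p3.1⟩ (hlt ⟨q, p3.1⟩)
        exact hy ((hC.unique hB hall w1 w2).2.2 y hne)
    · simpa using g3.left
    · simpa using hC.q_iff
    · intro u hu
      have := hC.cur_iff u
      simp [hu] at this ⊢
      exact this
    · intro u hu h
      simp at h ⊢
      exact ((hC.cur_iff u).1 h).2 hu
    · intro hne
      obtain ⟨w1, w2⟩ := g5 hne (hlt hne)
      obtain ⟨h1, h2, h3⟩ := hC.unique hB hall w1 w2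
      simp
      refine ⟨w1, h1, fun u hu => ⟨fun h => h2 u hu h, ?_⟩⟩
      rintro rfl; exact w2

end Contract

/-! ### Blocks in preorders without the pattern `N` -/

/-- Reachability does not contain the four-element pattern `N`: if `a` and `b` reach `c`, and `b`
reaches `d`, then `a` reaches `d`, or `a` and `b` are comparable, or `c` and `d` are. -/
def NFree (K : Net) : Prop := ∀ a b c d, a < K.n → b < K.n → K.R a c → K.R b c → K.R b d →
  K.R a d ∨ K.R a b ∨ K.R b a ∨ K.R c d ∨ K.R d c

open Net in
/-- The part of the up-set of a new vertex `v` that is not a chain is a module, because reachability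
does not contain the pattern `N`. Here `Q` is the forest, and `Cur` contains in addition the vertices
that are still to be inserted. Below level `d₀` the up-set of `v` is a chain (`H1`), and `W` is empty,
or a single vertex, or contains two vertices of level `d₀` (`H2`). -/
theorem Block.of_nFree {K : Net} {Cur Q W : ℕ → Prop} {dep par : ℕ → ℕ} {d₀ v : ℕ} (hN : NFree K)
    (hF : Forest K Q dep par) (hv : K.Leader v) (hQv : ∀ q, Q q → ¬ K.R q v)
    (hCur : ∀ u, Cur u → Q u ∨ K.Leader u ∧ (u = v ∨ ¬ K.R v u) ∧ ∀ q, Q q → ¬ K.R q u)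
    (hQC : ∀ q, Q q → Cur q) (hW : ∀ w, W w ↔ Q w ∧ K.R v w ∧ d₀ ≤ dep w) (H0 : ∀ w, W w → 1 ≤ d₀)
    (H1 : ∀ a b, Q a → Q b → K.R v a → K.R v b → dep a = dep b → dep a < d₀ → a = b)
    (H2 : ∀ a b, W a → W b → a ≠ b → ∃ a b, W a ∧ W b ∧ dep a = d₀ ∧ dep b = d₀ ∧ a ≠ b) :
    Block K Cur Q W dep par d₀ := by
  have hsub : ∀ w, W w → Q w := fun w h => ((hW w).1 h).1
  have hlt : ∀ w, W w → w < K.n := fun w h => (hF.leader w (hsub w h)).lt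
  have hge : ∀ w, W w → d₀ ≤ dep w := fun w h => ((hW w).1 h).2.2
  have hRv : ∀ w, W w → K.R v w := fun w h => ((hW w).1 h).2.1
  have hmod : ∀ a b, W a → W b → a ≠ b → IsModule K Cur W := by
    intro a' b' ha' hb' hab'
    obtain ⟨a, b, ha, hb, hda, hdb, hab⟩ := H2 a' b' ha' hb' hab'
    have hd1 := H0 a ha
    -- a vertex of the block is incomparable to each vertex at the top level other than its ancestor
    have hinc : ∀ w e c, W w → W e → dep e = d₀ → Q c → K.R w c → dep c = d₀ → e ≠ c →
        ¬ K.R w e ∧ ¬ K.R e w := by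
      intro w e c hw he hde hc hwc hdc hec
      refine ⟨fun h => hec (hF.anc_unique (hsub w hw) (hsub e he) hc h hwc (by omega)), fun h => ?_⟩
      by_cases hew : w = e
      · subst hew
        exact hec (hF.anc_unique (hsub w hw) (hsub w hw) hc (R.refl _) hwc (by omega))
      · have := hF.dep_lt (hsub e he) (hsub w hw) h hew
        have := hge w hw
        omega
    have hstep : ∀ u w z, Cur u → ¬ W u → W w → W z → ¬ K.R w z ∧ ¬ K.R z w → K.R u w →
        K.R u z := by
      intro u w z hu huW hw hz hwz huw
      have hul : K.Leader u := (hCur u hu).elim (fun h => hF.leader u h) fun h => h.1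
      rcases hN u v w z hul.lt hv.lt huw (hRv w hw) (hRv z hz) with h | h | h | h | h
      · exact h
      · exact h.trans (hRv z hz)
      · rcases hCur u hu with hq | ⟨_, h2 | h2, _⟩
        · have h3 : dep u < d₀ := by
            by_contra h3
            exact huW ((hW u).2 ⟨hq, h, by omega⟩)
          have h4 := hF.dep_lt hq (hsub w hw) huw (by rintro rfl; exact huW hw)
          have := hge w hw
          omega
        · subst h2; exact hRv z hz
        · exact absurd h h2
      · exact absurd h hwz.1
      · exact absurd h hwz.2
    -- two incomparable vertices of the block are linked directly by `hstep`, others through a vertex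
    -- of level `d₀` that is incomparable to both, or through two such vertices
    have hto : ∀ u w w', Cur u → ¬ W u → W w → W w' → K.R u w → K.R u w' := by
      intro u w w' hu huW hw hw' huw
      obtain ⟨c, hc1, hc2, hc3⟩ := hF.anc_exists (hsub w hw) hd1 (hge w hw)
      obtain ⟨c', hc1', hc2', hc3'⟩ := hF.anc_exists (hsub w' hw') hd1 (hge w' hw')
      obtain ⟨e, e', he, he', hde, hde', hee, hec⟩ : ∃ e e', W e ∧ W e' ∧ dep e = d₀ ∧ dep e' = d₀ ∧
          e ≠ e' ∧ e ≠ c := by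
        by_cases h : a = c
        · exact ⟨b, a, hb, ha, hdb, hda, hab.symm, by rw [← h]; exact hab.symm⟩
        · exact ⟨a, b, ha, hb, hda, hdb, hab, h⟩
      have hue := hstep u w e hu huW hw he (hinc w e c hw he hde hc1 hc2 hc3 hec) huw
      by_cases h : e = c'
      · have hee' := hinc e e' e he he' hde' (hsub e he) (R.refl e) hde hee.symm
        have hue' := hstep u e e' hu huW he he' hee' hue
        have := hinc w' e' c' hw' he' hde' hc1' hc2' hc3' (by rw [← h]; exact hee.symm)
        exact hstep u e' w' hu huW he' hw' ⟨this.2, this.1⟩ hue'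
      · have := hinc w' e c' hw' he hde hc1' hc2' hc3' h
        exact hstep u e w' hu huW he hw' ⟨this.2, this.1⟩ hue
    have hfrom : ∀ u w w', Cur u → ¬ W u → W w → W w' → K.R w u → K.R w' u := by
      intro u w w' hu huW hw hw' hwu
      rcases hCur u hu with hq | ⟨_, _, h3⟩
      · have hvu := (hRv w hw).trans hwu
        have hdu : dep u < d₀ := by
          by_contra h3
          exact huW ((hW u).2 ⟨hq, hvu, by omega⟩)
        obtain ⟨c, hc1, hc2, hc3⟩ := hF.anc_exists (hsub w' hw') (hF.dep_pos hq)
          (by have := hge w' hw'; omega)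
        rwa [H1 u c hq hc1 hvu ((hRv w' hw').trans hc2) hc3.symm hdu]
      · exact absurd hwu (h3 w (hsub w hw))
    intro u hu huW w w' hw hw'
    exact ⟨⟨hto u w w' hu huW hw hw', hto u w' w hu huW hw' hw⟩,
      ⟨hfrom u w w' hu huW hw hw', hfrom u w' w hu huW hw' hw⟩⟩
  -- a parent of a vertex deeper than `d₀` exists and is in the block
  have hpar : ∀ w, W w → d₀ < dep w → par w ≠ K.n := by
    intro w hw hd e
    have := (hF.root w (hsub w hw) e).1
    have := H0 w hw
    omega
  refine ⟨hsub, hlt, hge, fun w hw hd => ?_, fun w w' hw hw' hd hd' => ?_, hmod,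
    fun a' b' ha' hb' hab' q hq hpq => ?_⟩
  · have e := hpar w hw hd
    obtain ⟨h1, h2, h3, h4⟩ := hF.child w (hsub w hw) e
    exact (hW _).2 ⟨h1, (hRv w hw).trans (hF.R_par (hsub w hw) e), by omega⟩
  · by_cases e : par w = K.n
    · by_cases e' : par w' = K.n
      · rw [e, e']
      · have h1 := (hF.root w (hsub w hw) e).1
        obtain ⟨g1, g2, g3, g4⟩ := hF.child w' (hsub w' hw') e'
        have := hF.dep_pos g1
        omega
    · obtain ⟨f1, f2, f3, f4⟩ := hF.child w (hsub w hw) e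
      by_cases e' : par w' = K.n
      · have h1 := (hF.root w' (hsub w' hw') e').1
        have := hF.dep_pos f1
        omega
      · obtain ⟨g1, g2, g3, g4⟩ := hF.child w' (hsub w' hw') e'
        exact H1 _ _ f1 g1 ((hRv w hw).trans (hF.R_par (hsub w hw) e))
          ((hRv w' hw').trans (hF.R_par (hsub w' hw') e')) (by omega) (by omega)
  · by_contra hqW
    obtain ⟨a, b, ha, hb, hda, hdb, hab⟩ := H2 a' b' ha' hb' hab'
    have hn := hlt _ hpq
    have hR := hF.R_par hq (by omega)
    have hm := hmod a b ha hb hab q (hQC q hq) hqW (par q)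
    exact hab (hF.anc_unique hq (hsub a ha) (hsub b hb) ((hm a hpq ha).1.1 hR)
      ((hm b hpq hb).1.1 hR) (by omega))

/-! ### The first level at which an up-set branches -/

namespace Level

open Ex Cmd Net

/-- Counts the vertices of depth `d` in the list. -/
def count : Cmd :=
  .set .d (Reg.d + 1) ;;
  .set .m 0 ;;
  .for .j Reg.len
    (.set .x (get .row (Reg.base + Reg.j)) ;;
     when (eq (get .rep Reg.x) 1 * eq (get .dep Reg.x) Reg.d) (.set .m (Reg.m + 1)))

/-- Finds the largest `q` such that each level below `q` contains exactly one vertex of the list,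
and level `q` contains at least one. -/
def prog : Cmd :=
  .set .d 0 ;;
  .set .m 1 ;;
  .loop (eq Reg.m 1) count ;;
  .set .q Reg.d ;;
  when (eq Reg.m 0) (.set .q (Reg.q - 1))

/-- `m` counts the numbers below `l` with the property `P`. -/
def Counts (P : ℕ → Prop) (l m : ℕ) : Prop :=
  (m = 0 ∧ ∀ i < l, ¬ P i) ∨ (m = 1 ∧ ∃ i < l, P i ∧ ∀ i' < l, P i' → i' = i) ∨
    (2 ≤ m ∧ ∃ i < l, ∃ i' < l, P i ∧ P i' ∧ i ≠ i')

theorem Counts.succ {P : ℕ → Prop} {l m : ℕ} (h : Counts P l m) (hl : P l) :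
    Counts P (l + 1) (m + 1) := by
  rcases h with ⟨rfl, h⟩ | ⟨rfl, i, hi, h1, h2⟩ | ⟨hm, i, hi, i', hi', h⟩
  · refine .inr (.inl ⟨rfl, l, by omega, hl, fun i hi hP => ?_⟩)
    by_contra hne
    exact h i (by omega) hP
  · exact .inr (.inr ⟨by omega, i, by omega, l, by omega, h1, hl, by omega⟩)
  · exact .inr (.inr ⟨by omega, i, by omega, i', by omega, h⟩)

theorem Counts.skip {P : ℕ → Prop} {l m : ℕ} (h : Counts P l m) (hl : ¬ P l) :
    Counts P (l + 1) m := by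
  rcases h with ⟨rfl, h⟩ | ⟨rfl, i, hi, h1, h2⟩ | ⟨hm, i, hi, i', hi', h⟩
  · refine .inl ⟨rfl, fun i hi hP => ?_⟩
    by_cases e : i = l
    · subst e; exact hl hP
    · exact h i (by omega) hP
  · refine .inr (.inl ⟨rfl, i, by omega, h1, fun i' hi' hP => ?_⟩)
    by_cases e : i' = l
    · subst e; exact absurd hP hl
    · exact h2 i' (by omega) hP
  · exact .inr (.inr ⟨hm, i, by omega, i', by omega, h⟩)

/-- The `j`-th vertex of the list is left and has depth `d`. -/
def At (rep dep A : ℕ → ℕ) (b d j : ℕ) : Prop := rep (A (b + j)) = 1 ∧ dep (A (b + j)) = d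

variable {K : Net}

theorem count_runs {s : St} {b l i : ℕ} (hA : ∀ j < l, s.arr .row (b + j) < K.n)
    (hbl : b + l ≤ 2 * (K.n * K.c)) (hlX : l < K.X) (hb : s.reg .base = b)
    (hlen : s.reg .len = l) (hd : s.reg .d = i) (hi : i < K.X) :
    Runs K.toEnv count s ((l + 1) * (0 + 1)) fun s' => s'.reg .d = i + 1 ∧
      Counts (At (s.arr .rep) (s.arr .dep) (s.arr .row) b (i + 1)) l (s'.reg .m) := by
  have hnX := K.n_le_X
  refine .seq (.of_wp ?_)
  simp [hd]
  refine ⟨hi, .seq (.of_wp ?_)⟩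
  simp
  refine Runs.frame (Runs.mono (Runs.for (f := 0) (Q := fun s' =>
    Counts (At (s.arr .rep) (s.arr .dep) (s.arr .row) b (i + 1)) l (s'.reg .m) ∧ s'.reg .m ≤ l) l
    (fun j s' => Counts (At (s.arr .rep) (s.arr .dep) (s.arr .row) b (i + 1)) j (s'.reg .m) ∧
      s'.reg .m ≤ j) rfl hlX ?_ ?_ ?_ ?_ fun _ h => h) (by simp)) ?_
  · intro j s' x h; simpa using h
  · simp; exact .inl ⟨rfl, by simp⟩
  · intro j s' hf _
    have : s'.reg .len = l := by rw [hf.reg .len rfl]; simpa using hlen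
    simp [this]
  · rintro j s2 hf ⟨k1, k2⟩ hj hjl
    have e1 : s2.arr .rep = s.arr .rep := by rw [hf.arr .rep rfl]; simp
    have e2 : s2.arr .dep = s.arr .dep := by rw [hf.arr .dep rfl]; simp
    have e3 : s2.arr .row = s.arr .row := by rw [hf.arr .row rfl]; simp
    have e4 : s2.reg .base = b := by rw [hf.reg .base rfl]; simpa using hb
    have e5 : s2.reg .d = i + 1 := by rw [hf.reg .d rfl]; simp
    have hx := hA j hjl
    have hxl := K.lt_two_mul hx.le
    refine .of_wp ?_
    simp only [when]
    simp [e1, e2, e3, e4, e5, hj, Env.lim]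
    by_cases hP : At (s.arr .rep) (s.arr .dep) (s.arr .row) b (i + 1) j
    · have := k1.succ hP
      obtain ⟨p1, p2⟩ := hP
      simp [p1, p2]
      exact ⟨by omega, by omega, hxl, by omega, this, k2⟩
    · have := k1.skip hP
      have hP' : ¬ (s.arr .rep (s.arr .row (b + j)) = 1 ∧ s.arr .dep (s.arr .row (b + j)) = i + 1) := hP
      refine ⟨by omega, by omega, hxl, fun h1 h2 => ?_, fun _ => ⟨this, by omega⟩⟩
      exact absurd ⟨by omega, by omega⟩ hP'
  · rintro s2 hf ⟨k1, k2⟩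
    exact ⟨by rw [hf.reg .d rfl]; simp, k1⟩

/-- The search ends at the first level at which the list has no vertex or at least two. -/
theorem prog_runs {s : St} {b l : ℕ} (hA : ∀ j < l, s.arr .row (b + j) < K.n)
    (hbl : b + l ≤ 2 * (K.n * K.c)) (hlX : l < K.X) (hb : s.reg .base = b)
    (hlen : s.reg .len = l) (hdep : ∀ u, s.arr .rep u = 1 → s.arr .dep u ≤ K.c) :
    Runs K.toEnv prog s ((K.c + 2) * ((l + 1) + 1)) fun s' => ∃ d, 1 ≤ d ∧
      (∀ e, 1 ≤ e → e < d → Counts (At (s.arr .rep) (s.arr .dep) (s.arr .row) b e) l 1) ∧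
      (Counts (At (s.arr .rep) (s.arr .dep) (s.arr .row) b d) l 0 ∧ s'.reg .q + 1 = d ∨
        Counts (At (s.arr .rep) (s.arr .dep) (s.arr .row) b d) l 2 ∧ s'.reg .q = d) := by
  have hcX := K.c_le_X
  refine .seq (.of_wp ?_)
  simp
  refine .seq (.of_wp ?_)
  simp
  refine ⟨by omega, .seq ?_⟩
  refine (Runs.loop (N := K.c + 1) (f := (l + 1) * (0 + 1)) (fun i s' => s'.reg .d = i ∧
    (i = 0 → s'.reg .m = 1) ∧
    (∀ e, 1 ≤ e → e < i → Counts (At (s.arr .rep) (s.arr .dep) (s.arr .row) b e) l 1) ∧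
    (1 ≤ i → Counts (At (s.arr .rep) (s.arr .dep) (s.arr .row) b i) l (s'.reg .m)))
    ?_ ?_ ?_ ?_).mono (by simp)
  · simp
  · intro i s' _ _; simp
  · rintro i s' hf ⟨g1, g2, g3, g4⟩ hval
    have hval : s'.reg .m = 1 := by
      by_contra h
      simp [h] at hval
    have e1 : s'.arr .rep = s.arr .rep := by rw [hf.arr .rep rfl]; simp
    have e2 : s'.arr .dep = s.arr .dep := by rw [hf.arr .dep rfl]; simp
    have e3 : s'.arr .row = s.arr .row := by rw [hf.arr .row rfl]; simp
    have e4 : s'.reg .base = b := by rw [hf.reg .base rfl]; simpa using hb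
    have e5 : s'.reg .len = l := by rw [hf.reg .len rfl]; simpa using hlen
    have hic : i ≤ K.c := by
      by_cases h : 1 ≤ i
      · have h4 := g4 h
        rw [hval] at h4
        rcases h4 with ⟨h5, _⟩ | ⟨_, j, hj, h5, _⟩ | ⟨h5, _⟩
        · omega
        · have := hdep _ h5.1
          have := h5.2
          omega
        · omega
      · omega
    refine ⟨by omega, ?_⟩
    refine (count_runs (by rw [e3]; exact hA) hbl hlX e4 e5 g1 (by omega)).frame ?_
    rintro s2 _ ⟨k1, k2⟩
    rw [e1, e2, e3] at k2
    refine ⟨k1, by omega, fun e h1 h2 => ?_, fun _ => k2⟩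
    by_cases he : e = i
    · subst he
      have := g4 h1
      rwa [hval] at this
    · exact g3 e h1 (by omega)
  · rintro i s' hf ⟨g1, g2, g3, g4⟩ hval
    have hval : s'.reg .m ≠ 1 := fun h => by simp [h] at hval
    have hi : 1 ≤ i := by
      by_contra h
      exact hval (g2 (by omega))
    have h4 := g4 hi
    refine .of_ok fun hok => .of_wp ?_
    have := hok.1 .d
    simp only [when]
    simp [g1]
    rw [g1] at this
    refine ⟨this, fun hm => ⟨by omega, i, hi, g3, .inl ⟨by rwa [hm] at h4, by omega⟩⟩,
      fun hm => ⟨i, hi, g3, .inr ⟨?_, rfl⟩⟩⟩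
    rcases h4 with ⟨h5, _⟩ | ⟨h5, _⟩ | ⟨_, h5⟩
    · omega
    · omega
    · exact .inr (.inr ⟨le_rfl, h5⟩)

end Level

/-! ### Inserting the vertices into the forest -/

open Net in
/-- The new vertex `v` becomes a child of the vertex `w` to which the branching part of its up-set
has been contracted, or a root if it reaches no vertex of the forest. -/
theorem Forest.insert {K : Net} {Q : ℕ → Prop} {dep par dep' par' : ℕ → ℕ} {v w d₀ : ℕ}
    (hF : Forest K Q dep par) (hv : K.Leader v) (hvQ : ¬ Q v) (hQv : ∀ q, Q q → ¬ K.R q v)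
    (hdep : dep' = Function.update dep v (d₀ + 1))
    (hpar : par' = Function.update par v (if d₀ = 0 then K.n else w))
    (h0 : d₀ = 0 → ∀ q, Q q → ¬ K.R v q)
    (h1 : d₀ ≠ 0 → Q w ∧ K.R v w ∧ dep w = d₀ ∧ ∀ a, Q a → K.R v a → K.R w a) :
    Forest K (fun u => Q u ∨ u = v) dep' par' := by
  subst hdep hpar
  have hne : ∀ q, Q q → q ≠ v := fun q hq e => hvQ (e ▸ hq)
  refine ⟨?_, ?_, ?_⟩
  · rintro q (hq | rfl)
    exacts [hF.leader q hq, hv]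
  · rintro q (hq | rfl) e
    · rw [Function.update_of_ne (hne q hq)] at e ⊢
      obtain ⟨g1, g2⟩ := hF.root q hq e
      refine ⟨g1, ?_⟩
      rintro a (ha | rfl) hna
      exacts [g2 a ha hna, hQv q hq]
    · simp only [Function.update_self] at e ⊢
      have hd : d₀ = 0 := by
        by_contra hd
        rw [if_neg hd] at e
        have := (hF.leader w (h1 hd).1).lt
        omega
      refine ⟨by omega, ?_⟩
      rintro a (ha | rfl) hna
      exacts [h0 hd a ha, absurd rfl hna]
  · rintro q (hq | rfl) e
    · rw [Function.update_of_ne (hne q hq)] at e ⊢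
      rw [Function.update_of_ne (hne q hq)]
      obtain ⟨g1, g2, g3, g4⟩ := hF.child q hq e
      rw [Function.update_of_ne (hne _ g1)]
      refine ⟨.inl g1, g2, g3, ?_⟩
      rintro a (ha | rfl) hna
      · exact g4 a ha hna
      · exact iff_of_false (hQv q hq) (hQv _ g1)
    · simp only [Function.update_self] at e ⊢
      have hd : d₀ ≠ 0 := fun hd => by simp [hd] at e
      rw [if_neg hd]
      obtain ⟨g1, g2, g3, g4⟩ := h1 hd
      rw [Function.update_of_ne (hne w g1)]
      refine ⟨.inl g1, hne w g1, by omega, ?_⟩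
      rintro a (ha | rfl) hna
      · exact ⟨g4 a ha, fun h => g2.trans h⟩
      · exact absurd rfl hna

/-- The last vertex that absorbed another one is left. -/
theorem Net.ElimOk.exists_left {K : Net} {X P : ℕ → ℕ} {L v : ℕ} (h : K.ElimOk X P L)
    (hv : K.Alive v) : ∃ u, K.Left X L u := by
  cases L with
  | zero => exact ⟨v, hv, by simp⟩
  | succ k =>
    obtain ⟨-, ⟨h1, h2⟩, h3, -⟩ := h k (by omega)
    refine ⟨P k, h1, fun j hj => ?_⟩
    by_cases e : j = k
    · subst e; exact h3
    · exact h2 j (by omega)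

namespace Insertion

open Ex Cmd Net

/-- Makes `v` a vertex of the forest. -/
def place : Cmd :=
  put .dep Reg.v (Reg.q + 1) ;;
  ite (eq Reg.q 0) (put .par Reg.v nE) (put .par Reg.v Reg.w) ;;
  put .rep Reg.v 1

/-- Inserts the `i`-th leader into the forest. -/
def insert : Cmd :=
  .set .v (get .ord Reg.i) ;;
  .set .base (Reg.v * cE) ;;
  .set .len (get .cnt Reg.v) ;;
  Level.prog ;;
  Contract.prog ;;
  place

/-- Contracts the whole forest. -/
def finish : Cmd :=
  .for .v nE (put .row (nE * cE + Reg.v) Reg.v) ;;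
  .set .base (nE * cE) ;;
  .set .len nE ;;
  .set .q 1 ;;
  Contract.prog

/-- The whole elimination after the strongly connected components have been contracted. -/
def prog : Cmd := .for .i Reg.num insert ;; finish

variable {K : Net}

/-- The invariant of the insertion: the first `i` vertices of the order `A` have been inserted. -/
structure Inv (K : Net) (A : ℕ → ℕ) (N i : ℕ) (s : St) : Prop where
  elim : K.ElimOk (s.arr .lx) (s.arr .lp) (s.reg .em)
  forest : Forest K (fun u => s.arr .rep u = 1) (s.arr .dep) (s.arr .par)
  left : ∀ u, s.arr .rep u = 1 → K.Left (s.arr .lx) (s.reg .em) u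
  of_left : ∀ u, K.Left (s.arr .lx) (s.reg .em) u → s.arr .rep u = 1 ∨ ∃ j < N, i ≤ j ∧ A j = u
  later : ∀ j < N, i ≤ j → K.Left (s.arr .lx) (s.reg .em) (A j)
  earlier : ∀ u, s.arr .rep u = 1 → ∃ j < i, A j = u
  last : ∀ u, s.arr .last u = 0
  par_le : ∀ u, s.arr .par u ≤ K.n
  w_lt : s.reg .w < K.n

/-- The part of the up-set of `v` in the forest that is to be contracted. -/
def Top (K : Net) (v d₀ : ℕ) (s : St) (u : ℕ) : Prop :=
  s.arr .rep u = 1 ∧ K.R v u ∧ d₀ ≤ s.arr .dep u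

/-- The properties of the first level `d₀` at which the up-set of `v` branches. -/
structure Branch (K : Net) (v d₀ : ℕ) (s : St) : Prop where
  pos : ∀ w, Top K v d₀ s w → 1 ≤ d₀
  below : ∀ a b, s.arr .rep a = 1 → s.arr .rep b = 1 → K.R v a → K.R v b →
    s.arr .dep a = s.arr .dep b → s.arr .dep a < d₀ → a = b
  two : ∀ a b, Top K v d₀ s a → Top K v d₀ s b → a ≠ b →
    ∃ a b, Top K v d₀ s a ∧ Top K v d₀ s b ∧ s.arr .dep a = d₀ ∧ s.arr .dep b = d₀ ∧ a ≠ b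
  nonempty : d₀ ≠ 0 → ∃ w, Top K v d₀ s w ∧ s.arr .dep w = d₀

theorem Branch.of_counts {v d d₀ : ℕ} {s : St}
    (hF : Forest K (fun u => s.arr .rep u = 1) (s.arr .dep) (s.arr .par))
    (hv : Search.RowOk K (s.arr .cnt) (s.arr .row) v) (ha : K.Alive v) (hd : 1 ≤ d)
    (h1 : ∀ e, 1 ≤ e → e < d →
      Level.Counts (Level.At (s.arr .rep) (s.arr .dep) (s.arr .row) (v * K.c) e) (s.arr .cnt v) 1)
    (h2 : Level.Counts (Level.At (s.arr .rep) (s.arr .dep) (s.arr .row) (v * K.c) d)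
        (s.arr .cnt v) 0 ∧ d₀ + 1 = d ∨
      Level.Counts (Level.At (s.arr .rep) (s.arr .dep) (s.arr .row) (v * K.c) d)
        (s.arr .cnt v) 2 ∧ d₀ = d) : Branch K v d₀ s := by
  have hone : ∀ e, 1 ≤ e → e < d → ∃ z, (s.arr .rep z = 1 ∧ K.R v z ∧ s.arr .dep z = e) ∧
      ∀ z', s.arr .rep z' = 1 → K.R v z' → s.arr .dep z' = e → z' = z := by
    intro e he hed
    rcases h1 e he hed with ⟨h, _⟩ | ⟨_, i, hi, hP, hu⟩ | ⟨h, _⟩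
    · omega
    · refine ⟨_, ⟨hP.1, (hv.mem ha _).2 ⟨i, hi, rfl⟩, hP.2⟩, fun z' z1 z2 z3 => ?_⟩
      obtain ⟨i', hi', rfl⟩ := (hv.mem ha z').1 z2
      rw [hu i' hi' ⟨z1, z3⟩]
    · omega
  have hlast : (d₀ + 1 = d ∧ ∀ z, s.arr .rep z = 1 → K.R v z → s.arr .dep z ≠ d) ∨
      d₀ = d ∧ ∃ a b, Top K v d₀ s a ∧ Top K v d₀ s b ∧ s.arr .dep a = d₀ ∧ s.arr .dep b = d₀ ∧
        a ≠ b := by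
    rcases h2 with ⟨h, hd⟩ | ⟨h, rfl⟩
    · rcases h with ⟨_, h⟩ | ⟨h, _⟩ | ⟨h, _⟩
      · refine .inl ⟨hd, fun z z1 z2 z3 => ?_⟩
        obtain ⟨i, hi, rfl⟩ := (hv.mem ha z).1 z2
        exact h i hi ⟨z1, z3⟩
      · omega
      · omega
    · rcases h with ⟨h, _⟩ | ⟨h, _⟩ | ⟨_, i, hi, i', hi', p, p', hne⟩
      · omega
      · omega
      · refine .inr ⟨rfl, _, _, ⟨p.1, (hv.mem ha _).2 ⟨i, hi, rfl⟩, p.2.ge⟩,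
          ⟨p'.1, (hv.mem ha _).2 ⟨i', hi', rfl⟩, p'.2.ge⟩, p.2, p'.2, fun e => hne ?_⟩
        exact hv.inj ha i hi i' hi' e
  -- in the first case the up-set has no vertex deeper than `d₀`
  have hle : d₀ + 1 = d → (∀ z, s.arr .rep z = 1 → K.R v z → s.arr .dep z ≠ d) →
      ∀ z, s.arr .rep z = 1 → K.R v z → s.arr .dep z ≤ d₀ := by
    intro e h z z1 z2
    by_contra hz
    obtain ⟨a, g1, g2, g3⟩ := hF.anc_exists z1 (e := d) hd (by omega)
    exact h a g1 (z2.trans g2) g3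
  refine ⟨?_, ?_, ?_, ?_⟩
  · rintro w ⟨w1, w2, w3⟩
    rcases hlast with ⟨e, h⟩ | ⟨e, _⟩
    · have := hle e h w w1 w2
      have := hF.dep_pos w1
      omega
    · omega
  · intro a b ha1 hb1 ha2 hb2 hab hlt
    obtain ⟨z, _, hz⟩ := hone (s.arr .dep a) (hF.dep_pos ha1) (by rcases hlast with h | h <;> omega)
    rw [hz a ha1 ha2 rfl, hz b hb1 hb2 hab.symm]
  · intro a b ha' hb' hne
    rcases hlast with ⟨e, h⟩ | ⟨e, h⟩
    · have := hle e h a ha'.1 ha'.2.1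
      have := hle e h b hb'.1 hb'.2.1
      have := ha'.2.2
      have := hb'.2.2
      exact ⟨a, b, ha', hb', by omega, by omega, hne⟩
    · exact h
  · intro h0
    rcases hlast with ⟨e, h⟩ | ⟨e, a, b, h⟩
    · obtain ⟨z, ⟨z1, z2, z3⟩, _⟩ := hone d₀ (by omega) (by omega)
      exact ⟨z, ⟨z1, z2, z3.ge⟩, z3⟩
    · exact ⟨a, h.1, h.2.2.1⟩

/-- The rounds of `Level` and `Contract` over the list of `v` take `O(c)` passes of length `O(c)`. -/
theorem insert_runs {s : St} {N i : ℕ} (hN : NFree K) (hR : Components.Rows K s)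
    (hS : Order.Sorted K (s.arr .ord) N) (hI : Inv K (s.arr .ord) N i s) (hi : s.reg .i = i)
    (hiN : i < N) (hNn : N ≤ K.n) :
    Runs K.toEnv insert s ((K.c + 2) * ((K.c + 1) + 1)) fun s' => Inv K (s.arr .ord) N (i + 1) s' := by
  have hnX := K.n_le_X
  have hcX := K.c_le_X
  obtain ⟨v, hv⟩ : ∃ v, s.arr .ord i = v := ⟨_, rfl⟩
  have hL : K.Leader v := hv ▸ hS.leader i hiN
  have hvn := hL.lt
  have hrow := hR v hvn
  have hcl := hrow.cnt_le
  have hbase : v * K.c + s.arr .cnt v ≤ K.n * K.c := by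
    calc v * K.c + s.arr .cnt v ≤ (v + 1) * K.c := by rw [add_mul]; omega
      _ ≤ K.n * K.c := Nat.mul_le_mul_right _ hvn
  have hmX := K.mul_le_X
  have hncX : K.n * K.c ≤ K.X := by nlinarith
  have hvl := K.lt_two_mul hvn.le
  have hil := K.lt_two_mul (show i ≤ K.n by omega)
  have hlist : ∀ j < s.arr .cnt v, s.arr .row (v * K.c + j) < K.n := fun j hj =>
    (hR.entry hvn hj).2.lt hvn
  refine .seq (.of_wp ?_)
  simp [hi, hv, Env.lim]
  refine ⟨by omega, by omega, .seq (.of_wp ?_)⟩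
  simp
  refine ⟨by omega, .seq (.of_wp ?_)⟩
  simp [Env.lim]
  refine ⟨by omega, by omega, .seq ?_⟩
  refine ((Level.prog_runs (s := ((s.setR .v v).setR .base (v * K.c)).setR .len (s.arr .cnt v))
    (b := v * K.c) (l := s.arr .cnt v) (by simpa using hlist) (by omega)
    (by omega) (by simp) (by simp) (fun u hu => hI.forest.dep_le hu)).mono ?_).frame ?_
  · exact Nat.mul_le_mul_left _ (by omega)
  rintro s1 hf1 ⟨d, hd, h1, h2⟩
  have ear : ∀ k, s1.arr k = s.arr k := by
    intro k; rw [hf1.arr k (by cases k <;> rfl)]; rfl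
  have ev : s1.reg .v = v := by rw [hf1.reg .v rfl]; simp
  have eb : s1.reg .base = v * K.c := by rw [hf1.reg .base rfl]; simp
  have el : s1.reg .len = s.arr .cnt v := by rw [hf1.reg .len rfl]; simp
  have ew : s1.reg .w = s.reg .w := by rw [hf1.reg .w rfl]; simp
  have eem : s1.reg .em = s.reg .em := by rw [hf1.reg .em rfl]; simp
  have hBr : Branch K v (s1.reg .q) s := .of_counts hI.forest hrow hL.alive hd h1 h2
  obtain ⟨d₀, hq⟩ : ∃ d₀, s1.reg .q = d₀ := ⟨_, rfl⟩
  rw [hq] at hBr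
  have hQv : ∀ q, s.arr .rep q = 1 → ¬ K.R q v := by
    intro q hq' hr
    obtain ⟨j, hj, rfl⟩ := hI.earlier q hq'
    have := hS.lt_of_R (i := j) (j := i) (by omega) hiN (by rw [hv]; exact hr) (by omega)
    omega
  have hvQ : s.arr .rep v ≠ 1 := fun h => hQv v h (R.refl v)
  have hB := Block.of_nFree (Cur := K.Left (s.arr .lx) (s.reg .em)) (W := Top K v d₀ s) hN hI.forest
    hL hQv ?_ hI.left (fun w => Iff.rfl) hBr.pos hBr.below hBr.two
  swap
  · intro u hu
    refine (hI.of_left u hu).imp id ?_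
    rintro ⟨j, hj, hij, rfl⟩
    refine ⟨hS.leader j hj, ?_, ?_⟩
    · by_cases e : j = i
      · subst e; exact .inl hv
      · refine .inr fun hr => ?_
        have := hS.lt_of_R (i := i) (j := j) hiN hj (by rw [hv]; exact hr) (by omega)
        omega
    · intro q hq' hr
      obtain ⟨k, hk, rfl⟩ := hI.earlier q hq'
      have := hS.lt_of_R (by omega) hj hr (by omega)
      omega
  have hd₀c : d₀ ≤ K.c := by
    by_cases e : d₀ = 0
    · omega
    · obtain ⟨w, w1, w2⟩ := hBr.nonempty e
      have := hI.forest.dep_le w1.1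
      omega
  refine .seq (((Contract.prog_runs (s := s1) (W := Top K v d₀ s) (d₀ := d₀) (b := v * K.c)
    (l := s.arr .cnt v) ?_ ?_ ?_ ?_ ?_ ?_ ?_ ?_ eb el hq ?_ ?_).mono ?_).frame ?_)
  · simpa only [ear, eem] using hB
  · simp only [ear]
    refine ⟨hlist, fun j hj j' hj' => hrow.inj hL.alive j hj j' hj', fun w => ?_, by omega⟩
    rw [← hrow.mem hL.alive w]
    exact ⟨fun h => ⟨h.1, h.2.2, h.2.1⟩, fun h => ⟨h.1, h.2.2, h.2.1⟩⟩
  · rintro ⟨u, hu⟩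
    have := hBr.pos u hu
    simpa only [ear] using hBr.nonempty (by omega)
  · simpa only [ear, eem] using hI.elim
  · simpa only [ear] using hI.forest
  · simpa only [ear, eem] using hI.left
  · simpa only [ear] using hI.par_le
  · simpa only [ear] using hI.last
  · rw [ew]; exact hI.w_lt
  · omega
  · exact Nat.mul_le_mul (by omega) (by omega)
  rintro s2 hf2 ⟨r, hw⟩
  have e2v : s2.reg .v = v := (hf2.reg .v rfl).trans ev
  have e2q : s2.reg .q = d₀ := (hf2.reg .q rfl).trans hq
  have e2d : s2.arr .dep = s.arr .dep := (hf2.arr .dep rfl).trans (ear _)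
  have e2p : s2.arr .par = s.arr .par := (hf2.arr .par rfl).trans (ear _)
  have rF := r.forest
  have rI := r.rep_iff
  have rL := r.left_iff
  have rroot := r.root
  simp only [ear, eem] at rF rI rL rroot
  have hsub : ∀ u, s2.arr .rep u = 1 → s.arr .rep u = 1 := by
    intro u hu
    by_cases h : Top K v d₀ s u
    · exact h.1
    · exact (rI u h).1 hu
  have hnotTop : ∀ j < N, i ≤ j → ¬ Top K v d₀ s (s.arr .ord j) := by
    intro j hj hij h
    obtain ⟨k, hk, e⟩ := hI.earlier _ h.1
    have := hS.inj k (by omega) j hj e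
    omega
  have hvLeft : K.Left (s2.arr .lx) (s2.reg .em) v := by
    rw [← hv]
    exact (rL _ (hnotTop i hiN le_rfl)).2 (hI.later i hiN le_rfl)
  have hFi := rF.insert (v := v) (w := s2.reg .w) (d₀ := d₀) hL (fun h => hvQ (hsub v h))
    (fun q h => hQv q (hsub q h)) rfl rfl ?_ ?_
  rotate_left
  · intro e q hq' hr
    have := hBr.pos q ⟨hsub q hq', hr, by omega⟩
    omega
  · intro e
    obtain ⟨w', hw', _⟩ := hBr.nonempty e
    obtain ⟨t1, t2, t3⟩ := rroot ⟨w', hw'⟩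
    have hrw := (t3 _ t1).2 rfl
    refine ⟨hrw, t1.2.1, t2, fun a ha hr => ?_⟩
    by_cases hT : Top K v d₀ s a
    · rw [(t3 a hT).1 ha]; exact R.refl _
    · have hda : s.arr .dep a < d₀ := by
        by_contra h
        exact hT ⟨hsub a ha, hr, by omega⟩
      obtain ⟨c, c1, c2, c3⟩ := rF.anc_exists hrw (rF.dep_pos ha) (by omega)
      rw [hBr.below a c (hsub a ha) (hsub c c1) hr (t1.2.1.trans c2) c3.symm hda]
      exact c2
  refine .of_wp ?_
  simp [place, e2v, e2q, hvl, Env.lim]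
  -- both cases of the conditional lead to the same invariant
  have key : ∀ p, p = (if d₀ = 0 then K.n else s2.reg .w) →
      Inv K (s.arr .ord) N (i + 1) (((s2.setA .dep v (d₀ + 1)).setA .par v p).setA .rep v 1) := by
    rintro p rfl
    constructor
    · simpa using r.elim
    · simp only [St.setA_arr, reduceCtorEq, if_false, if_true, e2d, e2p]
      have : (fun u => Function.update (s2.arr .rep) v 1 u = 1) = fun u => s2.arr .rep u = 1 ∨ u = v := by
        funext u
        by_cases e : u = v
        · subst e; simp
        · simp [e]
      rw [this]
      exact hFi
    · intro u hu
      simp at hu ⊢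
      by_cases e : u = v
      · subst e; exact hvLeft
      · rw [Function.update_of_ne e] at hu; exact r.left u hu
    · intro u hu
      simp at hu ⊢
      by_cases e : u = v
      · subst e; simp
      · rw [Function.update_of_ne e]
        by_cases hT : Top K v d₀ s u
        · exact .inl (r.left_rep u hT hu)
        · rcases hI.of_left u ((rL u hT).1 hu) with h | ⟨j, hj, hij, h⟩
          · exact .inl ((rI u hT).2 h)
          · refine .inr ⟨j, hj, ?_, h⟩
            rcases Nat.eq_or_lt_of_le hij with h' | h'
            · subst h'; exact absurd (h.symm.trans hv) e
            · exact h'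
    · intro j hj hij
      simpa using (rL _ (hnotTop j hj (by omega))).2 (hI.later j hj (by omega))
    · intro u hu
      simp at hu
      by_cases e : u = v
      · exact ⟨i, by omega, by rw [hv, e]⟩
      · rw [Function.update_of_ne e] at hu
        obtain ⟨j, hj, h⟩ := hI.earlier u (hsub u hu)
        exact ⟨j, by omega, h⟩
    · intro u; simpa using r.last u
    · intro u
      simp [Function.update_apply]
      split_ifs
      · exact le_rfl
      · exact hw.le
      · rw [e2p]; exact hI.par_le u
    · simpa using hw
  exact ⟨by omega, fun e => ⟨by omega, by omega, key _ (by simp [e])⟩,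
    fun e => ⟨by omega, by omega, key _ (by simp [e])⟩⟩

/-- Contracting the whole forest leaves at most one vertex. -/
theorem finish_runs {s : St} {N : ℕ} (hI : Inv K (s.arr .ord) N N s) :
    Runs K.toEnv finish s ((K.c + 1) * ((K.n + 1) + 1)) fun s' =>
      K.ElimOk (s'.arr .lx) (s'.arr .lp) (s'.reg .em) ∧ s'.reg .w < K.n ∧
      (∀ u, K.Left (s'.arr .lx) (s'.reg .em) u → u = s'.reg .w) ∧
      (∀ u, K.Alive u → K.Left (s'.arr .lx) (s'.reg .em) (s'.reg .w)) ∧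
      ∀ j < K.n * K.c, s'.arr .row j = s.arr .row j := by
  have hnX := K.n_le_X
  have hcX := K.c_le_X
  have hmX := K.mul_le_X
  have hncX : K.n * K.c ≤ K.X := by nlinarith
  have hnn := K.lt_two_mul (le_refl K.n)
  have hnc : K.n ≤ K.n * K.c := Nat.le_mul_of_pos_right _ K.c_pos
  refine .seq (Runs.frame (Runs.mono (Runs.for (f := 0) (Q := fun s' =>
    (∀ j < K.n, s'.arr .row (K.n * K.c + j) = j) ∧ ∀ j < K.n * K.c, s'.arr .row j = s.arr .row j) K.n
    (fun i s' => (∀ j < i, s'.arr .row (K.n * K.c + j) = j) ∧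
      ∀ j < K.n * K.c, s'.arr .row j = s.arr .row j) rfl (by omega) ?_ ?_ ?_ ?_ fun _ h => h) ?_) ?_)
  · intro i s' x h; exact h
  · simp
  · simp
  · intro j s' hf h hj hjn
    refine .of_wp ?_
    simp [hj, Env.lim]
    refine ⟨by omega, by omega, fun i hi => ?_, fun i hi => ?_⟩
    · rw [Function.update_apply]
      split_ifs with e
      · omega
      · exact h.1 i (by omega)
    · rw [Function.update_of_ne (by omega)]
      exact h.2 i hi
  · nlinarith
  rintro s1 hf1 ⟨hrow, hold⟩
  refine .seq (.of_wp ?_)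
  simp
  refine ⟨hncX, .seq (.of_wp ?_)⟩
  simp
  refine ⟨by omega, .seq (.of_wp ?_)⟩
  simp
  refine ⟨by omega, ?_⟩
  have ear : ∀ k, k ≠ .row → s1.arr k = s.arr k := by
    intro k hk; rw [hf1.arr k (by cases k <;> first | rfl | exact absurd rfl hk)]
  have e1 := ear .lx (by simp)
  have e2 := ear .lp (by simp)
  have e3 := ear .rep (by simp)
  have e4 := ear .dep (by simp)
  have e5 := ear .par (by simp)
  have e6 := ear .last (by simp)
  have ew : s1.reg .w = s.reg .w := by rw [hf1.reg .w rfl]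
  have eem : s1.reg .em = s.reg .em := by rw [hf1.reg .em rfl]
  have hF := hI.forest
  have hof : ∀ u, K.Left (s.arr .lx) (s.reg .em) u → s.arr .rep u = 1 := by
    intro u hu
    rcases hI.of_left u hu with h | ⟨j, hj, hij, _⟩
    · exact h
    · omega
  refine (Contract.prog_runs (W := fun u => s.arr .rep u = 1) (d₀ := 1) (b := K.n * K.c)
    (l := K.n) ?_ ?_ ?_ ?_ ?_ ?_ ?_ ?_ (by simp) (by simp) (by simp) ?_ (by omega)).frame ?_
  · simp [e1, e3, e4, e5, eem]
    refine ⟨fun w h => h, fun w h => (hF.leader w h).lt, fun w h => hF.dep_pos h, fun w h hd => ?_,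
      fun w w' h h' hd hd' => ?_, fun a b _ _ _ u hu hnu => absurd (hof u hu) hnu,
      fun a b _ _ _ q hq _ => hq⟩
    · exact (hF.child w h fun e => by have := (hF.root w h e).1; omega).1
    · have : ∀ w, s.arr .rep w = 1 → s.arr .dep w = 1 → s.arr .par w = K.n := by
        intro w h hd
        by_contra e
        obtain ⟨g1, _, g3, _⟩ := hF.child w h e
        have := hF.dep_pos g1
        omega
      rw [this w h hd, this w' h' hd']
  · simp [e3, e4]
    refine ⟨fun j hj => by rw [hrow j hj]; exact hj, fun j hj j' hj' e => ?_, fun w => ?_, by omega⟩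
    · rwa [hrow j hj, hrow j' hj'] at e
    · refine ⟨fun h => ⟨h, hF.dep_pos h, w, (hF.leader w h).lt, hrow w (hF.leader w h).lt⟩,
        fun h => h.1⟩
  · rintro ⟨u, hu⟩
    simp [e4]
    obtain ⟨a, g1, g2, g3⟩ := hF.anc_exists hu le_rfl (hF.dep_pos hu)
    exact ⟨a, g1, g3⟩
  · simpa [e1, e2, eem] using hI.elim
  · simpa [e3, e4, e5] using hF
  · simpa [e1, e3, eem] using hI.left
  · simpa [e5] using hI.par_le
  · simpa [e6] using hI.last
  · simpa [ew] using hI.w_lt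
  rintro s2 hf2 ⟨r, hw⟩
  have rL := r.left_iff
  have rroot := r.root
  simp [e1, eem, e4] at rL rroot
  have hW : ∀ u, K.Left (s2.arr .lx) (s2.reg .em) u → s.arr .rep u = 1 := by
    intro u hu
    by_contra h
    exact h (hof u ((rL u h).1 hu))
  have erow : s2.arr .row = s1.arr .row := hf2.arr .row rfl
  refine ⟨r.elim, hw, fun u hu => ?_, fun u hu => ?_, by rwa [erow]⟩
  · exact ((rroot u (hW u hu)).2.2 u (hW u hu)).1 (r.left_rep u (hW u hu) hu)
  · obtain ⟨x, hx⟩ := hI.elim.exists_left hu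
    obtain ⟨t1, t2, t3⟩ := rroot x (hof x hx)
    exact r.left _ ((t3 _ t1).2 rfl)

theorem prog_runs {s : St} {N : ℕ} (hN : NFree K) (hR : Components.Rows K s)
    (hS : Order.Sorted K (s.arr .ord) N) (hnum : s.reg .num = N)
    (hE : K.ElimOk (s.arr .lx) (s.arr .lp) (s.reg .em))
    (hL : ∀ u, K.Left (s.arr .lx) (s.reg .em) u ↔ K.Leader u) (hrep : ∀ u, s.arr .rep u = 0)
    (hlast : ∀ u, s.arr .last u = 0) (hpar : ∀ u, s.arr .par u = 0) (hw : s.reg .w < K.n) :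
    Runs K.toEnv prog s ((K.n + 1) * ((K.c + 2) * ((K.c + 1) + 1) + 1)) fun s' =>
      K.ElimOk (s'.arr .lx) (s'.arr .lp) (s'.reg .em) ∧ s'.reg .w < K.n ∧
      (∀ u, K.Left (s'.arr .lx) (s'.reg .em) u → u = s'.reg .w) ∧
      (∀ u, K.Alive u → K.Left (s'.arr .lx) (s'.reg .em) (s'.reg .w)) ∧
      ∀ j < K.n * K.c, s'.arr .row j = s.arr .row j := by
  have hnX := K.n_le_X
  have hNn : N ≤ K.n := le_of_injOn (A := s.arr .ord) (fun i hi => (hS.leader i hi).lt)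
    (fun i hi j hj => hS.inj i hi j hj)
  refine .seq (Runs.frame (Runs.mono (Runs.for (f := (K.c + 2) * ((K.c + 1) + 1)) (Q := fun s' =>
    Inv K (s.arr .ord) N N s') N (fun i s' => Inv K (s.arr .ord) N i s') rfl (by omega) ?_ ?_ ?_ ?_
    fun _ h => h) ?_) ?_)
  · intro i s' x h
    exact ⟨h.elim, h.forest, h.left, h.of_left, h.later, h.earlier, h.last, h.par_le, h.w_lt⟩
  · refine ⟨hE, ⟨?_, ?_, ?_⟩, ?_, ?_, ?_, ?_, hlast, ?_, hw⟩
    · intro q hq; simp [hrep] at hq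
    · intro q hq; simp [hrep] at hq
    · intro q hq; simp [hrep] at hq
    · intro q hq; simp [hrep] at hq
    · intro u hu
      obtain ⟨j, hj, h⟩ := hS.surj u ((hL u).1 hu)
      exact .inr ⟨j, hj, by omega, h⟩
    · intro j hj _; exact (hL _).2 (hS.leader j hj)
    · intro q hq; simp [hrep] at hq
    · intro u; simp [hpar]
  · intro i s' hf _
    have := hf.reg .num rfl
    simp [this, hnum]
  · intro i s' hf hI hi hiN
    have e1 : s'.arr .ord = s.arr .ord := hf.arr .ord rfl
    have e2 : s'.arr .row = s.arr .row := hf.arr .row rfl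
    have e3 : s'.arr .cnt = s.arr .cnt := hf.arr .cnt rfl
    have := insert_runs (s := s') (N := N) (i := i) hN (by unfold Components.Rows; rw [e2, e3]; exact hR)
      (by rw [e1]; exact hS) (by rw [e1]; exact hI) hi hiN hNn
    rwa [e1] at this
  · exact Nat.mul_le_mul_right _ (by omega)
  · intro s1 hf1 hI
    have e1 : s1.arr .ord = s.arr .ord := hf1.arr .ord rfl
    have e2 : s1.arr .row = s.arr .row := hf1.arr .row rfl
    have := finish_runs (s := s1) (N := N) (by rw [e1]; exact hI)
    rw [e2] at this
    refine this.mono ?_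
    nlinarith [Nat.zero_le (K.n * K.c), Nat.zero_le (K.n * K.c * K.c)]

end Insertion

/-! ### Dynamic programming along an elimination sequence

When a vertex `v` is eliminated, it is merged into a vertex `p` from which no other vertex
distinguishes it. Each vertex that is left represents the cluster of the vertices merged into it. -/

namespace Net

variable (K : Net) (X P : ℕ → ℕ)

/-- The total size of the clusters after `k` merges. -/
def weight : ℕ → ℕ → ℕ
  | 0 => K.sz
  | k + 1 => Function.update (weight k) (P k) (weight k (P k) + weight k (X k))

/-- The amount `s` chosen from the union of the clusters of `p` and `v`, with the tables `A` and `B`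
and the sizes `a` and `b`, can be split so that the amount `y` comes from the cluster of `v`. -/
def SplitOk (p v : ℕ) (A B : ℕ → Prop) (a b s y : ℕ) : Prop :=
  y ≤ s ∧ A (s - y) ∧ B y ∧ (K.R p v → s - y = 0 ∨ y = b) ∧ (K.R v p → y = 0 ∨ s - y = a)

/-- The table after `k` merges: `table k v s` holds if the amount `s` can be chosen from the cluster
of `v` in accordance with the arcs within the cluster. -/
def table : ℕ → ℕ → ℕ → Prop
  | 0 => fun v s => s = 0 ∨ K.Alive v ∧ s = K.sz v
  | k + 1 => Function.update (table k) (P k) fun s => ∃ y, K.SplitOk (P k) (X k) (table k (P k))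
      (table k (X k)) (K.weight X P k (P k)) (K.weight X P k (X k)) s y

/-- The amounts `t` chosen from the clusters after `k` merges obey the arcs: if something is chosen
from a cluster, then every cluster that it reaches is chosen completely. -/
structure Sol (k : ℕ) (t : ℕ → ℕ) : Prop where
  tab : ∀ u, K.Left X k u → K.table X P k u (t u)
  arc : ∀ u y, K.Left X k u → K.Left X k y → u ≠ y → K.R u y → t u = 0 ∨ t y = K.weight X P k y
  zero : ∀ u, ¬ K.Left X k u → t u = 0

variable {K X P}

theorem table_zero (k v : ℕ) : K.table X P k v 0 := by
  induction k generalizing v with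
  | zero => exact .inl rfl
  | succ k ih =>
    simp only [table, Function.update_apply]
    split_ifs
    · exact ⟨0, le_rfl, ih _, ih _, fun _ => .inl rfl, fun _ => .inl rfl⟩
    · exact ih v

/-- An amount chosen from a cluster is at most its size. -/
theorem table_le {k v s : ℕ} (h : K.table X P k v s) : s ≤ K.weight X P k v := by
  induction k generalizing v s with
  | zero => rcases h with rfl | ⟨_, rfl⟩ <;> simp [weight]
  | succ k ih =>
    simp only [table, weight, Function.update_apply] at h ⊢
    split_ifs at h ⊢
    · obtain ⟨y, h1, h2, h3, _⟩ := h
      have := ih h2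
      have := ih h3
      omega
    · exact ih h

theorem sum_congr_pair {n p v : ℕ} {t t' : ℕ → ℕ} (hp : p < n) (hv : v < n) (hne : p ≠ v)
    (h : t p + t v = t' p + t' v) (ho : ∀ u, u ≠ p → u ≠ v → t u = t' u) :
    ∑ u ∈ Finset.range n, t u = ∑ u ∈ Finset.range n, t' u := by
  have hv' : v ∈ (Finset.range n).erase p := by simp [hne.symm, hv]
  have hp' : p ∈ Finset.range n := by simpa
  rw [← Finset.add_sum_erase _ t hp', ← Finset.add_sum_erase _ t' hp',
    ← Finset.add_sum_erase _ t hv', ← Finset.add_sum_erase _ t' hv', ← add_assoc, ← add_assoc, h]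
  congr 1
  refine Finset.sum_congr rfl fun u hu => ho u ?_ ?_
  · rintro rfl; simp at hu
  · rintro rfl; simp at hu

theorem left_succ {k u : ℕ} : K.Left X (k + 1) u ↔ K.Left X k u ∧ u ≠ X k := by
  have := left_update (K := K) (X := X) (L := k) (v := X k) (u := u)
  rwa [Function.update_eq_self] at this

variable {L : ℕ}

/-- The amounts chosen from two clusters can be added when the clusters are merged. -/
theorem Sol.merge (hE : K.ElimOk X P L) {k : ℕ} (hk : k < L) {t : ℕ → ℕ} (h : K.Sol X P k t) :
    ∃ t', K.Sol X P (k + 1) t' ∧ ∑ u ∈ Finset.range K.n, t' u = ∑ u ∈ Finset.range K.n, t u := by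
  obtain ⟨hv, hp, hne, htw⟩ := hE k hk
  refine ⟨Function.update (Function.update t (P k) (t (P k) + t (X k))) (X k) 0, ⟨?_, ?_, ?_⟩, ?_⟩
  · intro u hu
    obtain ⟨hu, huv⟩ := left_succ.1 hu
    rw [Function.update_of_ne huv]
    by_cases e : u = P k
    · subst e
      simp only [table, Function.update_self]
      refine ⟨t (X k), by omega, by simpa using h.tab _ hp, h.tab _ hv, fun hr => ?_, fun hr => ?_⟩
      · simpa using h.arc _ _ hp hv hne.symm hr
      · simpa using h.arc _ _ hv hp hne hr
    · simp only [table, Function.update_of_ne e]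
      exact h.tab u hu
  · intro u y hu hy huy hr
    obtain ⟨hu, huv⟩ := left_succ.1 hu
    obtain ⟨hy, hyv⟩ := left_succ.1 hy
    rw [Function.update_of_ne huv, Function.update_of_ne hyv]
    simp only [weight]
    by_cases e : u = P k
    · subst e
      have h1 := h.arc _ _ hu hy huy hr
      have h2 := h.arc _ _ hv hy hyv.symm ((htw y hy hyv huy.symm).2.2 hr)
      rw [Function.update_self, Function.update_of_ne huy.symm, Function.update_of_ne huy.symm]
      omega
    · rw [Function.update_of_ne e]
      by_cases e' : y = P k
      · subst e'
        have h1 := h.arc _ _ hu hy huy hr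
        have h2 := h.arc _ _ hu hv huv ((htw u hu huv e).1.2 hr)
        rw [Function.update_self, Function.update_self]
        omega
      · rw [Function.update_of_ne e', Function.update_of_ne e']
        exact h.arc u y hu hy huy hr
  · intro u hu
    by_cases e : u = X k
    · subst e; simp
    · have hu' : ¬ K.Left X k u := fun h => hu (left_succ.2 ⟨h, e⟩)
      rw [Function.update_of_ne e, Function.update_of_ne (by rintro rfl; exact hu' hp)]
      exact h.zero u hu'
  · refine sum_congr_pair hp.1.1 hv.1.1 hne.symm ?_ fun u h1 h2 => ?_
    · rw [Function.update_of_ne hne.symm]; simp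
    · rw [Function.update_of_ne h2, Function.update_of_ne h1]

/-- Splitting the amount chosen from a merged cluster undoes the merge. -/
theorem Sol.split (hE : K.ElimOk X P L) {k : ℕ} (hk : k < L) {t : ℕ → ℕ} (h : K.Sol X P (k + 1) t)
    {y : ℕ} (hy : K.SplitOk (P k) (X k) (K.table X P k (P k)) (K.table X P k (X k))
      (K.weight X P k (P k)) (K.weight X P k (X k)) (t (P k)) y) :
    K.Sol X P k (Function.update (Function.update t (X k) y) (P k) (t (P k) - y)) ∧
    ∑ u ∈ Finset.range K.n, Function.update (Function.update t (X k) y) (P k) (t (P k) - y) u =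
      ∑ u ∈ Finset.range K.n, t u := by
  obtain ⟨hv, hp, hne, htw⟩ := hE k hk
  obtain ⟨y1, y2, y3, y4, y5⟩ := hy
  have b1 := table_le y2
  have b2 := table_le y3
  have hleft : ∀ u, K.Left X k u → u ≠ X k → K.Left X (k + 1) u := fun u h1 h2 =>
    left_succ.2 ⟨h1, h2⟩
  have harc := h.arc
  simp only [weight] at harc
  -- arcs into the merged cluster
  have hinto : ∀ u, K.Left X k u → u ≠ X k → u ≠ P k → K.R u (P k) →
      t u = 0 ∨ t (P k) - y = K.weight X P k (P k) ∧ y = K.weight X P k (X k) := by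
    intro u hu h1 h2 hr
    have := harc u (P k) (hleft u hu h1) (hleft _ hp hne.symm) h2 hr
    rw [Function.update_self] at this
    omega
  -- arcs out of the merged cluster
  have hout : ∀ u, K.Left X k u → u ≠ X k → u ≠ P k → K.R (P k) u →
      (t (P k) - y = 0 ∧ y = 0) ∨ t u = K.weight X P k u := by
    intro u hu h1 h2 hr
    have := harc (P k) u (hleft _ hp hne.symm) (hleft u hu h1) h2.symm hr
    rw [Function.update_of_ne h2] at this
    omega
  refine ⟨⟨?_, ?_, ?_⟩, ?_⟩
  · intro u hu
    by_cases e : u = P k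
    · subst e; simpa using y2
    · rw [Function.update_of_ne e]
      by_cases e' : u = X k
      · subst e'; simpa using y3
      · rw [Function.update_of_ne e']
        have := h.tab u (hleft u hu e')
        simpa only [table, Function.update_of_ne e] using this
  · intro a b ha hb hab hr
    by_cases a1 : a = P k
    · subst a1
      rw [Function.update_self, Function.update_of_ne hab.symm]
      by_cases b1 : b = X k
      · subst b1; simpa using y4 hr
      · rw [Function.update_of_ne b1]
        exact (hout b hb b1 hab.symm hr).imp (fun h => h.1) id
    · rw [Function.update_of_ne a1]
      by_cases a2 : a = X k
      · subst a2
        rw [Function.update_self]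
        by_cases b1 : b = P k
        · subst b1; simpa using y5 hr
        · rw [Function.update_of_ne b1, Function.update_of_ne hab.symm]
          exact (hout b hb hab.symm b1 ((htw b hb hab.symm b1).2.1 hr)).imp (fun h => h.2) id
      · rw [Function.update_of_ne a2]
        by_cases b1 : b = P k
        · subst b1
          rw [Function.update_self]
          exact (hinto a ha a2 a1 hr).imp id fun h => h.1
        · rw [Function.update_of_ne b1]
          by_cases b2 : b = X k
          · subst b2
            rw [Function.update_self]
            exact (hinto a ha a2 a1 ((htw a ha a2 a1).1.1 hr)).imp id fun h => h.2
          · rw [Function.update_of_ne b2]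
            have := harc a b (hleft a ha a2) (hleft b hb b2) hab hr
            rwa [Function.update_of_ne b1] at this
  · intro u hu
    rw [Function.update_of_ne (by rintro rfl; exact hu hp),
      Function.update_of_ne (by rintro rfl; exact hu hv)]
    exact h.zero u fun h' => hu (left_succ.1 h').1
  · refine sum_congr_pair hp.1.1 hv.1.1 hne.symm ?_ fun u h1 h2 => ?_
    · have : t (X k) = 0 := h.zero _ fun h' => (left_succ.1 h').2 rfl
      rw [Function.update_self, Function.update_of_ne hne, Function.update_self]
      omega
    · rw [Function.update_of_ne h1, Function.update_of_ne h2]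

theorem Sol.merge_all (hE : K.ElimOk X P L) {t : ℕ → ℕ} (h : K.Sol X P 0 t) :
    ∃ t', K.Sol X P L t' ∧ ∑ u ∈ Finset.range K.n, t' u = ∑ u ∈ Finset.range K.n, t u := by
  have : ∀ k ≤ L, ∃ t', K.Sol X P k t' ∧
      ∑ u ∈ Finset.range K.n, t' u = ∑ u ∈ Finset.range K.n, t u := by
    intro k
    induction k with
    | zero => exact fun _ => ⟨t, h, rfl⟩
    | succ k ih =>
      intro hk
      obtain ⟨t', h1, h2⟩ := ih (by omega)
      obtain ⟨t'', h3, h4⟩ := h1.merge hE (show k < L by omega)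
      exact ⟨t'', h3, h4.trans h2⟩
  exact this L le_rfl

open scoped Classical in
/-- The weights never exceed the total size. -/
theorem sum_weight_le (hE : K.ElimOk X P L) : ∀ k ≤ L,
    ∑ u ∈ (Finset.range K.n).filter (K.Left X k), K.weight X P k u ≤ ∑ u ∈ Finset.range K.n, K.sz u := by
  intro k
  induction k with
  | zero => exact fun _ => Finset.sum_le_sum_of_subset (Finset.filter_subset _ _)
  | succ k ih =>
    intro hk
    refine le_trans ?_ (ih (by omega))
    obtain ⟨hv, hp, hne, htw⟩ := hE k (by omega)
    have e : (Finset.range K.n).filter (K.Left X (k + 1)) =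
        ((Finset.range K.n).filter (K.Left X k)).erase (X k) := by
      ext u
      simp only [Finset.mem_filter, Finset.mem_erase, left_succ]
      tauto
    have hpm : P k ∈ ((Finset.range K.n).filter (K.Left X k)).erase (X k) := by
      simp [hne.symm, hp, hp.1.1]
    have hvm : X k ∈ (Finset.range K.n).filter (K.Left X k) := by
      simp [hv, hv.1.1]
    rw [e, ← Finset.add_sum_erase _ _ hvm, ← Finset.add_sum_erase _ _ hpm,
      ← Finset.add_sum_erase _ (K.weight X P k) hpm]
    have : ∑ x ∈ (((Finset.range K.n).filter (K.Left X k)).erase (X k)).erase (P k),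
        K.weight X P (k + 1) x =
        ∑ x ∈ (((Finset.range K.n).filter (K.Left X k)).erase (X k)).erase (P k),
        K.weight X P k x := by
      refine Finset.sum_congr rfl fun u hu => ?_
      rw [weight, Function.update_of_ne (by rintro rfl; simp at hu)]
    rw [this, weight, Function.update_self]
    omega

theorem weight_le (hE : K.ElimOk X P L) {k u : ℕ} (hk : k ≤ L) (hu : K.Left X k u) :
    K.weight X P k u ≤ ∑ u ∈ Finset.range K.n, K.sz u := by
  classical
  refine le_trans ?_ (sum_weight_le hE k hk)
  exact Finset.single_le_sum (f := K.weight X P k) (fun _ _ => Nat.zero_le _)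
    (Finset.mem_filter.2 ⟨Finset.mem_range.2 hu.1.1, hu⟩)

/-- `B` is closed under reachability and respects the capacity. -/
structure IsUpSet (K : Net) (B : Finset ℕ) : Prop where
  lt : ∀ v ∈ B, v < K.n
  closed : ∀ v ∈ B, ∀ y, K.R v y → y ∈ B
  sum_le : ∑ v ∈ B, K.sz v ≤ K.c

theorem IsUpSet.alive {B : Finset ℕ} (h : IsUpSet K B) {v : ℕ} (hv : v ∈ B) : K.Alive v := by
  refine ⟨h.lt v hv, le_trans (Finset.sum_le_sum_of_subset fun y hy => ?_) h.sum_le⟩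
  exact h.closed v hv y ((K.mem_reach (h.lt v hv)).1 hy)

/-- If all vertices have been merged into `w`, then the total size of an up-closed set occurs in the
table of `w`. -/
theorem IsUpSet.table {B : Finset ℕ} (h : IsUpSet K B) (hE : K.ElimOk X P L) {w : ℕ}
    (hw : ∀ u, K.Left X L u → u = w) (hw' : w < K.n) (hl : ∀ u, K.Alive u → K.Left X L w) :
    K.table X P L w (∑ v ∈ B, K.sz v) := by
  by_cases hB : B = ∅
  · subst hB; simpa using table_zero L w
  obtain ⟨v, hv⟩ := Finset.nonempty_iff_ne_empty.2 hB
  have hS : K.Sol X P 0 fun u => if u ∈ B then K.sz u else 0 := by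
    refine ⟨fun u hu => ?_, fun u y hu hy hne hr => ?_, fun u hu => ?_⟩
    · show _ ∨ _
      split_ifs with hb
      · exact .inr ⟨hu.1, rfl⟩
      · exact .inl rfl
    · by_cases hb : u ∈ B
      · simp [hb, h.closed u hb y hr, weight]
      · simp [hb]
    · rw [if_neg]
      exact fun hb => hu ⟨h.alive hb, by simp⟩
  obtain ⟨t, h1, h2⟩ := hS.merge_all hE
  have hwl := hl v (h.alive hv)
  have e1 : ∑ u ∈ Finset.range K.n, t u = t w := by
    refine Finset.sum_eq_single w (fun u _ hne => h1.zero u fun hu => hne (hw u hu)) fun hn => ?_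
    simp at hn; omega
  have e2 : ∑ u ∈ Finset.range K.n, (if u ∈ B then K.sz u else 0) = ∑ v ∈ B, K.sz v := by
    rw [← Finset.sum_filter]
    congr 1
    ext u
    simp only [Finset.mem_filter, Finset.mem_range]
    exact ⟨fun h => h.2, fun hb => ⟨h.lt u hb, hb⟩⟩
  rw [← e2, ← h2, e1]
  exact h1.tab w hwl

/-- The choice before the first merge is an up-closed set. -/
theorem Sol.isUpSet {t : ℕ → ℕ} (h : K.Sol X P 0 t) (hc : ∑ u ∈ Finset.range K.n, t u ≤ K.c) :
    IsUpSet K ((Finset.range K.n).filter fun v => 0 < t v) ∧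
      ∑ v ∈ (Finset.range K.n).filter (fun v => 0 < t v), K.sz v =
        ∑ u ∈ Finset.range K.n, t u := by
  have hal : ∀ v, 0 < t v → K.Left X 0 v := by
    intro v hv
    by_contra hn
    have := h.zero v hn
    omega
  have hsz : ∀ v, 0 < t v → t v = K.sz v := by
    intro v hv
    rcases h.tab v (hal v hv) with h | h
    · omega
    · exact h.2
  have hsum : ∑ v ∈ (Finset.range K.n).filter (fun v => 0 < t v), K.sz v =
      ∑ u ∈ Finset.range K.n, t u := by
    rw [Finset.sum_filter]
    refine Finset.sum_congr rfl fun u _ => ?_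
    split_ifs with hu
    · exact (hsz u hu).symm
    · omega
  refine ⟨⟨?_, ?_, by omega⟩, hsum⟩
  · intro v hv; simp at hv; exact hv.1
  · intro v hv y hr
    simp at hv ⊢
    refine ⟨hr.lt hv.1, ?_⟩
    by_cases e : v = y
    · subst e; exact hv.2
    · have hy : K.Left X 0 y := ⟨(hal v hv.2).1.mono hr, by simp⟩
      have hpos := K.sz_pos y hy.1.1
      rcases h.arc v y (hal v hv.2) hy e hr with h | h
      · omega
      · simp only [weight] at h; omega

/-- Only `w` is left, and an amount from its table is chosen. -/
theorem Sol.single {w s : ℕ} (hw : ∀ u, K.Left X L u → u = w) (hs : K.table X P L w s)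
    (hl : K.Left X L w ∨ s = 0) : K.Sol X P L (Function.update (fun _ => 0) w s) := by
  refine ⟨fun u hu => ?_, fun u y hu hy hne => absurd ((hw u hu).trans (hw y hy).symm) hne,
    fun u hu => ?_⟩
  · rw [hw u hu]; simpa using hs
  · by_cases e : u = w
    · subst e
      rcases hl with hl | rfl
      · exact absurd hl hu
      · simp
    · simp [Function.update_of_ne e]

end Net

/-! ### Computing the tables -/

namespace Tables

open Ex Cmd Net

/-- The tables of the single vertices. -/
def init : Cmd :=
  .for .v nE
    (put .tab (Reg.v * (cE + 1)) 1 ;;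
     when (lt 0 (get .cnt Reg.v)) (put .tab (Reg.v * (cE + 1) + inp (Reg.v + 2)) 1) ;;
     put .wgt Reg.v (inp (Reg.v + 2)))

/-- Sets `r` to `1` if the vertex `a` reaches the vertex `b`, and to `0` otherwise. -/
def reaches (r a b : Reg) : Cmd :=
  .set r 0 ;;
  .for .j (get .cnt a) (when (eq (get .row (a * cE + Reg.j)) b) (.set r 1))

/-- Checks whether the amount `s` can be split so that `j` comes from the cluster of `v`. -/
def test : Cmd :=
  when (eq (get .tab (Reg.base + (Reg.s - Reg.j))) 1)
    (when (eq (get .tab (Reg.len + Reg.j)) 1)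
      (when (eq Reg.x 0 + eq (Reg.s - Reg.j) 0 + eq Reg.j Reg.q)
        (when (eq Reg.y 0 + eq Reg.j 0 + eq (Reg.s - Reg.j) Reg.d)
          (.set .f 1 ;; .set .g Reg.j))))

/-- One entry of the merged table. The entries are computed in decreasing order of `s`, so that the
table of `p` can be overwritten: entry `s` depends on the old entries up to `s` only. -/
def entry : Cmd :=
  .set .s (cE - Reg.i) ;;
  .set .f 0 ;;
  .set .g 0 ;;
  .for .j (Reg.s + 1) test ;;
  put .tab (Reg.base + Reg.s) Reg.f ;;
  put .cho (Reg.len + Reg.s) Reg.g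

/-- Loads the data of step `k`. -/
def load : Cmd :=
  .set .v (get .lx Reg.k) ;;
  .set .p (get .lp Reg.k) ;;
  .set .base (Reg.p * (cE + 1)) ;;
  .set .len (Reg.v * (cE + 1)) ;;
  .set .d (get .wgt Reg.p) ;;
  .set .q (get .wgt Reg.v)

/-- The merge in step `k`. -/
def merge : Cmd :=
  load ;;
  reaches .x .p .v ;;
  reaches .y .v .p ;;
  .for .i (cE + 1) entry ;;
  put .wgt Reg.p (Reg.d + Reg.q)

/-- Computes the tables of all clusters. -/
def prog : Cmd := init ;; .for .k Reg.em merge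

variable {K : Net}

theorem cell_lt {v σ : ℕ} (hv : v < K.n) (hσ : σ ≤ K.c) : v * (K.c + 1) + σ < 2 * (K.n * K.c) := by
  have h1 : v * (K.c + 1) + σ < K.n * (K.c + 1) := by
    calc v * (K.c + 1) + σ < (v + 1) * (K.c + 1) := by rw [add_mul v]; omega
      _ ≤ K.n * (K.c + 1) := Nat.mul_le_mul_right _ hv
  have h2 : K.n * 1 ≤ K.n * K.c := Nat.mul_le_mul_left _ K.c_pos
  have h3 : K.n * (K.c + 1) = K.n * K.c + K.n := by ring
  omega

theorem cell_le_X {v σ : ℕ} (hv : v < K.n) (hσ : σ ≤ K.c) : v * (K.c + 1) + σ < K.X := by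
  have h1 : v * (K.c + 1) + σ < K.n * (K.c + 1) := by
    calc v * (K.c + 1) + σ < (v + 1) * (K.c + 1) := by rw [add_mul v]; omega
      _ ≤ K.n * (K.c + 1) := Nat.mul_le_mul_right _ hv
  have := K.mul_le_X
  nlinarith

/-- The amount `s` can be split in step `k` so that `y` comes from the cluster of the eliminated
vertex. -/
def Split (K : Net) (X P : ℕ → ℕ) (k s y : ℕ) : Prop :=
  K.SplitOk (P k) (X k) (K.table X P k (P k)) (K.table X P k (X k)) (K.weight X P k (P k))
    (K.weight X P k (X k)) s y

theorem table_succ_self {X P : ℕ → ℕ} {k s : ℕ} :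
    K.table X P (k + 1) (P k) s ↔ ∃ y, Split K X P k s y := by
  simp [table, Split]

theorem table_succ_of_ne {X P : ℕ → ℕ} {k u : ℕ} (h : u ≠ P k) :
    K.table X P (k + 1) u = K.table X P k u := by
  simp [table, h]

/-- The tables after `k` merges have been computed. -/
structure Inv (K : Net) (X P : ℕ → ℕ) (k : ℕ) (s : St) : Prop where
  tab : ∀ u < K.n, ∀ σ ≤ K.c, s.arr .tab (u * (K.c + 1) + σ) = 1 ↔ K.table X P k u σ
  wgt : ∀ u < K.n, s.arr .wgt u = K.weight X P k u
  cho : ∀ k' < k, ∀ σ ≤ K.c, K.table X P (k' + 1) (P k') σ →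
    Split K X P k' σ (s.arr .cho (X k' * (K.c + 1) + σ))

theorem init_runs {s : St} (hR : Components.Rows K s) (h0 : ∀ j, s.arr .tab j = 0) {X P : ℕ → ℕ} :
    Runs K.toEnv init s ((K.n + 1) * (0 + 1)) fun s' => Inv K X P 0 s' := by
  have hnX := K.n_le_X
  refine Runs.for K.n (fun i s' => (∀ u < i, (∀ σ ≤ K.c,
      (s'.arr .tab (u * (K.c + 1) + σ) = 1 ↔ K.table X P 0 u σ)) ∧ s'.arr .wgt u = K.sz u) ∧
      ∀ u, i ≤ u → ∀ σ ≤ K.c, s'.arr .tab (u * (K.c + 1) + σ) = 0) rfl (by omega) ?_ ?_ ?_ ?_ ?_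
  · intro i s' x h; exact h
  · exact ⟨by simp, fun u _ σ _ => h0 _⟩
  · simp
  · rintro i s' hf ⟨h1, h2⟩ hi hin
    have ecnt : s'.arr .cnt = s.arr .cnt := hf.arr .cnt rfl
    obtain ⟨hs1, hs2⟩ := K.inp_sz i hin
    have hil := K.lt_two_mul hin.le
    have hc0 := cell_lt hin (Nat.zero_le K.c)
    have hrow := hR i hin
    have hszX := K.sz_add_le hin
    have hsz := K.sz_pos i hin
    have hother : ∀ u σ u' σ', σ ≤ K.c → σ' ≤ K.c → u * (K.c + 1) + σ = u' * (K.c + 1) + σ' →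
        u = u' ∧ σ = σ' := fun u σ u' σ' g g' e => row_inj (by omega) (by omega) e
    have hcz := K.c_le_X
    refine .of_wp ?_
    simp [when, hi, hs1, hs2, Env.lim, ecnt, hil]
    refine ⟨by omega, by omega, fun hcnt => ?_, fun hcnt => ?_⟩
    · have ha : K.Alive i := hrow.alive.1 (by omega)
      have hzc : K.sz i ≤ K.c := le_trans (Finset.single_le_sum (f := K.sz)
        (fun _ _ => Nat.zero_le _) ((K.mem_reach hin).2 (R.refl i))) ha.2
      have hcz := cell_lt hin hzc
      refine ⟨by omega, by omega, by omega, fun u hu => ⟨fun σ hσ => ?_, ?_⟩, fun u hu σ hσ => ?_⟩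
      · simp only [Function.update_apply, table]
        by_cases e : u = i
        · subst e
          simp [ha]
          by_cases e1 : σ = K.sz u
          · simp [e1]
          · by_cases e2 : σ = 0
            · simp [e2]
            · simp [e1, e2, h2 u le_rfl σ hσ]
        · have n1 : u * (K.c + 1) + σ ≠ i * (K.c + 1) + K.sz i := fun e' =>
            e (hother u σ i (K.sz i) hσ hzc e').1
          have n2 : u * (K.c + 1) + σ ≠ i * (K.c + 1) := fun e' =>
            e (hother u σ i 0 hσ (by omega) e').1
          rw [if_neg n1, if_neg n2]
          exact (h1 u (by omega)).1 σ hσ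
      · simp only [Function.update_apply]
        split_ifs with e
        · rw [e]
        · exact (h1 u (by omega)).2
      · have n1 : u * (K.c + 1) + σ ≠ i * (K.c + 1) + K.sz i := fun e' => by
          have := (hother u σ i (K.sz i) hσ hzc e').1; omega
        have n2 : u * (K.c + 1) + σ ≠ i * (K.c + 1) := fun e' => by
          have := (hother u σ i 0 hσ (by omega) e').1; omega
        rw [Function.update_of_ne n1, Function.update_of_ne n2]
        exact h2 u (by omega) σ hσ
    · have ha : ¬ K.Alive i := fun ha => hrow.alive.2 ha (by omega)
      refine ⟨by omega, fun u hu => ⟨fun σ hσ => ?_, ?_⟩, fun u hu σ hσ => ?_⟩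
      · simp only [Function.update_apply, table]
        by_cases e : u = i
        · subst e
          simp [ha]
          by_cases e2 : σ = 0
          · simp [e2]
          · simp [e2, h2 u le_rfl σ hσ]
        · have n2 : u * (K.c + 1) + σ ≠ i * (K.c + 1) := fun e' =>
            e (hother u σ i 0 hσ (by omega) e').1
          rw [if_neg n2]
          exact (h1 u (by omega)).1 σ hσ
      · simp only [Function.update_apply]
        split_ifs with e
        · rw [e]
        · exact (h1 u (by omega)).2
      · have n2 : u * (K.c + 1) + σ ≠ i * (K.c + 1) := fun e' => by
          have := (hother u σ i 0 hσ (by omega) e').1; omega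
        rw [Function.update_of_ne n2]
        exact h2 u (by omega) σ hσ
  · rintro s' ⟨h1, h2⟩
    exact ⟨fun u hu => (h1 u hu).1, fun u hu => (h1 u hu).2, fun k' hk' => absurd hk' (by omega)⟩

theorem reaches_runs {s : St} {r a b : Reg} {u y : ℕ} (hR : Components.Rows K s) (hrj : r ≠ .j)
    (haj : a ≠ .j) (hbj : b ≠ .j) (har : a ≠ r) (hbr : b ≠ r) (ha : s.reg a = u) (hb : s.reg b = y)
    (hal : K.Alive u) :
    Runs K.toEnv (reaches r a b) s ((K.c + 1) * (0 + 1)) fun s' => s'.reg r = 0 ↔ ¬ K.R u y := by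
  have hun := hal.lt
  have hrow := hR u hun
  have hcl := hrow.cnt_le
  have hcX := K.c_le_X
  have hul := K.lt_two_mul hun.le
  refine .seq (.of_wp ?_)
  simp
  refine Runs.mono (Runs.for (f := 0) (s.arr .cnt u) (fun i s' => s'.reg r = 0 ↔
    ∀ j < i, s.arr .row (u * K.c + j) ≠ y) (by simp [Cmd.wr, when, hrj]) (by omega)
    ?_ ?_ ?_ ?_ ?_) ?_
  · intro i s' x h; simpa [hrj] using h
  · simp
  · intro i s' hf _
    have e1 : s'.reg a = u := by rw [hf.reg a (by simp [Cmd.for, Cmd.wr, when, haj.symm, har.symm])]; simp [har, ha]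
    have e2 : s'.arr .cnt = s.arr .cnt := by rw [hf.arr .cnt rfl]; simp
    simp [e1, e2, Env.lim, hul]
  · intro i s' hf hI hi hin
    have e1 : s'.reg a = u := by rw [hf.reg a (by simp [Cmd.for, Cmd.wr, when, haj.symm, har.symm])]; simp [har, ha]
    have e2 : s'.reg b = y := by rw [hf.reg b (by simp [Cmd.for, Cmd.wr, when, hbj.symm, hbr.symm])]; simp [hbr, hb]
    have e3 : s'.arr .row = s.arr .row := by rw [hf.arr .row rfl]; simp
    have hrl := K.row_lt hun (show i < K.c by omega)
    refine .of_wp ?_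
    simp [when, e1, e2, e3, hi, Env.lim]
    refine ⟨by omega, fun h => ⟨by omega, i, by omega, h⟩, fun h => ?_⟩
    rw [hI]
    refine ⟨fun g j hj => ?_, fun g j hj => g j (by omega)⟩
    by_cases e : j = i
    · subst e; exact h
    · exact g j (by omega)
  · intro s' h
    rw [h, hrow.mem hal]
    simp
  · simp; omega

/-- The state of the computation of a merged table, when the entries above `c - i` are done. -/
structure Merging (K : Net) (X P : ℕ → ℕ) (k i : ℕ) (s : St) : Prop where
  done : ∀ σ ≤ K.c, K.c < σ + i →
    (s.arr .tab (P k * (K.c + 1) + σ) = 1 ↔ K.table X P (k + 1) (P k) σ) ∧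
    (K.table X P (k + 1) (P k) σ → Split K X P k σ (s.arr .cho (X k * (K.c + 1) + σ)))
  todo : ∀ σ, σ + i ≤ K.c →
    (s.arr .tab (P k * (K.c + 1) + σ) = 1 ↔ K.table X P k (P k) σ)
  other : ∀ u < K.n, u ≠ P k → ∀ σ ≤ K.c,
    (s.arr .tab (u * (K.c + 1) + σ) = 1 ↔ K.table X P k u σ)
  cho : ∀ k' < k, ∀ σ ≤ K.c, K.table X P (k' + 1) (P k') σ →
    Split K X P k' σ (s.arr .cho (X k' * (K.c + 1) + σ))

/-- The registers hold the data of step `k`. -/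
structure Loaded (K : Net) (X P : ℕ → ℕ) (k : ℕ) (s : St) : Prop where
  base : s.reg .base = P k * (K.c + 1)
  len : s.reg .len = X k * (K.c + 1)
  d : s.reg .d = K.weight X P k (P k)
  q : s.reg .q = K.weight X P k (X k)

/-- One entry of the merged table costs `O(c)` steps, one for each way to split its amount. -/
theorem entry_runs {s : St} {X P : ℕ → ℕ} {k i L : ℕ} (hE : K.ElimOk X P L) (hk : k < L)
    (hM : Merging K X P k i s) (hl : Loaded K X P k s) (hx : s.reg .x = 0 ↔ ¬ K.R (P k) (X k))
    (hy : s.reg .y = 0 ↔ ¬ K.R (X k) (P k)) (hi : s.reg .i = i) (hic : i ≤ K.c) :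
    Runs K.toEnv entry s ((K.c + 2) * (0 + 1)) fun s' => Merging K X P k (i + 1) s' := by
  obtain ⟨⟨hv, _⟩, ⟨hp, _⟩, hne, -⟩ := hE k hk
  have hvn := hv.lt
  have hpn := hp.lt
  have hcX := K.c_le_X
  have hcX2 : K.c + 1 < K.X := by
    have := K.mul_le_X
    have := K.n_pos
    nlinarith
  obtain ⟨σ, hσ⟩ : ∃ σ, σ = K.c - i := ⟨_, rfl⟩
  have hσi : σ + i = K.c := by omega
  refine .seq (.of_wp ?_)
  simp [hi, ← hσ]
  refine ⟨by omega, .seq (.of_wp ?_)⟩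
  simp
  refine .seq (.of_wp ?_)
  simp
  refine .seq (Runs.frame (Runs.mono (Runs.for (f := 0) (Q := fun s' => s'.reg .g ≤ σ ∧
      (s'.reg .f = 1 ∧ Split K X P k σ (s'.reg .g) ∨
        s'.reg .f = 0 ∧ ∀ y < σ + 1, ¬ Split K X P k σ y)) (σ + 1)
    (fun j s' => s'.reg .g ≤ σ ∧ (s'.reg .f = 1 ∧ Split K X P k σ (s'.reg .g) ∨
      s'.reg .f = 0 ∧ ∀ y < j, ¬ Split K X P k σ y)) rfl (by omega) ?_ ?_ ?_ ?_
    fun _ h => h) ?_) ?_)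
  · intro j s' x h; simpa using h
  · simp
  · intro j s' hf _
    have e1 : s'.reg .s = σ := by rw [hf.reg .s rfl]; simp
    simp [e1]
  · rintro j s' hf ⟨hg, hfg⟩ hj hjσ
    have e1 : s'.reg .s = σ := by rw [hf.reg .s rfl]; simp
    have e2 : s'.reg .base = P k * (K.c + 1) := by rw [hf.reg .base rfl]; simpa using hl.base
    have e3 : s'.reg .len = X k * (K.c + 1) := by rw [hf.reg .len rfl]; simpa using hl.len
    have e4 : s'.reg .d = K.weight X P k (P k) := by rw [hf.reg .d rfl]; simpa using hl.d
    have e5 : s'.reg .q = K.weight X P k (X k) := by rw [hf.reg .q rfl]; simpa using hl.q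
    have e6 : s'.reg .x = s.reg .x := by rw [hf.reg .x rfl]; simp
    have e7 : s'.reg .y = s.reg .y := by rw [hf.reg .y rfl]; simp
    have e8 : s'.arr .tab = s.arr .tab := by rw [hf.arr .tab rfl]; simp
    have c1 := cell_lt hpn (show σ - j ≤ K.c by omega)
    have c2 := cell_lt hvn (show j ≤ K.c by omega)
    have t1 := hM.todo (σ - j) (by omega)
    have t2 := hM.other (X k) hvn hne j (by omega)
    have hno : ¬ Split K X P k σ j → s'.reg .g ≤ σ ∧
        (s'.reg .f = 1 ∧ Split K X P k σ (s'.reg .g) ∨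
        s'.reg .f = 0 ∧ ∀ y < j + 1, ¬ Split K X P k σ y) := by
      intro hn
      refine ⟨hg, hfg.imp id fun h => ⟨h.1, fun y hy => ?_⟩⟩
      by_cases e : y = j
      · subst e; exact hn
      · exact h.2 y (by omega)
    refine .of_wp ?_
    simp only [test, when, wp, safe_eq, safe_get, safe_add, safe_sub, safe_reg, safe_one, safe_zero,
      val_eq, val_get, val_add, val_sub, val_reg, val_one, val_zero, e1, e2, e3, e4, e5, e6, e7, e8,
      hj, Env.lim, c1, c2, true_and, and_true, St.setR_reg]
    refine ⟨fun h1 => ⟨fun h2 => ⟨fun h3 => ⟨fun h4 => ?_, fun h4 => hno ?_⟩, fun h3 => hno ?_⟩,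
      fun h2 => hno ?_⟩, fun h1 => hno ?_⟩
    · have hs : Split K X P k σ j := by
        refine ⟨by omega, ?_, ?_, fun hr => ?_, fun hr => ?_⟩
        · by_contra h; exact h1 (if_neg (mt t1.1 h))
        · by_contra h; exact h2 (if_neg (mt t2.1 h))
        · have : s.reg .x ≠ 0 := fun h => hx.1 h hr
          by_contra h
          push Not at h
          simp [this, h.1, h.2] at h3
        · have : s.reg .y ≠ 0 := fun h => hy.1 h hr
          by_contra h
          push Not at h
          simp [this, h.1, h.2] at h4
      refine ⟨by omega, by simp; omega, by simp; omega, .inl ⟨by simp, by simpa using hs⟩⟩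
    · intro hs
      have := hs.2.2.2.2
      by_cases h : s.reg .y = 0
      · simp [h] at h4
      · have hr : K.R (X k) (P k) := by by_contra hr; exact h (hy.2 hr)
        rcases this hr with h5 | h5 <;> simp [h5] at h4
    · intro hs
      have := hs.2.2.2.1
      by_cases h : s.reg .x = 0
      · simp [h] at h3
      · have hr : K.R (P k) (X k) := by by_contra hr; exact h (hx.2 hr)
        rcases this hr with h5 | h5 <;> simp [h5] at h3
    · intro hs
      exact absurd ((if_pos (t2.2 hs.2.2.1)).symm.trans h2) one_ne_zero
    · intro hs
      exact absurd ((if_pos (t1.2 hs.2.1)).symm.trans h1) one_ne_zero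
  · simp; omega
  · rintro s1 hf1 ⟨hg, hfg⟩
    have e1 : s1.reg .s = σ := by rw [hf1.reg .s rfl]; simp
    have e2 : s1.reg .base = P k * (K.c + 1) := by rw [hf1.reg .base rfl]; simpa using hl.base
    have e3 : s1.reg .len = X k * (K.c + 1) := by rw [hf1.reg .len rfl]; simpa using hl.len
    have e8 : s1.arr .tab = s.arr .tab := by rw [hf1.arr .tab rfl]; simp
    have e9 : s1.arr .cho = s.arr .cho := by rw [hf1.arr .cho rfl]; simp
    have c1 := cell_lt hpn (show σ ≤ K.c by omega)
    have c2 := cell_lt hvn (show σ ≤ K.c by omega)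
    have hcell : ∀ u σ u' σ', σ ≤ K.c → σ' ≤ K.c → u * (K.c + 1) + σ = u' * (K.c + 1) + σ' →
        u = u' ∧ σ = σ' := fun u σ u' σ' g g' e => row_inj (by omega) (by omega) e
    have hf01 : s1.reg .f ≤ 1 := by omega
    refine .of_wp ?_
    simp [e1, e2, e3, Env.lim, c1, c2]
    refine ⟨by omega, by omega, ?_⟩
    refine ⟨fun σ' hσ' hlt => ?_, fun σ' hσ' => ?_, fun u hu hup σ' hσ' => ?_,
      fun k' hk' σ' hσ' ht => ?_⟩
    · simp only [St.setA_arr, reduceCtorEq, if_false, if_true, Function.update_apply, e8, e9,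
        Nat.add_left_cancel_iff]
      by_cases e : σ' = σ
      · subst e
        simp only [if_true, table_succ_self]
        rcases hfg with ⟨h1, h2⟩ | ⟨h1, h2⟩
        · simp only [h1, true_iff]
          exact ⟨⟨_, h2⟩, fun _ => h2⟩
        · have : ¬ ∃ y, Split K X P k σ' y := by
            rintro ⟨y, hy⟩
            exact h2 y (by have := hy.1; omega) hy
          simp [h1, this]
      · rw [if_neg e, if_neg e]
        exact hM.done σ' hσ' (by omega)
    · simp only [St.setA_arr, reduceCtorEq, if_false, if_true, Function.update_apply, e8, e9,
        Nat.add_left_cancel_iff]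
      rw [if_neg (by omega)]
      exact hM.todo σ' (by omega)
    · simp only [St.setA_arr, reduceCtorEq, if_false, if_true, Function.update_apply, e8, e9]
      rw [if_neg (fun e => hup (hcell u σ' _ σ hσ' (by omega) e).1)]
      exact hM.other u hu hup σ' hσ'
    · simp only [St.setA_arr, reduceCtorEq, if_false, if_true, Function.update_apply, e8, e9]
      rw [if_neg]
      · exact hM.cho k' hk' σ' hσ' ht
      · intro e
        have := (hcell _ σ' _ σ hσ' (by omega) e).1
        have := hE.injOn (show k' < L by omega) hk this
        omega

theorem merge_runs {s : St} {X P : ℕ → ℕ} {k L : ℕ} (hE : K.ElimOk X P L) (hk : k < L)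
    (hX : s.arr .lx = X) (hP : s.arr .lp = P) (hR : Components.Rows K s) (hI : Inv K X P k s)
    (hsk : s.reg .k = k) :
    Runs K.toEnv merge s ((K.c + 2) * ((K.c + 2) * (0 + 1) + 1)) fun s' => Inv K X P (k + 1) s' := by
  obtain ⟨⟨hv, _⟩, hpL, hne, -⟩ := hE k hk
  have hp := hpL.1
  have hvn := hv.lt
  have hpn := hp.lt
  have hcX := K.c_le_X
  have hnX := K.n_le_X
  have hL := hE.le
  have hkl := K.lt_two_mul (show k ≤ K.n by omega)
  have hvl := K.lt_two_mul hvn.le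
  have hpl := K.lt_two_mul hpn.le
  have c1 := cell_le_X hpn (Nat.zero_le K.c)
  have c2 := cell_le_X hvn (Nat.zero_le K.c)
  have w1 := hI.wgt _ hpn
  have w2 := hI.wgt _ hvn
  have hpL' : K.Left X (k + 1) (P k) := left_succ.2 ⟨hpL, hne.symm⟩
  have w3 : K.weight X P k (P k) + K.weight X P k (X k) ≤ K.X := by
    have := weight_le hE (show k + 1 ≤ L by omega) hpL'
    simp [weight] at this
    have := K.total_le
    omega
  have hload : Runs K.toEnv load s 0 fun s' => Loaded K X P k s' ∧ s'.reg .v = X k ∧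
      s'.reg .p = P k := by
    refine .of_wp ?_
    simp [load, hsk, hX, hP, Env.lim, hkl, hvl, hpl, w1, w2]
    exact ⟨by omega, by omega, by omega, by omega, by omega, by omega, by constructor <;> simp⟩
  refine .seq ((hload.mono (Nat.zero_le _)).frame ?_)
  rintro s1 hf1 ⟨l1, v1, p1⟩
  have ear1 : ∀ k, s1.arr k = s.arr k := fun k => hf1.arr k (by cases k <;> rfl)
  refine .seq (((reaches_runs (K := K) (u := P k) (y := X k) (r := .x) (a := .p) (b := .v)
    (by unfold Components.Rows; simp only [ear1]; exact hR) (by simp) (by simp) (by simp) (by simp)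
    (by simp) p1 v1 hp).mono (by nlinarith)).frame ?_)
  intro s2 hf2 hx
  have ear2 : ∀ k, s2.arr k = s.arr k := fun k => (hf2.arr k (by cases k <;> rfl)).trans (ear1 k)
  have v2 : s2.reg .v = X k := (hf2.reg .v rfl).trans v1
  have p2 : s2.reg .p = P k := (hf2.reg .p rfl).trans p1
  refine .seq (((reaches_runs (K := K) (u := X k) (y := P k) (r := .y) (a := .v) (b := .p)
    (by unfold Components.Rows; simp only [ear2]; exact hR) (by simp) (by simp) (by simp) (by simp)
    (by simp) v2 p2 hv).mono (by nlinarith)).frame ?_)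
  intro s3 hf3 hy
  have ear3 : ∀ k, s3.arr k = s.arr k := fun k => (hf3.arr k (by cases k <;> rfl)).trans (ear2 k)
  have p3 : s3.reg .p = P k := (hf3.reg .p rfl).trans p2
  have x3 : s3.reg .x = 0 ↔ ¬ K.R (P k) (X k) := by rw [hf3.reg .x rfl]; exact hx
  have l3 : Loaded K X P k s3 := by
    constructor
    · rw [hf3.reg .base rfl, hf2.reg .base rfl, l1.base]
    · rw [hf3.reg .len rfl, hf2.reg .len rfl, l1.len]
    · rw [hf3.reg .d rfl, hf2.reg .d rfl, l1.d]
    · rw [hf3.reg .q rfl, hf2.reg .q rfl, l1.q]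
  refine .seq (Runs.frame (Runs.for (f := (K.c + 2) * (0 + 1)) (Q := fun s' =>
    Merging K X P k (K.c + 1) s') (K.c + 1) (fun i s' => Merging K X P k i s') rfl
    ?_ ?_ ?_ ?_ ?_ fun _ h => h) ?_)
  · have := K.mul_le_X
    have := K.n_pos
    nlinarith
  · intro i s' x h
    exact ⟨h.done, h.todo, h.other, h.cho⟩
  · refine ⟨fun σ h1 h2 => by omega, fun σ h1 => ?_, fun u hu _ σ hσ => ?_, ?_⟩
    · rw [ear3]; exact hI.tab _ hpn σ (by omega)
    · rw [ear3]; exact hI.tab _ hu σ hσ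
    · rw [ear3]; exact hI.cho
  · intro i s' _ _; simp
  · intro i s' hf hM hi hic
    refine entry_runs hE hk hM ⟨?_, ?_, ?_, ?_⟩ ?_ ?_ hi (by omega)
    · rw [hf.reg .base rfl, l3.base]
    · rw [hf.reg .len rfl, l3.len]
    · rw [hf.reg .d rfl, l3.d]
    · rw [hf.reg .q rfl, l3.q]
    · rw [hf.reg .x rfl]; exact x3
    · rw [hf.reg .y rfl]; exact hy
  · intro s4 hf4 hM
    have p4 : s4.reg .p = P k := (hf4.reg .p rfl).trans p3
    have d4 : s4.reg .d = K.weight X P k (P k) := (hf4.reg .d rfl).trans l3.d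
    have q4 : s4.reg .q = K.weight X P k (X k) := (hf4.reg .q rfl).trans l3.q
    have a4 : s4.arr .wgt = s.arr .wgt := (hf4.arr .wgt rfl).trans (ear3 _)
    refine .of_wp ?_
    simp [p4, d4, q4, Env.lim, hpl]
    refine ⟨w3, ?_, ?_, ?_⟩
    · intro u hu σ hσ
      simp only [St.setA_arr, reduceCtorEq, if_false]
      by_cases e : u = P k
      · subst e; exact (hM.done σ hσ (by omega)).1
      · rw [table_succ_of_ne e]; exact hM.other u hu e σ hσ
    · intro u hu
      simp only [St.setA_arr, if_true, weight, a4, Function.update_apply]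
      split_ifs
      · rfl
      · exact hI.wgt u hu
    · intro k' hk' σ hσ ht
      simp only [St.setA_arr, reduceCtorEq, if_false]
      by_cases e : k' = k
      · subst e; exact (hM.done σ hσ (by omega)).2 ht
      · exact hM.cho k' (by omega) σ hσ ht

theorem prog_runs {s : St} {X P : ℕ → ℕ} {L : ℕ} (hE : K.ElimOk X P L) (hX : s.arr .lx = X)
    (hP : s.arr .lp = P) (hL : s.reg .em = L) (hR : Components.Rows K s)
    (h0 : ∀ j, s.arr .tab j = 0) :
    Runs K.toEnv prog s ((K.n + 1) * ((K.c + 2) * ((K.c + 2) * (0 + 1) + 1) + 1)) fun s' =>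
      Inv K X P L s' := by
  have hnX := K.n_le_X
  have hLn := hE.le
  refine .seq (((init_runs (X := X) (P := P) hR h0).mono (Nat.mul_le_mul_left _ (by omega))).frame ?_)
  intro s1 hf1 hI
  refine Runs.mono (Runs.for (f := (K.c + 2) * ((K.c + 2) * (0 + 1) + 1)) L
    (fun k s' => Inv K X P k s') rfl (by omega) ?_ hI ?_ ?_ fun _ h => h)
    (Nat.mul_le_mul_right _ (by omega))
  · intro i s' x h; exact ⟨h.tab, h.wgt, h.cho⟩
  · intro i s' hf _
    have : s'.reg .em = L := by rw [hf.reg .em rfl, hf1.reg .em rfl, hL]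
    simp [this]
  · intro k s' hf hI hk hkL
    have e1 : s'.arr .cnt = s.arr .cnt := by rw [hf.arr .cnt rfl, hf1.arr .cnt rfl]
    have e2 : s'.arr .row = s.arr .row := by rw [hf.arr .row rfl, hf1.arr .row rfl]
    exact merge_runs hE hkL (by rw [hf.arr .lx rfl, hf1.arr .lx rfl, hX])
      (by rw [hf.arr .lp rfl, hf1.arr .lp rfl, hP]) (by unfold Components.Rows; rw [e1, e2]; exact hR)
      hI hk

end Tables

/-! ### Reading off an optimal solution -/

namespace Traceback

open Ex Cmd Net

/-- Finds the largest amount in the table of the last cluster. -/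
def best : Cmd :=
  .set .base (Reg.w * (cE + 1)) ;;
  .set .s cE ;;
  .loop (eq (eq (get .tab (Reg.base + Reg.s)) 1) 0) (.set .s (Reg.s - 1)) ;;
  put .tgt Reg.w Reg.s

/-- Splits the amount that is chosen from a merged cluster. -/
def split : Cmd :=
  .set .k (Reg.em - 1 - Reg.i) ;;
  .set .v (get .lx Reg.k) ;;
  .set .p (get .lp Reg.k) ;;
  .set .t (get .tgt Reg.p) ;;
  .set .g (get .cho (Reg.v * (cE + 1) + Reg.t)) ;;
  put .tgt Reg.v Reg.g ;;
  put .tgt Reg.p (Reg.t - Reg.g)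

/-- Writes an optimal solution to the output region. -/
def prog : Cmd :=
  best ;;
  .for .i Reg.em split ;;
  .for .v nE (put .out Reg.v (lt 0 (get .tgt Reg.v)))

variable {K : Net} {X P : ℕ → ℕ} {L : ℕ}

theorem best_runs {s : St} (hI : Tables.Inv K X P L s) {w : ℕ} (hw : s.reg .w = w) (hwn : w < K.n)
    (ht : ∀ u, s.arr .tgt u = 0) :
    Runs K.toEnv best s ((K.c + 1) * (0 + 1)) fun s' => ∃ σ ≤ K.c, K.table X P L w σ ∧
      (∀ y ≤ K.c, K.table X P L w y → y ≤ σ) ∧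
      s'.arr .tgt = Function.update (fun _ => 0) w σ := by
  have hcX := K.c_le_X
  have hb := Tables.cell_le_X hwn (Nat.zero_le K.c)
  have hwl := K.lt_two_mul hwn.le
  refine .seq (.of_wp ?_)
  simp [hw]
  refine ⟨by omega, .seq (.of_wp ?_)⟩
  simp
  refine ⟨by omega, .seq ((Runs.loop (N := K.c) (f := 0) (fun i s' => s'.reg .s + i = K.c ∧
    ∀ y ≤ K.c, s'.reg .s < y → ¬ K.table X P L w y) ?_ ?_ ?_ ?_).mono (by simp))⟩
  · simp; intro y h1 h2; omega
  · rintro i s' hf ⟨h1, h2⟩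
    have e1 : s'.reg .base = w * (K.c + 1) := by rw [hf.reg .base rfl]; simp
    simp [e1, Env.lim]
    exact Tables.cell_lt hwn (by omega)
  · rintro i s' hf ⟨h1, h2⟩ hv
    have e1 : s'.reg .base = w * (K.c + 1) := by rw [hf.reg .base rfl]; simp
    have e2 : s'.arr .tab = s.arr .tab := by rw [hf.arr .tab rfl]; simp
    simp [e1, e2] at hv
    rw [hI.tab w hwn _ (by omega)] at hv
    have h0 : s'.reg .s ≠ 0 := fun h => hv (by rw [h]; exact table_zero L w)
    refine ⟨by omega, .of_wp ?_⟩
    simp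
    refine ⟨by omega, by omega, fun y hy hlt => ?_⟩
    by_cases e : y = s'.reg .s
    · rw [e]; exact hv
    · exact h2 y hy (by omega)
  · rintro i s' hf ⟨h1, h2⟩ hv
    have e1 : s'.reg .base = w * (K.c + 1) := by rw [hf.reg .base rfl]; simp
    have e2 : s'.arr .tab = s.arr .tab := by rw [hf.arr .tab rfl]; simp
    have e3 : s'.reg .w = w := by rw [hf.reg .w rfl]; simpa using hw
    have e4 : s'.arr .tgt = fun _ => 0 := by rw [hf.arr .tgt rfl]; funext u; simp [ht]
    simp [e1, e2] at hv
    rw [hI.tab w hwn _ (by omega)] at hv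
    refine .of_wp ?_
    simp [e3, e4, Env.lim, hwl]
    refine ⟨by omega, s'.reg .s, by omega, hv, fun y hy hty => ?_, rfl⟩
    by_contra h
    exact h2 y hy (by omega) hty

/-- Undoing one merge: the amount required of the merged cluster is divided between its two parts as
recorded in the table. -/
theorem split_runs {s : St} {k : ℕ} (hE : K.ElimOk X P L) (hk : k < L) (hL : s.reg .em = L)
    (hX : s.arr .lx = X) (hP : s.arr .lp = P) (hi : s.reg .i + k + 1 = L)
    (hcho : ∀ k' < L, ∀ σ ≤ K.c, K.table X P (k' + 1) (P k') σ →
      Tables.Split K X P k' σ (s.arr .cho (X k' * (K.c + 1) + σ)))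
    (hS : K.Sol X P (k + 1) (s.arr .tgt)) (hsum : ∑ u ∈ Finset.range K.n, s.arr .tgt u ≤ K.c)
    {f : ℕ} :
    Runs K.toEnv split s f fun s' => K.Sol X P k (s'.arr .tgt) ∧
      ∑ u ∈ Finset.range K.n, s'.arr .tgt u = ∑ u ∈ Finset.range K.n, s.arr .tgt u := by
  obtain ⟨⟨hv, _⟩, hpL, hne, -⟩ := hE k hk
  have hp := hpL.1
  have hvn := hv.lt
  have hpn := hp.lt
  have hcX := K.c_le_X
  have hnX := K.n_le_X
  have hLn := hE.le
  have hkl := K.lt_two_mul (show k ≤ K.n by omega)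
  have hvl := K.lt_two_mul hvn.le
  have hpl := K.lt_two_mul hpn.le
  have htc : s.arr .tgt (P k) ≤ K.c := le_trans (Finset.single_le_sum (f := s.arr .tgt)
    (fun _ _ => Nat.zero_le _) (Finset.mem_range.2 hpn)) hsum
  have htab := hS.tab (P k) (left_succ.2 ⟨hpL, hne.symm⟩)
  have hsp := hcho k hk _ htc htab
  obtain ⟨r1, r2⟩ := hS.split hE hk hsp
  have hg := hsp.1
  have c1 := Tables.cell_lt hvn htc
  have ek : L - 1 - s.reg .i = k := by omega
  refine .of_wp ?_
  simp [split, hL, ek, hX, hP, Env.lim, hkl, hvl, hpl, c1]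
  exact ⟨by omega, by omega, by omega, by omega, by omega, by omega, r1, r2⟩

theorem prog_runs {s : St} (hE : K.ElimOk X P L) (hL : s.reg .em = L)
    (hX : s.arr .lx = X) (hP : s.arr .lp = P) (hI : Tables.Inv K X P L s) {w : ℕ}
    (hw : s.reg .w = w) (hwn : w < K.n) (hone : ∀ u, K.Left X L u → u = w)
    (hl : ∀ u, K.Alive u → K.Left X L w) (ht : ∀ u, s.arr .tgt u = 0) :
    Runs K.toEnv prog s ((K.n + 1) * (K.c + 1)) fun s' => ∃ A, IsUpSet K A ∧
      (∀ B, IsUpSet K B → ∑ v ∈ B, K.sz v ≤ ∑ v ∈ A, K.sz v) ∧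
      ∀ v < K.n, s'.arr .out v = if v ∈ A then 1 else 0 := by
  have hnX := K.n_le_X
  have hLn := hE.le
  refine .seq (((best_runs hI hw hwn ht).mono (by nlinarith)).frame ?_)
  rintro s1 hf1 ⟨σ, hσ, h1, h2, h3⟩
  -- if nothing is left, then all tables contain only `0`
  have hS : K.Sol X P L (s1.arr .tgt) := by
    rw [h3]
    refine Sol.single hone h1 ?_
    by_cases h : K.Alive w
    · exact .inl (hl w h)
    · right
      by_contra hσ0
      by_cases ha : ∃ u, K.Alive u
      · obtain ⟨u, hu⟩ := ha
        exact h (hl u hu).1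
      · have hL0 : L = 0 := by
          by_contra hL0
          exact ha ⟨_, (hE 0 (by omega)).1.1⟩
        subst hL0
        rcases h1 with h1 | h1
        · exact hσ0 h1
        · exact h h1.1
  have hsum : ∑ u ∈ Finset.range K.n, s1.arr .tgt u = σ := by
    rw [h3, Finset.sum_eq_single w (fun u _ hne => Function.update_of_ne hne _ _)
      fun hn => absurd (Finset.mem_range.2 hwn) hn]
    simp
  refine .seq (Runs.frame (Runs.mono (Runs.for (f := 0) (Q := fun s' =>
    K.Sol X P 0 (s'.arr .tgt) ∧ ∑ u ∈ Finset.range K.n, s'.arr .tgt u = σ) L (fun i s' =>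
    K.Sol X P (L - i) (s'.arr .tgt) ∧ ∑ u ∈ Finset.range K.n, s'.arr .tgt u = σ) rfl (by omega)
    ?_ ?_ ?_ ?_ fun s' h => by simpa using h) ?_) ?_)
  · intro i s' x h; exact h
  · exact ⟨hS, hsum⟩
  · intro i s' hf _
    have : s'.reg .em = L := by rw [hf.reg .em rfl, hf1.reg .em rfl, hL]
    simp [this]
  · rintro i s' hf ⟨g1, g2⟩ hi hiL
    have e1 : s'.arr .cho = s.arr .cho := by rw [hf.arr .cho rfl, hf1.arr .cho rfl]
    refine (split_runs (k := L - (i + 1)) hE (by omega)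
      (by rw [hf.reg .em rfl, hf1.reg .em rfl, hL]) (by rw [hf.arr .lx rfl, hf1.arr .lx rfl, hX])
      (by rw [hf.arr .lp rfl, hf1.arr .lp rfl, hP]) (by omega) (by rw [e1]; exact hI.cho)
      (by rwa [show L - (i + 1) + 1 = L - i by omega]) (by omega)).frame ?_
    rintro s'' _ ⟨k1, k2⟩
    exact ⟨k1, k2.trans g2⟩
  · nlinarith
  rintro s2 hf2 ⟨h4, h5⟩
  refine Runs.mono (Runs.for (f := 0) K.n (fun i s' =>
    ∀ v < i, s'.arr .out v = if 0 < s2.arr .tgt v then 1 else 0) rfl (by omega) ?_ ?_ ?_ ?_ ?_) ?_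
  · intro i s' x h; exact h
  · simp
  · simp
  · intro i s' hf h hi hin
    have e1 : s'.arr .tgt = s2.arr .tgt := hf.arr .tgt rfl
    have hil := K.lt_two_mul hin.le
    refine .of_wp ?_
    simp [hi, e1, Env.lim, hil, hin]
    refine ⟨by split_ifs <;> omega, fun v hv => ?_⟩
    rw [Function.update_apply]
    by_cases e : v = i
    · subst e; simp
    · rw [if_neg e]; exact h v (by omega)
  · intro s' h
    obtain ⟨u1, u2⟩ := h4.isUpSet (by omega)
    refine ⟨_, u1, fun B hB => ?_, fun v hv => ?_⟩
    · rw [u2, h5]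
      exact h2 _ hB.sum_le (hB.table hE hone hwn hl)
    · rw [h v hv]
      simp [hv]
  · nlinarith

end Traceback

/-! ### The whole program -/

namespace Solve

open Ex Cmd Net

/-- The algorithm for the subset sum problem with digraph constraint. -/
def prog : Cmd :=
  Search.prog ;; Components.prog ;; Order.prog ;; Insertion.prog ;; Tables.prog ;; Traceback.prog

variable {K : Net}

/-- The program finds an up-closed set of maximum size. -/
theorem prog_runs (hN : NFree K) :
    Runs K.toEnv prog ⟨fun _ => 0, fun _ _ => 0⟩ (2 * K.n * (14 * K.c ^ 2)) fun s' =>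
      ∃ A, IsUpSet K A ∧ (∀ B, IsUpSet K B → ∑ v ∈ B, K.sz v ≤ ∑ v ∈ A, K.sz v) ∧
        ∀ v < K.n, s'.arr .out v = if v ∈ A then 1 else 0 := by
  have hn := K.n_pos
  have hc := K.c_pos
  -- all phases are within this bound
  have hT : ∀ a b, a ≤ K.n + 1 → b ≤ (K.c + 2) * (K.c + 3) + 1 →
      a * b ≤ 2 * K.n * (14 * K.c ^ 2) := by
    intro a b ha hb
    refine Nat.mul_le_mul (by omega) (hb.trans ?_)
    nlinarith
  refine .seq (((Search.prog_runs (K := K) (fun _ => rfl) (fun _ => rfl)).mono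
    (hT _ _ le_rfl ?_)).frame ?_)
  · nlinarith
  intro s1 hf1 hR1
  refine .seq (((Components.prog_runs (K := K) hR1 (hf1.reg .em rfl)
    (fun v => by rw [hf1.arr .lead rfl])).mono (hT _ _ le_rfl ?_)).frame ?_)
  · nlinarith
  rintro s2 hf2 ⟨hE2, hL2, hlead⟩
  have hrow2 : s2.arr .row = s1.arr .row := hf2.arr .row rfl
  have hcnt2 : s2.arr .cnt = s1.arr .cnt := hf2.arr .cnt rfl
  have hR2 : Components.Rows K s2 := by unfold Components.Rows; rw [hrow2, hcnt2]; exact hR1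
  refine .seq (((Order.prog_runs (K := K) (s := s2) ?_ ?_).mono ?_).frame ?_)
  · rw [hf2.reg .num rfl, hf1.reg .num rfl]
  · intro v hv
    obtain ⟨g1, g2⟩ := hlead v hv
    refine ⟨g1, fun h => ?_⟩
    rw [g2 h, card_eq_cnt (hR1 v hv) (g1.1 h).alive]
  · have h1 : (K.c + 1) * ((K.n + 1) * (0 + 1) + 1) ≤ (2 * K.c) * (3 * K.n) :=
      Nat.mul_le_mul (by omega) (by omega)
    have h2 : K.c * K.n ≤ K.c ^ 2 * K.n := Nat.mul_le_mul_right _ (by nlinarith)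
    nlinarith
  intro s3 hf3 hS3
  have e3 : ∀ k, k ≠ .ord → s3.arr k = s2.arr k := fun k hk =>
    hf3.arr k (by cases k <;> first | rfl | exact absurd rfl hk)
  have em3 : s3.reg .em = s2.reg .em := hf3.reg .em rfl
  have hR3 : Components.Rows K s3 := by
    unfold Components.Rows; rw [e3 _ (by simp), e3 _ (by simp)]; exact hR2
  have hz : ∀ k, k = .rep ∨ k = .last ∨ k = .par → s3.arr k = fun _ => 0 := by
    rintro k (rfl | rfl | rfl)
    · rw [e3 _ (by simp), hf2.arr .rep rfl, hf1.arr .rep rfl]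
    · rw [e3 _ (by simp), hf2.arr .last rfl, hf1.arr .last rfl]
    · rw [e3 _ (by simp), hf2.arr .par rfl, hf1.arr .par rfl]
  refine .seq (((Insertion.prog_runs (K := K) hN hR3 hS3 rfl (by
    rw [e3 _ (by simp), e3 _ (by simp), em3]; exact hE2) (by
    rw [e3 _ (by simp), em3]; exact hL2) (fun u => by rw [hz _ (by simp)])
    (fun u => by rw [hz _ (by simp)]) (fun u => by rw [hz _ (by simp)]) (by
    rw [hf3.reg .w rfl, hf2.reg .w rfl, hf1.reg .w rfl]; exact hn)).mono (hT _ _ le_rfl ?_)).frame ?_)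
  · nlinarith
  rintro s4 hf4 ⟨hE4, hw4, hone4, hl4, hrow4⟩
  have hR4 : Components.Rows K s4 :=
    hR3.congr (hf4.arr .cnt rfl) hrow4
  refine .seq (((Tables.prog_runs (K := K) hE4 rfl rfl rfl hR4 (fun j => by
    rw [hf4.arr .tab rfl, hf3.arr .tab rfl, hf2.arr .tab rfl, hf1.arr .tab rfl])).mono
    (hT _ _ le_rfl ?_)).frame ?_)
  · nlinarith
  intro s5 hf5 hI5
  refine (Traceback.prog_runs (K := K) hE4 (hf5.reg .em rfl) (hf5.arr .lx rfl) (hf5.arr .lp rfl)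
    hI5 (hf5.reg .w rfl) hw4 hone4 hl4 (fun j => by
    rw [hf5.arr .tgt rfl, hf4.arr .tgt rfl, hf3.arr .tgt rfl, hf2.arr .tgt rfl,
      hf1.arr .tgt rfl])).mono (hT _ _ le_rfl ?_)
  nlinarith

end Solve

/-! ### Reachability in directed co-graphs -/

namespace DiCoExpr

variable {V : Type} {X Y : DiCoExpr V} {u v : V}

open Relation

theorem verts_nonempty (X : DiCoExpr V) : X.verts.Nonempty := by
  induction X with
  | vertex v => exact ⟨v, rfl⟩
  | union X Y ihX _ => exact ihX.mono Set.subset_union_left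
  | series X Y ihX _ => exact ihX.mono Set.subset_union_left
  | order X Y ihX _ => exact ihX.mono Set.subset_union_left

theorem Arc.mem (h : X.Arc u v) : u ∈ X.verts ∧ v ∈ X.verts := by
  induction X with
  | vertex v => exact h.elim
  | union X Y ihX ihY =>
    rcases h with h | h
    · exact (ihX h).imp .inl .inl
    · exact (ihY h).imp .inr .inr
  | series X Y ihX ihY =>
    rcases h with h | h | h | h
    · exact (ihX h).imp .inl .inl
    · exact (ihY h).imp .inr .inr
    · exact h.imp .inl .inr
    · exact h.imp .inr .inl
  | order X Y ihX ihY =>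
    rcases h with h | h | h
    · exact (ihX h).imp .inl .inl
    · exact (ihY h).imp .inr .inr
    · exact h.imp .inl .inr

/-- A path cannot leave a part of the vertices that is closed under the arcs. -/
theorem reach_of_closed {r s : V → V → Prop} {S : Set V} (h : ReflTransGen r u v) (hu : u ∈ S)
    (hS : ∀ x y, x ∈ S → r x y → s x y ∧ y ∈ S) : ReflTransGen s u v ∧ v ∈ S := by
  induction h with
  | refl => exact ⟨.refl, hu⟩
  | tail _ h ih =>
    obtain ⟨h1, h2⟩ := hS _ _ ih.2 h
    exact ⟨ih.1.tail h1, h2⟩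

/-- Reachability in a directed co-graph does not contain the pattern `N`. -/
theorem nFree (X : DiCoExpr V) (hX : X.Valid) : ∀ a b c d, a ∈ X.verts → b ∈ X.verts →
    ReflTransGen X.Arc a c → ReflTransGen X.Arc b c → ReflTransGen X.Arc b d →
    ReflTransGen X.Arc a d ∨ ReflTransGen X.Arc a b ∨ ReflTransGen X.Arc b a ∨
      ReflTransGen X.Arc c d ∨ ReflTransGen X.Arc d c := by
  -- the claim for a part of the digraph implies the claim for the whole digraph
  have lift : ∀ {r s : V → V → Prop} {a b c d : V}, (∀ x y, r x y → s x y) →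
      (ReflTransGen r a d ∨ ReflTransGen r a b ∨ ReflTransGen r b a ∨
        ReflTransGen r c d ∨ ReflTransGen r d c) →
      (ReflTransGen s a d ∨ ReflTransGen s a b ∨ ReflTransGen s b a ∨
        ReflTransGen s c d ∨ ReflTransGen s d c) := by
    intro r s a b c d h
    have : ∀ x y, ReflTransGen r x y → ReflTransGen s x y := fun x y =>
      ReflTransGen.mono h x y
    exact Or.imp (this _ _) (Or.imp (this _ _) (Or.imp (this _ _) (Or.imp (this _ _) (this _ _))))
  induction X with
  | vertex v =>
    intro a b c d ha hb _ _ hbd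
    obtain rfl : a = v := ha
    obtain rfl : b = a := hb
    exact .inl hbd
  | union X Y ihX ihY =>
    obtain ⟨hvX, hvY, hdis⟩ := hX
    have hd := Set.disjoint_left.1 hdis
    have sX : ∀ {u v}, ReflTransGen (union X Y).Arc u v → u ∈ X.verts →
        ReflTransGen X.Arc u v ∧ v ∈ X.verts := fun h hu => reach_of_closed h hu fun x y hx hxy =>
      hxy.elim (fun h => ⟨h, h.mem.2⟩) fun h => absurd h.mem.1 (hd hx)
    have sY : ∀ {u v}, ReflTransGen (union X Y).Arc u v → u ∈ Y.verts →
        ReflTransGen Y.Arc u v ∧ v ∈ Y.verts := fun h hu => reach_of_closed h hu fun x y hx hxy =>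
      hxy.elim (fun h => absurd hx (hd h.mem.1)) fun h => ⟨h, h.mem.2⟩
    intro a b c d ha hb hac hbc hbd
    rcases ha with ha | ha <;> rcases hb with hb | hb
    · exact lift (fun _ _ h => .inl h) (ihX hvX a b c d ha hb (sX hac ha).1 (sX hbc hb).1 (sX hbd hb).1)
    · exact absurd (sY hbc hb).2 (hd (sX hac ha).2)
    · exact absurd (sY hac ha).2 (hd (sX hbc hb).2)
    · exact lift (fun _ _ h => .inr h) (ihY hvY a b c d ha hb (sY hac ha).1 (sY hbc hb).1 (sY hbd hb).1)
  | series X Y ihX ihY =>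
    -- any two vertices reach each other
    obtain ⟨x, hx⟩ := X.verts_nonempty
    obtain ⟨y, hy⟩ := Y.verts_nonempty
    have hXY : ∀ {u v}, u ∈ X.verts → v ∈ Y.verts → ReflTransGen (series X Y).Arc u v :=
      fun hu hv => .single (.inr (.inr (.inl ⟨hu, hv⟩)))
    have hYX : ∀ {u v}, u ∈ Y.verts → v ∈ X.verts → ReflTransGen (series X Y).Arc u v :=
      fun hu hv => .single (.inr (.inr (.inr ⟨hu, hv⟩)))
    intro a b c d ha hb _ _ hbd
    have hd : d ∈ (series X Y).verts := by
      rcases hbd.cases_tail with rfl | ⟨e, _, h⟩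
      · exact hb
      · exact h.mem.2
    left
    rcases ha with ha | ha <;> rcases hd with hd | hd
    · exact (hXY ha hy).trans (hYX hy hd)
    · exact hXY ha hd
    · exact hYX ha hd
    · exact (hYX ha hx).trans (hXY hx hd)
  | order X Y ihX ihY =>
    obtain ⟨hvX, hvY, hdis⟩ := hX
    have hd := Set.disjoint_left.1 hdis
    have sY : ∀ {u v}, ReflTransGen (order X Y).Arc u v → u ∈ Y.verts →
        ReflTransGen Y.Arc u v ∧ v ∈ Y.verts := fun h hu => reach_of_closed h hu fun x y hx hxy => by
      rcases hxy with h | h | h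
      · exact absurd hx (hd h.mem.1)
      · exact ⟨h, h.mem.2⟩
      · exact absurd hx (hd h.1)
    have sX : ∀ {u v}, ReflTransGen (order X Y).Arc u v → u ∈ X.verts →
        ReflTransGen X.Arc u v ∧ v ∈ X.verts ∨ v ∈ Y.verts := by
      intro u v h hu
      induction h with
      | refl => exact .inl ⟨.refl, hu⟩
      | tail _ h ih =>
        rcases h with h | h | h
        · rcases ih with ih | ih
          · exact .inl ⟨ih.1.tail h, h.mem.2⟩
          · exact absurd ih (hd h.mem.1)
        · exact .inr h.mem.2
        · exact .inr h.2
    have hXY : ∀ {u v}, u ∈ X.verts → v ∈ Y.verts → ReflTransGen (order X Y).Arc u v :=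
      fun hu hv => .single (.inr (.inr ⟨hu, hv⟩))
    intro a b c d ha hb hac hbc hbd
    rcases ha with ha | ha <;> rcases hb with hb | hb
    · rcases sX hbd hb with hd' | hd'
      · rcases sX hbc hb with hc | hc
        · rcases sX hac ha with hc' | hc'
          · exact lift (fun _ _ h => .inl h) (ihX hvX a b c d ha hb hc'.1 hc.1 hd'.1)
          · exact absurd hc' (hd hc.2)
        · exact .inr (.inr (.inr (.inr (hXY hd'.2 hc))))
      · exact .inl (hXY ha hd')
    · exact .inr (.inl (hXY ha hb))
    · exact .inr (.inr (.inl (hXY hb ha)))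
    · exact lift (fun _ _ h => .inr (.inl h))
        (ihY hvY a b c d ha hb (sY hac ha).1 (sY hbc hb).1 (sY hbd hb).1)

end DiCoExpr

/-! ### The input of the machine -/

namespace SSGInstance

variable {n : ℕ} (I : SSGInstance n) (adj : Fin n → List (Fin n))

/-- The size of an item, and `0` outside of the items. -/
def szNat (v : ℕ) : ℕ := if h : v < n then I.size ⟨v, h⟩ else 0

/-- The position at which the list of successors of `v` begins. -/
def offset (v : ℕ) : ℕ := (((List.ofFn adj).take v).map List.length).sum

/-- The list of successors with natural numbers as vertices. -/
def nbNat (v : ℕ) : List ℕ := if h : v < n then (adj ⟨v, h⟩).map Fin.val else []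

theorem encode_zero : (I.encode adj)[0]? = some n := by simp [encode]

theorem encode_one : (I.encode adj)[1]? = some I.cap := by simp [encode]

theorem encode_size {v : ℕ} (hv : v < n) : (I.encode adj)[v + 2]? = some (I.szNat v) := by
  simp [encode, szNat, hv, List.getElem?_append]

theorem encode_offset {v : ℕ} (hv : v ≤ n) : (I.encode adj)[n + 2 + v]? = some (offset adj v) := by
  unfold encode
  rw [List.append_assoc, List.getElem?_append_right (by simp)]
  rw [List.getElem?_append_left (by simp; omega)]
  have : n + 2 + v - ([n, I.cap] ++ List.ofFn I.size).length = v := by simp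
  rw [this]
  simp [offset, show v < n + 1 by omega]

theorem offset_succ {v : ℕ} (hv : v < n) :
    offset adj (v + 1) = offset adj v + (nbNat adj v).length := by
  unfold offset
  rw [List.take_add_one]
  simp [nbNat, hv]

/-- Positions in a concatenation of lists. -/
theorem flatten_getElem? {α : Type*} (l : List (List α)) {v i : ℕ} (hv : v < l.length)
    (hi : i < l[v].length) :
    l.flatten[((l.take v).map List.length).sum + i]? = some l[v][i] := by
  have e : l.flatten = (l.take v).flatten ++ (l.drop v).flatten := by
    rw [← List.flatten_append, List.take_append_drop]
  rw [e, List.getElem?_append_right (by simp [List.length_flatten])]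
  rw [List.length_flatten, Nat.add_sub_cancel_left, List.drop_eq_getElem_cons hv, List.flatten_cons,
    List.getElem?_append_left hi]
  simp

theorem encode_nb {v i : ℕ} (hv : v < n) (hi : i < (nbNat adj v).length) :
    (I.encode adj)[2 * n + 3 + (offset adj v + i)]? = some (nbNat adj v)[i] := by
  unfold encode
  rw [List.getElem?_append_right (by simp; omega)]
  have : 2 * n + 3 + (offset adj v + i) - ([n, I.cap] ++ List.ofFn I.size ++
      (List.range (n + 1)).map
        fun i => (((List.ofFn adj).take i).map List.length).sum).length = offset adj v + i := by
    simp; omega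
  rw [this, List.getElem?_map]
  have hi' : i < (adj ⟨v, hv⟩).length := by simpa [nbNat, hv] using hi
  unfold offset
  rw [flatten_getElem? (List.ofFn adj) (v := v) (i := i) (by simpa) (by simpa)]
  simp [nbNat, hv]

theorem mem_nbNat (hadj : I.IsAdjacencyLists adj) {x y : ℕ} :
    y ∈ nbNat adj x ↔ ∃ (hx : x < n) (hy : y < n), I.graph.Adj ⟨x, hx⟩ ⟨y, hy⟩ := by
  unfold nbNat
  split_ifs with hx
  · simp only [List.mem_map, (hadj ⟨x, hx⟩).2, hx, exists_true_left]
    constructor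
    · rintro ⟨w, hw, rfl⟩; exact ⟨w.2, hw⟩
    · rintro ⟨hy, h⟩; exact ⟨⟨y, hy⟩, h, rfl⟩
  · simp [hx]

theorem nbNat_length_le (hadj : I.IsAdjacencyLists adj) (v : ℕ) : (nbNat adj v).length ≤ n := by
  unfold nbNat
  split_ifs with hv
  · simpa using (hadj ⟨v, hv⟩).1.length_le_card
  · simp

theorem offset_le (hadj : I.IsAdjacencyLists adj) {v : ℕ} (hv : v ≤ n) : offset adj v ≤ v * n := by
  induction v with
  | zero => simp [offset]
  | succ v ih =>
    rw [offset_succ adj (by omega), add_mul, one_mul]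
    exact Nat.add_le_add (ih (by omega)) (nbNat_length_le I adj hadj v)

/-- All words of the input are polynomially bounded. -/
theorem encode_le (hadj : I.IsAdjacencyLists adj) : ∀ a ∈ I.encode adj,
    a ≤ (n + I.cap + ∑ v, I.size v) ^ 4 := by
  set B := n + I.cap + ∑ v, I.size v with hB
  have hB1 : 1 ≤ B := by have := I.cap_pos; omega
  have h1 : B ≤ B ^ 4 := Nat.le_self_pow (by simp) B
  have h2 : B * B ≤ B ^ 4 := by
    calc B * B = B ^ 2 := (sq B).symm
      _ ≤ B ^ 4 := Nat.pow_le_pow_right hB1 (by simp)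
  intro a ha
  simp only [encode, List.mem_append, List.mem_cons, List.not_mem_nil, or_false, List.mem_map,
    List.mem_range, List.mem_ofFn'] at ha
  rcases ha with (((rfl | rfl) | ⟨v, rfl⟩) | ⟨v, hv, rfl⟩) | ⟨v, _, rfl⟩
  · omega
  · omega
  · have := Finset.single_le_sum (f := I.size) (fun _ _ => Nat.zero_le _) (Finset.mem_univ v)
    omega
  · have := offset_le I adj hadj (show v ≤ n by omega)
    have h3 : v * n ≤ B * B := Nat.mul_le_mul (by omega) (by omega)
    unfold offset at this
    omega
  · have := v.2
    omega

/-- The instance on the machine with the resources determined by `k`. All stored numbers are bounded by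
the fourth power of `n + c + ∑ s`, so that `k = 241` allows for intermediate results up to the
`60`-th power of that bound, and for `33` cells per vertex and unit of capacity. -/
def net (hadj : I.IsAdjacencyLists adj) (hn : 0 < n) (k : ℕ) (hk : 241 ≤ k) : Net :=
  have hB : 3 ≤ n + I.cap + ∑ v, I.size v := by
    have h1 := I.cap_pos
    have h2 := Finset.single_le_sum (f := I.size) (fun _ _ => Nat.zero_le _)
      (Finset.mem_univ ⟨0, hn⟩)
    have h3 := I.size_pos ⟨0, hn⟩
    omega
  have inp_eq : ∀ {i a : ℕ}, (I.encode adj)[i]? = some a → i < (I.encode adj).length ∧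
      (I.encode adj).getD i 0 = a := fun h =>
    ⟨(List.getElem?_eq_some_iff.1 h).1, by rw [List.getD_eq_getElem?_getD, h]; rfl⟩
  { M := ⟨I.encode adj, k * (n * I.cap), (n + I.cap + ∑ v, I.size v) ^ k⟩
    n := n
    c := I.cap
    X := (n + I.cap + ∑ v, I.size v) ^ 4
    n_pos := hn
    c_pos := I.cap_pos
    input_zero := encode_zero I adj
    input_one := encode_one I adj
    le_X := encode_le I adj hadj
    mul_le_X := by
      have hc := I.cap_pos
      show 4 * ((n + 1) * (I.cap + 1)) ≤ _
      calc 4 * ((n + 1) * (I.cap + 1))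
          ≤ (n + I.cap + ∑ v, I.size v) ^ 2 * ((n + I.cap + ∑ v, I.size v) *
            (n + I.cap + ∑ v, I.size v)) :=
            Nat.mul_le_mul (by nlinarith) (Nat.mul_le_mul (by omega) (by omega))
        _ = _ := by ring
    X_lt := by
      rw [← pow_mul]
      exact Nat.pow_lt_pow_right (by omega) (by omega)
    cells := by
      have : n * 1 ≤ n * I.cap := Nat.mul_le_mul_left _ I.cap_pos
      have : 33 * (n * I.cap) ≤ k * (n * I.cap) := Nat.mul_le_mul_right _ (by omega)
      show n + 16 * (2 * (n * I.cap)) ≤ k * (n * I.cap)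
      omega
    sz := I.szNat
    sz_pos := fun v hv => by simp [szNat, show v < n from hv, I.size_pos]
    nb := nbNat adj
    nb_nodup := fun v hv => by
      have hv : v < n := hv
      simp only [nbNat, hv, dif_pos]
      exact (hadj _).1.map Fin.val_injective
    nb_lt := fun v _ y hy => ((mem_nbNat I adj hadj).1 hy).2.1
    off := offset adj
    inp_sz := fun v hv => inp_eq (encode_size I adj hv)
    inp_off := fun v hv => inp_eq (encode_offset I adj (le_of_lt hv))
    inp_off_succ := fun v hv => by
      have hv : v < n := hv
      have h := encode_offset I adj (show v + 1 ≤ n from hv)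
      rw [offset_succ adj hv, show n + 2 + (v + 1) = n + 3 + v by omega] at h
      exact inp_eq h
    inp_nb := fun v hv i hi => inp_eq (encode_nb I adj hv hi)
    total_le := by
      have : ∑ y ∈ Finset.range n, I.szNat y = ∑ v, I.size v := by
        rw [Finset.sum_range]
        simp [szNat]
      show I.cap + ∑ y ∈ Finset.range n, I.szNat y ≤ _
      rw [this]
      exact le_trans (by omega) (Nat.le_self_pow (by simp) _)
    off_lt := fun v hv => by
      have hv : v < n := hv
      rw [← offset_succ adj hv]
      have h1 := offset_le I adj hadj (show v + 1 ≤ n from hv)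
      have h2 : (v + 1) * n ≤ (n + I.cap + ∑ v, I.size v) ^ 2 := by
        rw [sq]; exact Nat.mul_le_mul (by omega) (by omega)
      have h3 := Nat.pow_lt_pow_right (show 1 < n + I.cap + ∑ v, I.size v by omega)
        (show 2 < 4 by simp)
      omega }

variable {I adj}

theorem net_R_iff (hadj : I.IsAdjacencyLists adj) {hn : 0 < n} {k : ℕ} {hk : 241 ≤ k} {x y : ℕ}
    (hx : x < n) : (I.net adj hadj hn k hk).R x y ↔
      ∃ hy : y < n, Relation.ReflTransGen I.graph.Adj ⟨x, hx⟩ ⟨y, hy⟩ := by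
  constructor
  · intro h
    induction h with
    | refl => exact ⟨hx, .refl⟩
    | tail _ h ih =>
      obtain ⟨hy, h1⟩ := ih
      obtain ⟨_, hz, h2⟩ := (mem_nbNat I adj hadj).1 h
      exact ⟨hz, h1.tail h2⟩
  · rintro ⟨hy, h⟩
    exact h.lift (p := fun x y => y ∈ nbNat adj x) Fin.val fun a b hab =>
      (mem_nbNat I adj hadj).2 ⟨a.2, b.2, hab⟩

theorem net_nFree (hadj : I.IsAdjacencyLists adj) {hn : 0 < n} {k : ℕ} {hk : 241 ≤ k}
    (hG : IsDirectedCograph I.graph) : NFree (I.net adj hadj hn k hk) := by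
  obtain ⟨X, h1, h2, h3⟩ := hG
  have e : I.graph.Adj = X.Arc := by funext u v; exact propext (h3 u v)
  intro a b c d (ha : a < n) (hb : b < n) hac hbc hbd
  obtain ⟨hc, hac⟩ := (net_R_iff hadj ha).1 hac
  obtain ⟨_, hbc⟩ := (net_R_iff hadj hb).1 hbc
  obtain ⟨hd, hbd⟩ := (net_R_iff hadj hb).1 hbd
  rw [net_R_iff hadj ha, net_R_iff hadj ha, net_R_iff hadj hb, net_R_iff hadj hc,
    net_R_iff hadj hd]
  simp only [ha, hb, hc, hd, exists_true_left]
  rw [e] at *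
  exact X.nFree h1 _ _ _ _ (by simp [h2]) (by simp [h2]) hac hbc hbd

/-- The feasible sets are the sets that are closed under reachability. -/
theorem isUpSet_map_iff (hadj : I.IsAdjacencyLists adj) {hn : 0 < n} {k : ℕ} {hk : 241 ≤ k}
    {A : Finset (Fin n)} : Net.IsUpSet (I.net adj hadj hn k hk) (A.map Fin.valEmbedding) ↔
      I.Feasible A := by
  have hsum : ∑ v ∈ A.map Fin.valEmbedding, (I.net adj hadj hn k hk).sz v = I.total A := by
    rw [Finset.sum_map]
    refine Finset.sum_congr rfl fun v _ => ?_
    show I.szNat v = I.size v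
    simp [szNat]
  constructor
  · rintro ⟨h1, h2, h3⟩
    refine ⟨by rw [← hsum]; exact h3, ?_⟩
    rintro y ⟨x, hx, hxy⟩
    have := h2 x (Finset.mem_map_of_mem Fin.valEmbedding hx) y
      ((net_R_iff hadj x.2).2 ⟨y.2, .single hxy⟩)
    exact (Finset.mem_map' Fin.valEmbedding).1 this
  · rintro ⟨h1, h2⟩
    refine ⟨?_, ?_, by rw [hsum]; exact h1⟩
    · intro v hv
      obtain ⟨x, _, rfl⟩ := Finset.mem_map.1 hv
      exact x.2
    · intro v hv y hr
      obtain ⟨x, hx, rfl⟩ := Finset.mem_map.1 hv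
      obtain ⟨hy, hr⟩ := (net_R_iff hadj x.2).1 hr
      refine Finset.mem_map.2 ⟨⟨y, hy⟩, ?_, rfl⟩
      generalize (⟨y, hy⟩ : Fin n) = z at hr
      induction hr with
      | refl => exact hx
      | tail _ h ih => exact h2 _ ⟨_, ih, h⟩

theorem sum_map_sz (hadj : I.IsAdjacencyLists adj) {hn : 0 < n} {k : ℕ} {hk : 241 ≤ k}
    {A : Finset (Fin n)} :
    ∑ v ∈ A.map Fin.valEmbedding, (I.net adj hadj hn k hk).sz v = I.total A := by
  rw [Finset.sum_map]
  refine Finset.sum_congr rfl fun v _ => ?_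
  show I.szNat v = I.size v
  simp [szNat]

end SSGInstance

theorem theorem3p3 :
    ∃ (P : RamProg) (K : ℕ), ∀ (n : ℕ) (I : SSGInstance n), IsDirectedCograph I.graph →
      ∀ adj : Fin n → List (Fin n), I.IsAdjacencyLists adj →
        ∃ (t : ℕ) (τ : RamState) (A : Finset (Fin n)),
          RamRun
            { input := I.encode adj
              cells := K * (n * I.cap)
              bound := (n + I.cap + ∑ v, I.size v) ^ K }
            P RamState.start t τ ∧
          t ≤ K * (n * I.cap ^ 2 + I.numArcs) ∧
          I.IsOptimal A ∧
          ∀ v : Fin n, τ.mem v = if v ∈ A then 1 else 0 := by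
  refine ⟨Solve.prog.compile, 29 * Solve.prog.compile.length + 241, fun n I hG adj hadj => ?_⟩
  have hn : 0 < n := by
    obtain ⟨X, _, _, _⟩ := hG
    obtain ⟨v, _⟩ := X.verts_nonempty
    exact v.pos
  set N := I.net adj hadj hn (29 * Solve.prog.compile.length + 241) (by omega) with hN
  obtain ⟨t, τ, s, hrun, ht, hrep, -, -, A, hA, hopt, hout⟩ :=
    Solve.prog_runs (K := N) (SSGInstance.net_nFree hadj hG) rfl RamState.start
      ⟨fun _ => rfl, fun _ _ _ => rfl⟩ ⟨fun _ => Nat.zero_le _, fun _ _ => Nat.zero_le _⟩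
  set A' : Finset (Fin n) := Finset.univ.filter fun v => v.val ∈ A with hA'
  have hmap : A'.map Fin.valEmbedding = A := by
    ext v
    simp only [Finset.mem_map, hA', Finset.mem_filter, Finset.mem_univ, true_and,
      Fin.valEmbedding_apply]
    exact ⟨by rintro ⟨x, hx, rfl⟩; exact hx, fun h => ⟨⟨v, hA.lt v h⟩, h, rfl⟩⟩
  refine ⟨t, τ, A', hrun, ht.trans ?_, ⟨?_, fun B hB => ?_⟩, fun v => ?_⟩
  · show Solve.prog.compile.length * (2 * n * (14 * I.cap ^ 2) + 1) ≤ _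
    have h1 : 1 ≤ n * I.cap ^ 2 := Nat.mul_pos hn (Nat.pow_pos I.cap_pos)
    calc Solve.prog.compile.length * (2 * n * (14 * I.cap ^ 2) + 1)
        ≤ Solve.prog.compile.length * (29 * (n * I.cap ^ 2)) :=
          Nat.mul_le_mul_left _ (by nlinarith)
      _ = (29 * Solve.prog.compile.length) * (n * I.cap ^ 2) := by ring
      _ ≤ _ := Nat.mul_le_mul (by omega) (by omega)
  · rw [← SSGInstance.isUpSet_map_iff hadj, hmap]
    exact hA
  · have := hopt _ ((SSGInstance.isUpSet_map_iff hadj).2 hB)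
    rw [← hmap] at this
    simpa only [hN, SSGInstance.sum_map_sz] using this
  · have h1 := hrep.2 .out v v.2
    have h2 := hout v v.2
    rw [h2] at h1
    simpa [Env.loc, hA'] using h1
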